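/- Let $a<c<b$ and let $W:\mathbb R\to[0,\infty)$ be of class $C^2$ with $W''$ locally Hölder continuous with some exponent in $(0,1)$. Assume that $W$ vanishes exactly at $a$ and $b$, that $W''(a)>0$ and $W''(b)>0$, that $\lim_{s\to-\infty}W'(s)=-\infty$ and $\lim_{s\to\infty}W'(s)=\infty$, and that $W'$ vanishes exactly at $a,b,c$, with $W''(c)<0$. Write $$C_W:=2\int_a^bW^{1/2}(\rho)\,d\rho,\qquad \mathrm d_W(r,s):=2\Big|\int_r^sW^{1/2}(\rho)\,d\rho\Big| \quad\text{if } r \text{ or } s \text{ belongs to } \{a,b\}.$$ Let $a<\alpha_-<\min\{c,\frac{a+b}2\}$, $T>0$, $I:=(0,T)$, and $\omega\in C^{1,d}([0,T])$ for some $d\in(0,1]$, with $\min_{[0,T]}\omega>0$ and $$\omega(t)>\omega(0)-\omega_0\quad\text{for all }t\in(0,T],\qquad\text{where } 0\le\omega_0<\frac12\,\frac{\mathrm d_W(a,\alpha_-)}{C_W}\,\omega(0).$$ Let $A_0,B_0>0$. For $0<\varepsilon<1$ and $v\in H^1(I)$ let $$G_\varepsilon(v):=\int_0^T\big(W(v)+\varepsilon^2(v')^2\big)\,\omega\,dt,\qquad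 G^{(2)}_\varepsilon(v):=\int_0^T\Big(\frac1{\varepsilon^2}W(v)+(v')^2\Big)\omega\,dt-\frac1\varepsilon\,\mathrm d_W(\alpha,b)\,\omega(0).$$ Then there exist $0<\varepsilon_0<1$, $C>0$, $l_0>1$, $\mu>0$, $\gamma_0>0$, depending only on $\alpha_-,A_0,B_0,T,\omega,W$, and, for every $\gamma>1$, a number $\gamma_1>0$ depending only on these data and on $\gamma$, such that the following holds. Let $\alpha\in\mathbb R$ and let $\alpha_\varepsilon,\beta_\varepsilon$, $0<\varepsilon<1$, satisfy $$\alpha_-\le\alpha_\varepsilon\le b,\quad \alpha_-\le\beta_\varepsilon\le b,\quad |\alpha_\varepsilon-\alpha|\le A_0\varepsilon^\gamma,\quad|\beta_\varepsilon-b|\le B_0\varepsilon^\gamma .$$ For every $0<\varepsilon<1$ let $v_\varepsilon$ be a minimizer of $G_\varepsilon$ over all $v\in H^1(I)$ with $v(0)=\alpha_\varepsilon$ and $v(T)=\beta_\varepsilon$. Set $w_\varepsilon(s):=v_\varepsilon(\varepsilon s)$ for $0\le s\le T\varepsilon^{-1}$ and $w_\varepsilon(s):=\beta_\varepsilon$ for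 $s>T\varepsilon^{-1}$. Then 1. for all $0<\varepsilon<\varepsilon_0$ and all $l>l_0$, $$G^{(2)}_\varepsilon(v_\varepsilon)\ \ge\ 2\omega'(0)\int_0^lW^{1/2}(w_\varepsilon)\,w_\varepsilon'\,s\,ds-Ce^{-l\mu}(l\mu+1)-C\varepsilon^{1/2}l^2-C\varepsilon^{\gamma_1}|\log\varepsilon|^{2+\gamma_0};$$ 2. if $z_\alpha:\mathbb R\to\mathbb R$ solves $z_\alpha'=W^{1/2}(z_\alpha)$, $z_\alpha(0)=\alpha$, then for every $l>0$ $$\lim_{\varepsilon\to0^+}\int_0^lW^{1/2}(w_\varepsilon)\,w_\varepsilon'\,s\,ds=\int_0^lW^{1/2}(z_\alpha)\,z_\alpha'\,s\,ds;$$ 3. in particular, the function $s\mapsto W^{1/2}(z_\alpha)z_\alpha' s$ is integrable on $(0,\infty)$ and $$\liminf_{\varepsilon\to0^+}G^{(2)}_\varepsilon(v_\varepsilon)\ \ge\ 2\omega'(0)\int_0^\infty W^{1/2}(z_\alpha)\,z_\alpha'\,s\,ds .$$ -/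

import Mathlib

open Set Filter Topology MeasureTheory
open scoped NNReal

noncomputable section

namespace CahnHilliard1D

/-- Double-well potentials: `W : ℝ → [0, ∞)` is of class `C^{2,α₀}` for some `α₀ ∈ (0,1)` (the Hölder
condition on `W''` being local, since `W''` may be unbounded), it vanishes precisely at the wells
`a < b`, which are nondegenerate, `W'` tends to `±∞` at `±∞`, and `W'` has exactly the three zeros
`a < c < b`, with `W''(c) < 0`. -/
structure IsDoubleWell (W : ℝ → ℝ) (a b c : ℝ) : Prop where
  nonneg : ∀ s, 0 ≤ W s
  contDiff : ContDiff ℝ 2 W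
  holder : ∃ α₀ : ℝ≥0, 0 < α₀ ∧ α₀ < 1 ∧
    ∀ R : ℝ, ∃ K : ℝ≥0, HolderOnWith K α₀ (deriv (deriv W)) (Icc (-R) R)
  lt_left : a < c
  lt_right : c < b
  zero_iff : ∀ s, W s = 0 ↔ s = a ∨ s = b
  deriv2_left : 0 < deriv (deriv W) a
  deriv2_right : 0 < deriv (deriv W) b
  tendsto_atBot : Tendsto (deriv W) atBot atBot
  tendsto_atTop : Tendsto (deriv W) atTop atTop
  deriv_zero_iff : ∀ s, deriv W s = 0 ↔ s = a ∨ s = b ∨ s = c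
  deriv2_mid : deriv (deriv W) c < 0

/-- Derivative of the weight on the closed interval `[0, T]`, one-sided at the endpoints. -/
def weightDeriv (T : ℝ) (ω : ℝ → ℝ) (t : ℝ) : ℝ := derivWithin ω (Icc 0 T) t

/-- Weights: `ω ∈ C^{1,d}([0,T])` for some `d ∈ (0,1]`, and `ω` is positive on `[0,T]`
(equivalently, its minimum there is positive). -/
structure IsWeight (T : ℝ) (ω : ℝ → ℝ) : Prop where
  contDiffOn : ContDiffOn ℝ 1 ω (Icc 0 T)
  holder : ∃ d K : ℝ≥0, 0 < d ∧ d ≤ 1 ∧ HolderOnWith K d (weightDeriv T ω) (Icc 0 T)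
  pos : ∀ t ∈ Icc 0 T, 0 < ω t

/-- The geodesic distance `d_W(r, s) = 2 |∫_r^s W^{1/2}|`. It is only used when `r` or `s` is a well. -/
def dW (W : ℝ → ℝ) (r s : ℝ) : ℝ := 2 * |∫ ρ in r..s, √(W ρ)|

/-- The constant `C_W = 2 ∫_a^b W^{1/2}`. -/
def CW (W : ℝ → ℝ) (a b : ℝ) : ℝ := 2 * ∫ ρ in a..b, √(W ρ)

/-- `v` is, on `[0, T]`, the continuous representative of an element of `H¹((0, T))`: it is absolutely
continuous on `[0, T]` and its almost everywhere derivative, which is its weak derivative, is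
square-integrable. (The values of `v` outside `[0, T]` are irrelevant.) -/
def IsH1 (T : ℝ) (v : ℝ → ℝ) : Prop :=
  AbsolutelyContinuousOnInterval v 0 T ∧ MemLp (deriv v) 2 (volume.restrict (Ioo 0 T))

/-- Competitors: `H¹((0,T))` functions with Dirichlet data `v(0) = α'`, `v(T) = β'`. -/
def IsAdmissible (T α' β' : ℝ) (v : ℝ → ℝ) : Prop :=
  IsH1 T v ∧ v 0 = α' ∧ v T = β'

/-- The functional `G_ε(v) = ∫_0^T (W(v) + ε² (v')²) ω dt`. It is finite on `H¹((0,T))`. -/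
def G (W ω : ℝ → ℝ) (T ε : ℝ) (v : ℝ → ℝ) : ℝ :=
  ∫ t in (0 : ℝ)..T, (W (v t) + ε ^ 2 * (deriv v t) ^ 2) * ω t

/-- `v` minimizes `G_ε` among all competitors with Dirichlet data `α'`, `β'`. -/
def IsMinimizer (W ω : ℝ → ℝ) (T ε α' β' : ℝ) (v : ℝ → ℝ) : Prop :=
  IsAdmissible T α' β' v ∧ ∀ u, IsAdmissible T α' β' u → G W ω T ε v ≤ G W ω T ε u

/-- `G⁽¹⁾_ε = G_ε / ε`, on competitors. -/
def G1 (W ω : ℝ → ℝ) (T ε : ℝ) (v : ℝ → ℝ) : ℝ := G W ω T ε v / ε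

/-- `G⁽²⁾_ε(v) = (G⁽¹⁾_ε(v) - d_W(α, b) ω(0)) / ε`, on competitors, where `d_W(α, b) ω(0)` is the
minimum of the first-order limit. -/
def G2 (W ω : ℝ → ℝ) (T b α ε : ℝ) (v : ℝ → ℝ) : ℝ :=
  (G1 W ω T ε v - dW W α b * ω 0) / ε

/-- The rescaled profile `w(s) = v(ε s)` for `0 ≤ s ≤ T / ε`, extended by the constant `v(T)` to
`s ≥ T / ε`. -/
def rescale (T ε : ℝ) (v : ℝ → ℝ) (s : ℝ) : ℝ := v (min (ε * s) T)

/-- `z` is a global solution of the Cauchy problem `z' = W^{1/2}(z)`, `z(0) = α`. -/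
def IsCauchySolution (W : ℝ → ℝ) (α : ℝ) (z : ℝ → ℝ) : Prop :=
  (∀ t, HasDerivAt z (√(W (z t))) t) ∧ z 0 = α

/-- The integrand `W^{1/2}(w) w' s`. -/
def momentIntegrand (W w : ℝ → ℝ) (s : ℝ) : ℝ := √(W (w s)) * deriv w s * s

end CahnHilliard1D

end

/-!
Let `Φ(x) = ∫_b^x W^{1/2}` (`wellPrimitive`), so that `d_W(r, s) = 2 |Φ(s) - Φ(r)|`. Completing the
square, `W(v) + ε² (v')² = (ε v' - W^{1/2}(v))² + 2 ε (Φ ∘ v)'`, and an integration by parts against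
the weight turns the last term into boundary terms and `-2 ε ∫ Φ(v) ω'`
(`IsH1.integral_energyDensity_eq`). The boundary term at `0` is the first-order energy that `G⁽²⁾`
subtracts, up to `|Φ(α_ε) - Φ(α)|`; the one at `T` is of order `(β_ε - b)²`, because `Φ` vanishes
quadratically at the well `b`. What remains is `-2 ε⁻¹ ∫ Φ(v_ε) ω'`. As soon as `Φ(v_ε)` concentrates
in a layer of width `ε` at `0`, the factor `ω'` may be replaced by `ω'(0)` at the expense of its Hölder
modulus, and `-ε⁻¹ ∫_0^{εl} Φ(v_ε)` is, after a second integration by parts, the moment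
`∫_0^l W^{1/2}(w_ε) w_ε' s ds` up to a boundary term at `εl`. This is `IsH1.moment_sub_le_G2`, which
holds for every competitor and drops the nonnegative defect `(ε v' - W^{1/2}(v))²`. The theorem is
thereby reduced to the decay of `Φ(v_ε)` away from `t = 0`.

Minimality gives the decay through comparison only; neither the Euler-Lagrange equation nor the
regularity of minimizers is used.

* A competitor that follows a regularization of `ε u' = W^{1/2}(u)` from `α_ε` to `β_ε` shows that the
  minimal energy is at most `ε (-2 Φ(α_ε) ω(0) + o(1))`, uniformly in the data
  (`exists_admissible_le_of_isDoubleWell`).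
* A minimizer that came close to `a` would have to descend from `α_ε ≥ α₋` and climb back to
  `β_ε ≈ b`, at a cost that exceeds this bound because `ω > ω(0) - ω₀` and
  `ω₀ < d_W(a, α₋) ω(0) / (2 C_W)`. So minimizers take values in a compact interval `[a', b']` with
  `a < a'`, on which `W` is comparable to `(· - b)²` (`exists_confinement`).
* On such an interval the convex combination of `v_ε` and the constant `β_ε` that changes from the
  first to the second on `[t, t + ε]` has energy on this layer controlled by that of `v_ε`. Hence the
  energy of `v_ε` after `t` is bounded by a fixed multiple of its energy on `[t, t + ε]`
  (`IsMinimizer.tailEnergy_le`), and filling the hole makes it decay geometrically from layer to layer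
  (`exists_minimizer_estimates`). As `|Φ| ≲ (· - b)² ≲ W` on `[a', b']`, the same decay holds for
  `Φ(v_ε)`, integrated and pointwise (`exists_wellPrimitive_estimates`), which proves the lower bound
  (`exists_moment_sub_le_G2`).

For the limit, the identity above compared with the sharp upper bound shows that
`∫ (ε v_ε' - W^{1/2}(v_ε))²` is `o(ε)` (`exists_integral_equipartitionDefect_le`). After rescaling,
`w_ε` therefore solves `w' = W^{1/2}(w)` up to an error that tends to zero in `L²`, and since `W^{1/2}`
is locally Lipschitz, Grönwall's inequality makes `w_ε` converge to `z_α` uniformly on bounded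
intervals. The moments depend on `w_ε` only through `Φ(w_ε)`, so they converge too (`tendsto_moment`).
The decay of `Φ(v_ε)` bounds them uniformly in `l` (`exists_abs_moment_le`), so the nonnegative
integrand of `z_α` is integrable on `(0, ∞)`, and the inequality for the lower limit follows by letting
first `ε → 0` and then `l → ∞`.
-/

namespace CahnHilliard1D

/-! ### The potential and its geodesic primitive -/

/-- First-order Taylor expansion with a quadratic remainder, uniform on compact sets. -/
lemma exists_taylor_bound {W : ℝ → ℝ} (hW : ContDiff ℝ 2 W) (R : ℝ) :
    ∃ M : ℝ, 0 < M ∧ ∀ x ∈ Icc (-R) R, ∀ y ∈ Icc (-R) R,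
      |W y - W x - deriv W x * (y - x)| ≤ M * (y - x) ^ 2 := by
  have h1 : ContDiff ℝ 1 (deriv W) := ContDiff.deriv' (n := 1) (by norm_num; exact hW)
  have h0 : Continuous (deriv (deriv W)) := h1.continuous_deriv (by norm_num)
  have hd : Differentiable ℝ W := hW.differentiable (by norm_num)
  have hd1 : Differentiable ℝ (deriv W) := h1.differentiable (by norm_num)
  obtain ⟨M, hM⟩ := (isCompact_Icc (a := -R) (b := R)).exists_bound_of_continuousOn
    h0.continuousOn
  refine ⟨max M 1, by positivity, fun x hx y hy => ?_⟩
  have hlip : ∀ t ∈ uIcc x y, ‖deriv W t - deriv W x‖ ≤ max M 1 * |y - x| := by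
    intro t ht
    have htR : t ∈ Icc (-R) R := (convex_Icc (-R) R).ordConnected.uIcc_subset hx hy ht
    have := (convex_Icc (-R) R).norm_image_sub_le_of_norm_deriv_le (f := deriv W)
      (fun z _ => hd1 z) (fun z hz => (hM z hz).trans (le_max_left M 1)) hx htR
    refine this.trans ?_
    gcongr
    rw [Real.norm_eq_abs, abs_sub_comm t x, abs_sub_comm y x]
    rcases le_total x y with h | h
    · rw [uIcc_of_le h] at ht
      rw [abs_sub_comm x t, abs_sub_comm x y, abs_of_nonneg (by linarith [ht.1]),
        abs_of_nonneg (by linarith)]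
      linarith [ht.2]
    · rw [uIcc_of_ge h] at ht
      rw [abs_of_nonneg (by linarith [ht.2]), abs_of_nonneg (by linarith)]
      linarith [ht.1]
  have := (convex_uIcc x y).norm_image_sub_le_of_norm_hasDerivWithin_le
    (f := fun t => W t - deriv W x * t) (f' := fun t => deriv W t - deriv W x)
    (fun t _ => by
      have := ((hd t).hasDerivAt.sub ((hasDerivAt_id t).const_mul (deriv W x)))
      exact (this.congr_deriv (by simp)).hasDerivWithinAt) hlip left_mem_uIcc right_mem_uIcc
  rw [Real.norm_eq_abs, Real.norm_eq_abs, mul_assoc, abs_mul_abs_self] at this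
  calc |W y - W x - deriv W x * (y - x)|
      = |W y - deriv W x * y - (W x - deriv W x * x)| := by ring_nf
    _ ≤ _ := by rw [sq]; exact this

/-- A nonnegative `C²` function satisfies `(W')² ≤ K W` locally: evaluate its Taylor expansion at
the point minimizing the quadratic majorant. -/
lemma exists_deriv_sq_le {W : ℝ → ℝ} (hW : ContDiff ℝ 2 W) (hW0 : ∀ s, 0 ≤ W s) (R : ℝ) :
    ∃ K : ℝ, 0 < K ∧ ∀ x ∈ Icc (-R) R, deriv W x ^ 2 ≤ K * W x := by
  obtain ⟨M, hM, h⟩ := exists_taylor_bound hW (R + 1)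
  have hc : Continuous (deriv W) := hW.continuous_deriv (by norm_num)
  obtain ⟨D, hD⟩ := (isCompact_Icc (a := -R) (b := R)).exists_bound_of_continuousOn
    hc.continuousOn
  -- The step `-W'(x) / N` has length at most one.
  set N := 2 * M + |D| with hN
  have hNpos : 0 < N := by positivity
  refine ⟨2 * N, by positivity, fun x hx => ?_⟩
  have hDx : |deriv W x| ≤ N := by
    have := hD x hx
    rw [Real.norm_eq_abs] at this
    linarith [le_abs_self D]
  have hstep : |deriv W x / N| ≤ 1 := by
    rw [abs_div, abs_of_pos hNpos]; exact (div_le_one hNpos).2 hDx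
  rw [abs_le] at hstep
  have := (abs_le.1 (h x ⟨by linarith [hx.1], by linarith [hx.2]⟩ (x - deriv W x / N)
    ⟨by linarith [hx.1], by linarith [hx.2]⟩)).2
  have h2 := hW0 (x - deriv W x / N)
  have h3 : deriv W x ^ 2 / N ≤ W x + M * (deriv W x / N) ^ 2 := by
    have e1 : deriv W x * (x - deriv W x / N - x) = - (deriv W x ^ 2 / N) := by ring
    have e2 : (x - deriv W x / N - x) ^ 2 = (deriv W x / N) ^ 2 := by ring
    rw [e1, e2] at this
    linarith
  have h4 : M * (deriv W x / N) ^ 2 ≤ deriv W x ^ 2 / N / 2 := by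
    have : M * (deriv W x / N) ^ 2 = (M / N) * (deriv W x ^ 2 / N) := by
      field_simp
    rw [this]
    have hMN : M / N ≤ 1 / 2 := by
      rw [div_le_div_iff₀ hNpos (by norm_num)]
      linarith [abs_nonneg D]
    have : 0 ≤ deriv W x ^ 2 / N := by positivity
    nlinarith
  have h5 : deriv W x ^ 2 / N ≤ 2 * W x := by linarith
  rw [div_le_iff₀ hNpos] at h5
  linarith

/-- The square root of a nonnegative `C²` function is locally Lipschitz. -/
lemma exists_lipschitz_sqrt {W : ℝ → ℝ} (hW : ContDiff ℝ 2 W) (hW0 : ∀ s, 0 ≤ W s) (R : ℝ) :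
    ∃ L : ℝ, 0 < L ∧ ∀ x ∈ Icc (-R) R, ∀ y ∈ Icc (-R) R, |√(W x) - √(W y)| ≤ L * |x - y| := by
  obtain ⟨K, hK, h⟩ := exists_deriv_sq_le hW hW0 R
  refine ⟨√K, Real.sqrt_pos.2 hK, fun x hx y hy => ?_⟩
  have hd : Differentiable ℝ W := hW.differentiable (by norm_num)
  -- Regularize to avoid the zeros of `W`.
  have key : ∀ δ : ℝ, 0 < δ → |√(W x + δ) - √(W y + δ)| ≤ √K * |x - y| := by
    intro δ hδ
    have := (convex_Icc (-R) R).norm_image_sub_le_of_norm_hasDerivWithin_le (C := √K)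
      (f := fun t => √(W t + δ)) (f' := fun t => deriv W t / (2 * √(W t + δ)))
      (fun t _ => (((hd t).hasDerivAt.add_const δ).sqrt
        (by have := hW0 t; positivity)).hasDerivWithinAt) (fun t ht => ?_) hy hx
    · simpa only [Real.norm_eq_abs] using this
    · have hp : 0 < √(W t + δ) := Real.sqrt_pos.2 (by linarith [hW0 t])
      rw [Real.norm_eq_abs, abs_div, abs_of_pos (by positivity : 0 < 2 * √(W t + δ)),
        div_le_iff₀ (by positivity)]
      have h1 : |deriv W t| ≤ √K * √(W t + δ) := by
        rw [← Real.sqrt_mul hK.le]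
        apply Real.abs_le_sqrt
        exact (h t ht).trans (by gcongr; linarith)
      have : 0 ≤ √K * √(W t + δ) := by positivity
      linarith
  have hlim : Tendsto (fun δ : ℝ => |√(W x + δ) - √(W y + δ)|) (𝓝[>] 0)
      (𝓝 (|√(W x + 0) - √(W y + 0)|)) := by
    apply Tendsto.mono_left _ nhdsWithin_le_nhds
    exact Continuous.tendsto (by fun_prop) 0
  rw [add_zero, add_zero] at hlim
  exact le_of_tendsto hlim (by filter_upwards [self_mem_nhdsWithin] with δ hδ using key δ hδ)

lemma exists_le_sq {W : ℝ → ℝ} {b : ℝ} (hW : ContDiff ℝ 2 W) (h0 : W b = 0)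
    (h1 : deriv W b = 0) (R : ℝ) :
    ∃ C : ℝ, 0 < C ∧ ∀ x ∈ Icc (-R) R, W x ≤ C * (x - b) ^ 2 := by
  obtain ⟨M, hM, h⟩ := exists_taylor_bound hW (max R |b|)
  refine ⟨M, hM, fun x hx => ?_⟩
  have hb : b ∈ Icc (-(max R |b|)) (max R |b|) :=
    abs_le.1 (le_max_right _ _)
  have := h b hb x ⟨by linarith [hx.1, le_max_left R |b|], hx.2.trans (le_max_left _ _)⟩
  rw [h0, h1] at this
  simpa using (le_abs_self _).trans this

/-- Quadratic nondegeneracy of `W` at the well `b`, on compact intervals avoiding the other well. -/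
lemma exists_sq_le {W : ℝ → ℝ} {a b c : ℝ} (hW : IsDoubleWell W a b c) {p q : ℝ} (hp : a < p) :
    ∃ k : ℝ, 0 < k ∧ ∀ x ∈ Icc p q, k * (x - b) ^ 2 ≤ W x := by
  have hb1 : deriv W b = 0 := (hW.deriv_zero_iff b).2 (by simp)
  have hb0 : W b = 0 := (hW.zero_iff b).2 (by simp)
  have hc1 : ContDiff ℝ 1 (deriv W) := ContDiff.deriv' (n := 1) (by norm_num; exact hW.contDiff)
  have hd : Differentiable ℝ W := hW.contDiff.differentiable (by norm_num)
  have hdd : HasDerivAt (deriv W) (deriv (deriv W) b) b :=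
    (hc1.differentiable (by norm_num) b).hasDerivAt
  set κ := deriv (deriv W) b with hκ
  have hκ0 : 0 < κ := hW.deriv2_right
  rw [hasDerivAt_iff_isLittleO] at hdd
  have hev := hdd.def (c := κ / 4) (by positivity)
  obtain ⟨r, hr, hball⟩ := Metric.eventually_nhds_iff_ball.1 hev
  have hnear : ∀ x ∈ Metric.ball b r, κ / 4 * (x - b) ^ 2 ≤ W x := by
    intro x hx
    have hsub : uIcc b x ⊆ Metric.ball b r :=
      (convex_ball b r).ordConnected.uIcc_subset (Metric.mem_ball_self hr) hx
    have := (convex_uIcc b x).norm_image_sub_le_of_norm_hasDerivWithin_le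
      (f := fun t => W t - κ / 2 * (t - b) ^ 2) (f' := fun t => deriv W t - κ * (t - b))
      (C := κ / 4 * |x - b|)
      (fun t _ => by
        have h1 := (((hasDerivAt_id t).sub_const b).pow 2).const_mul (κ / 2)
        have h2 := (hd t).hasDerivAt.sub h1
        refine (h2.congr_deriv ?_).hasDerivWithinAt
        simp; ring) (fun t ht => ?_) left_mem_uIcc right_mem_uIcc
    · rw [Real.norm_eq_abs, Real.norm_eq_abs, mul_assoc, abs_mul_abs_self] at this
      have h2 := (abs_le.1 this).1
      simp only [hb0, sub_self] at h2
      nlinarith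
    · have h1 := hball t (hsub ht)
      rw [hb1] at h1
      simp only [sub_zero, smul_eq_mul, Real.norm_eq_abs] at h1
      rw [Real.norm_eq_abs, mul_comm κ]
      refine h1.trans ?_
      gcongr ?_ * ?_
      rcases le_total b x with h | h
      · rw [uIcc_of_le h] at ht
        rw [abs_of_nonneg (by linarith [ht.1]), abs_of_nonneg (by linarith)]
        linarith [ht.2]
      · rw [uIcc_of_ge h] at ht
        rw [abs_sub_comm, abs_sub_comm x, abs_of_nonneg (by linarith [ht.2]),
          abs_of_nonneg (by linarith)]
        linarith [ht.1]
  have hcompact : IsCompact (Icc p q \ Metric.ball b r) :=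
    isCompact_Icc.diff Metric.isOpen_ball
  rcases (Icc p q \ Metric.ball b r).eq_empty_or_nonempty with he | hne
  · refine ⟨κ / 4, by positivity, fun x hx => hnear x ?_⟩
    by_contra hxb
    exact (he ▸ (⟨hx, hxb⟩ : x ∈ Icc p q \ Metric.ball b r) : x ∈ (∅ : Set ℝ))
  · obtain ⟨x₀, hx₀, hmin⟩ := hcompact.exists_isMinOn hne hW.contDiff.continuous.continuousOn
    have hpos : 0 < W x₀ := by
      refine lt_of_le_of_ne (hW.nonneg _) fun h => ?_
      rcases (hW.zero_iff x₀).1 h.symm with h | h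
      · exact absurd hx₀.1.1 (by rw [h]; linarith)
      · exact hx₀.2 (by rw [h]; exact Metric.mem_ball_self hr)
    set D := (|p| + |q| + |b|) ^ 2 + 1 with hD
    have hDp : 0 < D := by positivity
    refine ⟨min (κ / 4) (W x₀ / D), by positivity, fun x hx => ?_⟩
    by_cases hxb : x ∈ Metric.ball b r
    · exact (mul_le_mul_of_nonneg_right (min_le_left _ _) (sq_nonneg _)).trans (hnear x hxb)
    · have hxD : (x - b) ^ 2 ≤ D := by
        have h1 : |x - b| ≤ |p| + |q| + |b| := by
          rw [abs_le]
          constructor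
          · linarith [hx.1, neg_abs_le p, abs_nonneg q, le_abs_self b]
          · linarith [hx.2, le_abs_self q, abs_nonneg p, neg_abs_le b]
        have := sq_le_sq' (by linarith [abs_nonneg p, abs_nonneg q, abs_nonneg b, abs_nonneg (x-b)])
          h1
        rw [sq_abs] at this
        linarith
      have hm : W x₀ ≤ W x := hmin ⟨hx, hxb⟩
      calc min (κ / 4) (W x₀ / D) * (x - b) ^ 2 ≤ W x₀ / D * D := by
            gcongr
            exact min_le_right _ _
        _ = W x₀ := by field_simp
        _ ≤ W x := hm

/-- The primitive `Φ(x) = ∫_b^x W^{1/2}` of `W^{1/2}` that vanishes at the well `b`; so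
`d_W(r, s) = 2 |Φ(s) - Φ(r)|`. -/
noncomputable def wellPrimitive (W : ℝ → ℝ) (b x : ℝ) : ℝ := ∫ ρ in b..x, √(W ρ)

section Primitive

variable {W : ℝ → ℝ} {b : ℝ}

lemma hasDerivAt_wellPrimitive (hW : Continuous W) (b x : ℝ) :
    HasDerivAt (wellPrimitive W b) (√(W x)) x :=
  ((Real.continuous_sqrt.comp hW).integral_hasStrictDerivAt b x).hasDerivAt

lemma wellPrimitive_self : wellPrimitive W b b = 0 := intervalIntegral.integral_same

lemma continuous_wellPrimitive (hW : Continuous W) : Continuous (wellPrimitive W b) :=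
  continuous_iff_continuousAt.2 fun x => (hasDerivAt_wellPrimitive hW b x).continuousAt

lemma monotone_wellPrimitive (hW : Continuous W) : Monotone (wellPrimitive W b) :=
  monotone_of_deriv_nonneg (fun x => (hasDerivAt_wellPrimitive hW b x).differentiableAt)
    fun x => by rw [(hasDerivAt_wellPrimitive hW b x).deriv]; exact Real.sqrt_nonneg _

lemma integral_sqrt_eq (hW : Continuous W) (b x y : ℝ) :
    ∫ ρ in x..y, √(W ρ) = wellPrimitive W b y - wellPrimitive W b x :=
  (intervalIntegral.integral_interval_sub_left
    ((Real.continuous_sqrt.comp hW).intervalIntegrable _ _)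
    ((Real.continuous_sqrt.comp hW).intervalIntegrable _ _)).symm

lemma wellPrimitive_lt (hW : Continuous W) {x y : ℝ} (hxy : x < y) (hpos : ∀ t ∈ Ioo x y, 0 < W t) :
    wellPrimitive W b x < wellPrimitive W b y := by
  have : 0 < ∫ ρ in x..y, √(W ρ) :=
    intervalIntegral.intervalIntegral_pos_of_pos_on
      ((Real.continuous_sqrt.comp hW).intervalIntegrable _ _)
      (fun t ht => Real.sqrt_pos.2 (hpos t ht)) hxy
  rw [integral_sqrt_eq hW b] at this
  linarith

lemma exists_lipschitz_wellPrimitive (hW : Continuous W) (b R : ℝ) :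
    ∃ L : ℝ, 0 < L ∧ ∀ x ∈ Icc (-R) R, ∀ y ∈ Icc (-R) R,
      |wellPrimitive W b x - wellPrimitive W b y| ≤ L * |x - y| := by
  obtain ⟨L, hL⟩ := (isCompact_Icc (a := -R) (b := R)).exists_bound_of_continuousOn
    (Real.continuous_sqrt.comp hW).continuousOn
  refine ⟨max L 1, by positivity, fun x hx y hy => ?_⟩
  exact (convex_Icc (-R) R).norm_image_sub_le_of_norm_hasDerivWithin_le (C := max L 1)
    (fun t _ => (hasDerivAt_wellPrimitive hW b t).hasDerivWithinAt)
    (fun t ht => (hL t ht).trans (le_max_left _ _)) hy hx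

lemma exists_abs_wellPrimitive_le (hW : ContDiff ℝ 2 W) (h0 : W b = 0)
    (h1 : deriv W b = 0) (R : ℝ) :
    ∃ C : ℝ, 0 < C ∧ ∀ x ∈ Icc (-R) R, |wellPrimitive W b x| ≤ C * (x - b) ^ 2 := by
  obtain ⟨C, hC, h⟩ := exists_le_sq hW h0 h1 (max R |b|)
  refine ⟨√C, Real.sqrt_pos.2 hC, fun x hx => ?_⟩
  have hb : b ∈ Icc (-(max R |b|)) (max R |b|) := abs_le.1 (le_max_right _ _)
  have hx' : x ∈ Icc (-(max R |b|)) (max R |b|) :=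
    ⟨by linarith [hx.1, le_max_left R |b|], hx.2.trans (le_max_left _ _)⟩
  have : ‖∫ ρ in b..x, √(W ρ)‖ ≤ (√C * |x - b|) * |x - b| := by
    apply intervalIntegral.norm_integral_le_of_norm_le_const
    intro t ht
    have htR := (convex_Icc _ _).ordConnected.uIcc_subset hb hx' (uIoc_subset_uIcc ht)
    rw [Real.norm_eq_abs, abs_of_nonneg (Real.sqrt_nonneg _)]
    calc √(W t) ≤ √(C * (t - b) ^ 2) := Real.sqrt_le_sqrt (h t htR)
      _ = √C * |t - b| := by rw [Real.sqrt_mul hC.le, Real.sqrt_sq_eq_abs]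
      _ ≤ √C * |x - b| := by
        gcongr ?_ * ?_
        rcases le_total b x with hbx | hbx
        · rw [uIoc_of_le hbx] at ht
          rw [abs_of_nonneg (by linarith [ht.1]), abs_of_nonneg (by linarith)]
          linarith [ht.2]
        · rw [uIoc_of_ge hbx] at ht
          rw [abs_sub_comm, abs_sub_comm x, abs_of_nonneg (by linarith [ht.2]),
            abs_of_nonneg (by linarith)]
          linarith [ht.1]
  rw [mul_assoc, abs_mul_abs_self, ← sq] at this
  exact this

lemma IsDoubleWell.tendsto_wellPrimitive {a c : ℝ} (hW : IsDoubleWell W a b c) :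
    Tendsto (wellPrimitive W b) atTop atTop := by
  have hd : Differentiable ℝ W := hW.contDiff.differentiable (by norm_num)
  obtain ⟨s₀, hs₀⟩ := (hW.tendsto_atTop.eventually_ge_atTop 1).exists_forall_of_atTop
  have hWge : ∀ s, s₀ ≤ s → s - s₀ ≤ W s := by
    intro s hs
    have := (convex_Ici s₀).mul_sub_le_image_sub_of_le_deriv (f := W) (C := 1)
      hd.continuous.continuousOn hd.differentiableOn
      (fun x hx => hs₀ x (interior_subset hx)) s₀ self_mem_Ici s hs hs
    linarith [hW.nonneg s₀]
  have hge : ∀ s, s₀ + 1 ≤ s → s - (s₀ + 1) + wellPrimitive W b (s₀ + 1) ≤ wellPrimitive W b s := by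
    intro s hs
    have := (convex_Ici (s₀ + 1)).mul_sub_le_image_sub_of_le_deriv (f := wellPrimitive W b) (C := 1)
      (continuous_wellPrimitive hd.continuous).continuousOn
      (fun x _ => (hasDerivAt_wellPrimitive hd.continuous b x).differentiableAt.differentiableWithinAt)
      (fun x hx => by
        have hx' : s₀ + 1 ≤ x := interior_subset hx
        rw [(hasDerivAt_wellPrimitive hd.continuous b x).deriv]
        exact Real.one_le_sqrt.2 (by linarith [hWge x (by linarith)]))
      (s₀ + 1) self_mem_Ici s hs hs
    linarith
  refine tendsto_atTop_mono' atTop (eventually_atTop.2 ⟨s₀ + 1, hge⟩) ?_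
  exact tendsto_atTop_add_const_right _ _ (tendsto_atTop_add_const_right _ _ tendsto_id)

end Primitive

/-! ### Absolutely continuous competitors and their energy -/

/-- Absolute continuity is preserved by composition with a Lipschitz function. -/
lemma absolutelyContinuousOnInterval_comp {f g : ℝ → ℝ} {s t : ℝ} {S : Set ℝ} {K : ℝ≥0}
    (hg : LipschitzOnWith K g S) (hf : AbsolutelyContinuousOnInterval f s t)
    (hS : MapsTo f (uIcc s t) S) : AbsolutelyContinuousOnInterval (fun x => g (f x)) s t := by
  rw [absolutelyContinuousOnInterval_iff] at hf ⊢
  intro ε hε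
  obtain ⟨δ, hδ, h⟩ := hf (ε / (K + 1)) (by positivity)
  refine ⟨δ, hδ, fun E hE hlt => ?_⟩
  have h1 := h E hE hlt
  rw [lt_div_iff₀ (by positivity)] at h1
  refine lt_of_le_of_lt ?_ h1
  rw [Finset.sum_mul]
  refine Finset.sum_le_sum fun i hi => ?_
  have hm := hE.1 i hi
  have := hg.dist_le_mul _ (hS hm.1) _ (hS hm.2)
  nlinarith [dist_nonneg (x := f (E.2 i).1) (y := f (E.2 i).2), K.2]

lemma isH1_of_lipschitz {u : ℝ → ℝ} {K : ℝ≥0} (hu : LipschitzWith K u) (T : ℝ) : IsH1 T u := by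
  refine ⟨hu.lipschitzOnWith.absolutelyContinuousOnInterval, ?_⟩
  exact MemLp.of_bound (measurable_deriv u).aestronglyMeasurable K
    (Eventually.of_forall fun x => norm_deriv_le_of_lipschitz hu)

/-- The integrand of `G`. -/
noncomputable def energyDensity (W ω : ℝ → ℝ) (ε : ℝ) (v : ℝ → ℝ) (t : ℝ) : ℝ :=
  (W (v t) + ε ^ 2 * (deriv v t) ^ 2) * ω t

section Energy

variable {W ω v : ℝ → ℝ} {T ε b : ℝ}

lemma IsH1.continuousOn (hv : IsH1 T v) (hT : 0 ≤ T) : ContinuousOn v (Icc 0 T) := by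
  have := hv.1.continuousOn
  rwa [uIcc_of_le hT] at this

lemma IsH1.intervalIntegrable_deriv_sq (hv : IsH1 T v) (hT : 0 ≤ T) :
    IntervalIntegrable (fun t => deriv v t ^ 2) volume 0 T := by
  rw [intervalIntegrable_iff_integrableOn_Ioo_of_le hT]
  exact hv.2.integrable_sq

lemma IsH1.intervalIntegrable_energyDensity (hv : IsH1 T v) (hT : 0 ≤ T) (hW : Continuous W)
    (hω : ContinuousOn ω (Icc 0 T)) (ε : ℝ) :
    IntervalIntegrable (energyDensity W ω ε v) volume 0 T := by
  rw [← uIcc_of_le hT] at hω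
  refine IntervalIntegrable.mul_continuousOn (IntervalIntegrable.add ?_ ?_) hω
  · exact (hW.comp_continuousOn hv.1.continuousOn).intervalIntegrable
  · exact (hv.intervalIntegrable_deriv_sq hT).const_mul _

lemma intervalIntegrable_mono {f : ℝ → ℝ} (h : IntervalIntegrable f volume 0 T) {s t : ℝ}
    (hs : 0 ≤ s) (hst : s ≤ t) (ht : t ≤ T) : IntervalIntegrable f volume s t := by
  refine h.mono_set ?_
  rw [uIcc_of_le hst, uIcc_of_le (hs.trans (hst.trans ht))]
  exact Icc_subset_Icc hs ht

lemma IsWeight.continuousOn (hω : IsWeight T ω) : ContinuousOn ω (Icc 0 T) :=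
  hω.contDiffOn.continuousOn

lemma IsWeight.absolutelyContinuousOnInterval (hω : IsWeight T ω) (hT : 0 ≤ T) :
    AbsolutelyContinuousOnInterval ω 0 T :=
  ContDiffOn.absolutelyContinuousOnInterval (by rw [uIcc_of_le hT]; exact hω.contDiffOn)

lemma deriv_eq_weightDeriv {t : ℝ} (ht : t ∈ Ioo 0 T) : deriv ω t = weightDeriv T ω t :=
  (derivWithin_of_mem_nhds (Icc_mem_nhds ht.1 ht.2)).symm

lemma energyDensity_nonneg (hW0 : ∀ s, 0 ≤ W s) (hω : IsWeight T ω) {t : ℝ} (ht : t ∈ Icc 0 T) :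
    0 ≤ energyDensity W ω ε v t := by
  have := hW0 (v t)
  have := (hω.pos t ht).le
  unfold energyDensity
  positivity

lemma IsH1.absolutelyContinuousOnInterval_wellPrimitive (hv : IsH1 T v) (hW : Continuous W)
    (b : ℝ) : AbsolutelyContinuousOnInterval (fun t => wellPrimitive W b (v t)) 0 T := by
  obtain ⟨C, hC⟩ := hv.1.exists_bound
  obtain ⟨L, hL, h⟩ := exists_lipschitz_wellPrimitive hW b C
  refine absolutelyContinuousOnInterval_comp (S := Icc (-C) C) (K := L.toNNReal) ?_ hv.1
    fun t ht => abs_le.1 (hC t ht)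
  refine LipschitzOnWith.of_dist_le_mul fun x hx y hy => ?_
  rw [Real.coe_toNNReal _ hL.le]
  exact h x hx y hy

lemma deriv_wellPrimitive_comp (hW : Continuous W) {t : ℝ} (hd : DifferentiableAt ℝ v t) :
    deriv (fun t => wellPrimitive W b (v t)) t = √(W (v t)) * deriv v t :=
  ((hasDerivAt_wellPrimitive hW b (v t)).comp t hd.hasDerivAt).deriv

lemma IsH1.intervalIntegrable_sqrt_mul_deriv (hv : IsH1 T v) (hW : Continuous W) :
    IntervalIntegrable (fun t => √(W (v t)) * deriv v t) volume 0 T :=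
  hv.1.intervalIntegrable_deriv.continuousOn_mul
    ((Real.continuous_sqrt.comp hW).comp_continuousOn hv.1.continuousOn)

lemma IsH1.ae_deriv_wellPrimitive_comp (hv : IsH1 T v) (hT : 0 ≤ T) (hW : Continuous W) (b : ℝ) :
    ∀ᵐ t, t ∈ Icc 0 T →
      deriv (fun t => wellPrimitive W b (v t)) t = √(W (v t)) * deriv v t := by
  filter_upwards [hv.1.ae_differentiableAt] with t ht h
  rw [uIcc_of_le hT] at ht
  exact deriv_wellPrimitive_comp hW (ht h)

lemma IsH1.integral_sqrt_mul_deriv (hv : IsH1 T v) (hW : Continuous W) (b : ℝ) {s t : ℝ}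
    (hs : 0 ≤ s) (hst : s ≤ t) (ht : t ≤ T) :
    ∫ r in s..t, √(W (v r)) * deriv v r = wellPrimitive W b (v t) - wellPrimitive W b (v s) := by
  have hT : 0 ≤ T := hs.trans (hst.trans ht)
  have hac := (hv.absolutelyContinuousOnInterval_wellPrimitive hW b).mono (c := s) (d := t)
    (by rw [uIcc_of_le hst, uIcc_of_le hT]; exact Icc_subset_Icc hs ht)
  rw [← hac.integral_deriv_eq_sub]
  apply intervalIntegral.integral_congr_ae
  filter_upwards [hv.ae_deriv_wellPrimitive_comp hT hW b] with r hr hm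
  rw [uIoc_of_le hst] at hm
  exact (hr ⟨hs.trans hm.1.le, hm.2.trans ht⟩).symm

/-- The Modica–Mortola lower bound: a transition from `v s` to `v t` costs at least the geodesic
distance, weighted by a lower bound of `ω`. -/
lemma IsH1.two_mul_abs_sub_le_integral (hv : IsH1 T v) (hW : Continuous W) (hW0 : ∀ s, 0 ≤ W s)
    (hω : ContinuousOn ω (Icc 0 T)) (b : ℝ) (hε : 0 < ε) {m s t : ℝ} (hm : 0 ≤ m)
    (hmω : ∀ r ∈ Ioc 0 T, m ≤ ω r) (hs : 0 ≤ s) (hst : s ≤ t) (ht : t ≤ T) :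
    2 * ε * m * |wellPrimitive W b (v t) - wellPrimitive W b (v s)| ≤
      ∫ r in s..t, energyDensity W ω ε v r := by
  have hT : 0 ≤ T := hs.trans (hst.trans ht)
  rw [← hv.integral_sqrt_mul_deriv hW b hs hst ht]
  have hint := intervalIntegrable_mono (hv.intervalIntegrable_sqrt_mul_deriv hW) hs hst ht
  calc 2 * ε * m * |∫ r in s..t, √(W (v r)) * deriv v r|
      ≤ 2 * ε * m * ∫ r in s..t, |√(W (v r)) * deriv v r| := by
        gcongr
        exact intervalIntegral.abs_integral_le_integral_abs hst
    _ = ∫ r in s..t, 2 * ε * m * |√(W (v r)) * deriv v r| := by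
        rw [intervalIntegral.integral_const_mul]
    _ ≤ _ := by
        refine intervalIntegral.integral_mono_on_of_le_Ioo hst (hint.abs.const_mul _)
          (intervalIntegrable_mono (hv.intervalIntegrable_energyDensity hT hW hω ε) hs hst ht) ?_
        intro r hr
        have h1 : 2 * ε * |√(W (v r)) * deriv v r| ≤ W (v r) + ε ^ 2 * deriv v r ^ 2 := by
          rw [abs_mul, abs_of_nonneg (Real.sqrt_nonneg _)]
          nlinarith [sq_nonneg (√(W (v r)) - ε * |deriv v r|), Real.sq_sqrt (hW0 (v r)),
            sq_abs (deriv v r)]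
        have h2 := hmω r ⟨hs.trans_lt hr.1, hr.2.le.trans ht⟩
        have h3 : 0 ≤ W (v r) + ε ^ 2 * deriv v r ^ 2 := by
          have := hW0 (v r); positivity
        calc 2 * ε * m * |√(W (v r)) * deriv v r| = 2 * ε * |√(W (v r)) * deriv v r| * m := by ring
          _ ≤ (W (v r) + ε ^ 2 * deriv v r ^ 2) * ω r := by gcongr

/-- Integrating the calibration `2 W^{1/2}(v) v' ω` by parts. -/
lemma IsH1.integral_sqrt_mul_deriv_mul_weight (hv : IsH1 T v) (hW : Continuous W) (hT : 0 ≤ T)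
    (hω : IsWeight T ω) (b : ℝ) :
    ∫ t in (0 : ℝ)..T, √(W (v t)) * deriv v t * ω t =
      wellPrimitive W b (v T) * ω T - wellPrimitive W b (v 0) * ω 0 -
        ∫ t in (0 : ℝ)..T, wellPrimitive W b (v t) * weightDeriv T ω t := by
  have h := (hv.absolutelyContinuousOnInterval_wellPrimitive hW b).integral_mul_deriv_eq_deriv_mul
    (hω.absolutelyContinuousOnInterval hT)
  have h1 : ∫ t in (0 : ℝ)..T, wellPrimitive W b (v t) * weightDeriv T ω t =
      ∫ t in (0 : ℝ)..T, wellPrimitive W b (v t) * deriv ω t := by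
    rw [intervalIntegral.integral_of_le hT, intervalIntegral.integral_of_le hT,
      integral_Ioc_eq_integral_Ioo, integral_Ioc_eq_integral_Ioo]
    exact setIntegral_congr_fun measurableSet_Ioo fun t ht => by
      simp only [deriv_eq_weightDeriv (ω := ω) ht]
  have h2 : ∫ t in (0 : ℝ)..T, deriv (fun t => wellPrimitive W b (v t)) t * ω t =
      ∫ t in (0 : ℝ)..T, √(W (v t)) * deriv v t * ω t := by
    apply intervalIntegral.integral_congr_ae
    filter_upwards [hv.ae_deriv_wellPrimitive_comp hT hW b] with r hr hm
    rw [uIoc_of_le hT] at hm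
    rw [hr ⟨hm.1.le, hm.2⟩]
  rw [h1, h, h2]
  ring

/-- The equipartition defect, whose vanishing means that `v` solves `ε v' = W^{1/2}(v)`. -/
noncomputable def equipartitionDefect (W : ℝ → ℝ) (ε : ℝ) (v : ℝ → ℝ) (t : ℝ) : ℝ :=
  (√(W (v t)) - ε * deriv v t) ^ 2

lemma IsH1.intervalIntegrable_equipartitionDefect (hv : IsH1 T v) (hW : Continuous W)
    (hW0 : ∀ s, 0 ≤ W s) (hT : 0 ≤ T) (ε : ℝ) :
    IntervalIntegrable (equipartitionDefect W ε v) volume 0 T := by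
  have h1 : IntervalIntegrable (fun t => W (v t)) volume 0 T :=
    (hW.comp_continuousOn hv.1.continuousOn).intervalIntegrable
  have h2 := (hv.intervalIntegrable_deriv_sq hT).const_mul (ε ^ 2)
  have h3 := (hv.intervalIntegrable_sqrt_mul_deriv hW).const_mul (2 * ε)
  refine ((h1.add h2).sub h3).congr fun t _ => ?_
  simp only [equipartitionDefect, sub_sq, Real.sq_sqrt (hW0 (v t))]
  ring

/-- Completing the square in the energy and integrating the cross term by parts. -/
lemma IsH1.integral_energyDensity_eq (hv : IsH1 T v) (hW : Continuous W) (hW0 : ∀ s, 0 ≤ W s)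
    (hT : 0 ≤ T) (hω : IsWeight T ω) (b ε : ℝ) :
    ∫ t in (0 : ℝ)..T, energyDensity W ω ε v t =
      (∫ t in (0 : ℝ)..T, equipartitionDefect W ε v t * ω t) +
      2 * ε * (wellPrimitive W b (v T) * ω T - wellPrimitive W b (v 0) * ω 0 -
        ∫ t in (0 : ℝ)..T, wellPrimitive W b (v t) * weightDeriv T ω t) := by
  have hωc : ContinuousOn ω (uIcc 0 T) := by rw [uIcc_of_le hT]; exact hω.continuousOn
  rw [← hv.integral_sqrt_mul_deriv_mul_weight hW hT hω b, ← intervalIntegral.integral_const_mul,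
    ← intervalIntegral.integral_add]
  · refine intervalIntegral.integral_congr fun t _ => ?_
    simp only [energyDensity, equipartitionDefect, sub_sq, Real.sq_sqrt (hW0 (v t))]
    ring
  · exact (hv.intervalIntegrable_equipartitionDefect hW hW0 hT ε).mul_continuousOn hωc
  · exact ((hv.intervalIntegrable_sqrt_mul_deriv hW).mul_continuousOn hωc).const_mul _

/-- The first moment of `(Φ ∘ v)'`, integrated by parts. -/
lemma IsH1.integral_sqrt_mul_deriv_mul_id (hv : IsH1 T v) (hW : Continuous W) (b : ℝ) {L : ℝ}
    (hL : 0 ≤ L) (hLT : L ≤ T) :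
    ∫ t in (0 : ℝ)..L, √(W (v t)) * deriv v t * t =
      wellPrimitive W b (v L) * L - ∫ t in (0 : ℝ)..L, wellPrimitive W b (v t) := by
  have hT : 0 ≤ T := hL.trans hLT
  have hac := (hv.absolutelyContinuousOnInterval_wellPrimitive hW b).mono (c := 0) (d := L)
    (by rw [uIcc_of_le hL, uIcc_of_le hT]; exact Icc_subset_Icc le_rfl hLT)
  have hid : AbsolutelyContinuousOnInterval (fun t : ℝ => t) 0 L :=
    (LipschitzWith.id.lipschitzOnWith (s := uIcc 0 L)).absolutelyContinuousOnInterval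
  have h := hac.integral_mul_deriv_eq_deriv_mul hid
  have h2 : ∫ t in (0 : ℝ)..L, deriv (fun t => wellPrimitive W b (v t)) t * t =
      ∫ t in (0 : ℝ)..L, √(W (v t)) * deriv v t * t := by
    apply intervalIntegral.integral_congr_ae
    filter_upwards [hv.ae_deriv_wellPrimitive_comp hT hW b] with r hr hm
    rw [uIoc_of_le hL] at hm
    rw [hr ⟨hm.1.le, hm.2.trans hLT⟩]
  simp only [deriv_id'', mul_one] at h
  rw [h2] at h
  linarith

end Energy

/-! ### Recovery competitors with sharp leading-order energy -/

/-- A global solution `z` of `z' = f(z)` for a continuous `f` between two positive constants, obtained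
as the inverse of the travel time `Θ = ∫ 1 / f`. -/
lemma exists_profile {f : ℝ → ℝ} {σ K : ℝ} (hf : Continuous f) (hσ : 0 < σ) (hσf : ∀ x, σ ≤ f x)
    (hfK : ∀ x, f x ≤ K) :
    ∃ z Θ : ℝ → ℝ, (∀ x, z (Θ x) = x) ∧ (∀ s, HasDerivAt z (f (z s)) s) ∧ Monotone Θ ∧
      ∀ x y, x ≤ y → Θ y - Θ x ≤ (y - x) / σ := by
  have hpos : ∀ x, 0 < f x := fun x => hσ.trans_le (hσf x)
  have hK : 0 < K := (hpos 0).trans_le (hfK 0)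
  have hinv : Continuous fun x => (f x)⁻¹ := hf.inv₀ fun x => (hpos x).ne'
  set Θ : ℝ → ℝ := fun x => ∫ ρ in (0 : ℝ)..x, (f ρ)⁻¹ with hΘ
  have hd : ∀ x, HasDerivAt Θ (f x)⁻¹ x := fun x =>
    (hinv.integral_hasStrictDerivAt 0 x).hasDerivAt
  have hdiff : Differentiable ℝ Θ := fun x => (hd x).differentiableAt
  have hcont : Continuous Θ := hdiff.continuous
  have hmono : StrictMono Θ := strictMono_of_deriv_pos fun x => by
    rw [(hd x).deriv]; exact inv_pos.2 (hpos x)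
  have hlow : ∀ x y, x ≤ y → K⁻¹ * (y - x) ≤ Θ y - Θ x := fun x y hxy =>
    mul_sub_le_image_sub_of_le_deriv hdiff (fun t => by
      rw [(hd t).deriv]; exact inv_anti₀ (hpos t) (hfK t)) hxy
  have hup : ∀ x y, x ≤ y → Θ y - Θ x ≤ σ⁻¹ * (y - x) := fun x y hxy =>
    image_sub_le_mul_sub_of_deriv_le hdiff (fun t => by
      rw [(hd t).deriv]; exact inv_anti₀ hσ (hσf t)) hxy
  have htop : Tendsto Θ atTop atTop := by
    refine tendsto_atTop_mono' atTop (f₁ := fun x => K⁻¹ * x) ?_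
      (tendsto_id.const_mul_atTop (inv_pos.2 hK))
    filter_upwards [eventually_ge_atTop 0] with x hx
    have := hlow 0 x hx
    simpa [hΘ] using this
  have hbot : Tendsto Θ atBot atBot := by
    refine tendsto_atBot_mono' atBot (f₁ := fun x => K⁻¹ * x) ?_
      (tendsto_id.const_mul_atBot (inv_pos.2 hK))
    filter_upwards [eventually_le_atBot 0] with x hx
    have := hlow x 0 hx
    simp only [hΘ, intervalIntegral.integral_same] at this ⊢
    linarith
  let e := hmono.orderIsoOfSurjective Θ (hcont.surjective htop hbot)
  have he : ∀ x, e.symm (Θ x) = x := hmono.orderIsoOfSurjective_symm_apply_self Θ _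
  refine ⟨e.symm, Θ, he, fun s => ?_, hmono.monotone, fun x y hxy => ?_⟩
  · have := HasDerivAt.of_local_left_inverse (f := Θ) (g := e.symm) (a := s)
      e.symm.continuous.continuousAt (hd (e.symm s)) (inv_ne_zero (hpos _).ne')
      (Eventually.of_forall fun y =>
        hmono.orderIsoOfSurjective_self_symm_apply Θ (hcont.surjective htop hbot) y)
    rwa [inv_inv] at this
  · rw [div_eq_inv_mul]; exact hup x y hxy

section Recovery

variable {W ω : ℝ → ℝ} {T ε : ℝ}

/-- The competitor that runs from `p` up to `q` along `ε u' = f(u)` and then stays at `q`. -/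
lemma exists_admissible_le {f : ℝ → ℝ} {σ K p q M Ω : ℝ} (hW : Continuous W)
    (hW0 : ∀ s, 0 ≤ W s) (hω : IsWeight T ω) (hf : Continuous f) (hσ : 0 < σ)
    (hσf : ∀ x, σ ≤ f x) (hfK : ∀ x, f x ≤ K) (hpq : p ≤ q)
    (hWf : ∀ x ∈ Icc p q, √(W x) ≤ f x) (hε : 0 < ε) (htime : ε * ((q - p) / σ) ≤ T)
    (hM : ∀ t ∈ Icc 0 (ε * ((q - p) / σ)), ω t ≤ M) (hΩ : ∀ t ∈ Icc 0 T, ω t ≤ Ω) :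
    ∃ u, IsAdmissible T p q u ∧ ∫ t in (0 : ℝ)..T, energyDensity W ω ε u t ≤
      2 * ε * M * (∫ x in p..q, f x) + W q * Ω * T := by
  obtain ⟨z, Θ, hzΘ, hz, hΘm, hΘ⟩ := exists_profile hf hσ hσf hfK
  have hpos : ∀ x, 0 < f x := fun x => hσ.trans_le (hσf x)
  have hK : 0 < K := (hpos 0).trans_le (hfK 0)
  set τ := Θ q - Θ p with hτ
  have hτ0 : 0 ≤ τ := sub_nonneg.2 (hΘm hpq)
  have hτle : ε * τ ≤ ε * ((q - p) / σ) := by have := hΘ p q hpq; gcongr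
  have hετ0 : 0 ≤ ε * τ := by positivity
  have hετT : ε * τ ≤ T := hτle.trans htime
  have hT : 0 ≤ T := hετ0.trans hετT
  have hzm : Monotone z := monotone_of_deriv_nonneg (fun s => (hz s).differentiableAt)
    fun s => by rw [(hz s).deriv]; exact (hpos _).le
  have hzl : LipschitzWith K.toNNReal z := by
    refine lipschitzWith_of_nnnorm_deriv_le (fun s => (hz s).differentiableAt) fun s => ?_
    rw [(hz s).deriv, ← NNReal.coe_le_coe, coe_nnnorm, Real.coe_toNNReal _ hK.le,
      Real.norm_eq_abs, abs_of_pos (hpos _)]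
    exact hfK _
  set u : ℝ → ℝ := fun t => z (Θ p + min (t / ε) τ) with hu
  have hul : LipschitzWith (K.toNNReal * (ε⁻¹).toNNReal) u := by
    refine hzl.comp (LipschitzWith.of_dist_le_mul fun x y => ?_)
    rw [Real.coe_toNNReal _ (inv_pos.2 hε).le, dist_add_left, Real.dist_eq, Real.dist_eq]
    refine (abs_min_sub_min_le_max _ _ _ _).trans ?_
    rw [sub_self, abs_zero, max_eq_left (abs_nonneg _), ← sub_div, abs_div, abs_of_pos hε,
      div_eq_inv_mul]
  have hu0 : u 0 = p := by simp [hu, hτ0, hzΘ]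
  have huτ : ∀ t, ε * τ ≤ t → u t = q := by
    intro t ht
    have : τ ≤ t / ε := by rw [le_div_iff₀ hε]; linarith
    rw [hu]
    simp only [min_eq_right this]
    rw [hτ, add_sub_cancel, hzΘ]
  have hH1 : IsH1 T u := isH1_of_lipschitz hul T
  refine ⟨u, ⟨hH1, hu0, huτ T hετT⟩, ?_⟩
  have hint := hH1.intervalIntegrable_energyDensity hT hW hω.continuousOn ε
  rw [← intervalIntegral.integral_add_adjacent_intervals
    (intervalIntegrable_mono hint le_rfl hετ0 hετT)
    (intervalIntegrable_mono hint hετ0 hετT le_rfl)]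
  -- On the transition layer the energy density is at most `2 ε f(u) u' ω`.
  set y : ℝ → ℝ := fun t => z (Θ p + t / ε) with hy
  have hyd : ∀ t, HasDerivAt y (f (y t) / ε) t := fun t => by
    have h1 : HasDerivAt (fun t : ℝ => Θ p + t / ε) (1 / ε) t :=
      ((hasDerivAt_id t).div_const ε).const_add _
    have := (hz (Θ p + t / ε)).comp t h1
    exact this.congr_deriv (by simp only [hy]; ring)
  have hyc : Continuous y := continuous_iff_continuousAt.2 fun t => (hyd t).continuousAt
  have huy : ∀ t, t ≤ ε * τ → u t = y t := by
    intro t ht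
    have : t / ε ≤ τ := by rw [div_le_iff₀ hε]; linarith
    simp [hu, hy, this]
  have hlayer : ∫ t in (0 : ℝ)..ε * τ, energyDensity W ω ε u t ≤
      ∫ t in (0 : ℝ)..ε * τ, 2 * ε * M * (f (y t) * (f (y t) / ε)) := by
    refine intervalIntegral.integral_mono_on_of_le_Ioo hετ0
      (intervalIntegrable_mono hint le_rfl hετ0 hετT) ?_ fun t ht => ?_
    · exact (continuous_const.mul ((hf.comp hyc).mul ((hf.comp hyc).div_const ε))).intervalIntegrable
        _ _
    · have hde : HasDerivAt u (f (y t) / ε) t :=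
        (hyd t).congr_of_eventuallyEq (by
          filter_upwards [Iio_mem_nhds ht.2] with s hs using huy s (le_of_lt hs))
      have hyI : y t ∈ Icc p q := by
        constructor
        · calc p = z (Θ p) := (hzΘ p).symm
            _ ≤ y t := hzm (by have := div_nonneg ht.1.le hε.le; linarith)
        · calc y t ≤ z (Θ q) := hzm (by
                have : t / ε ≤ τ := by rw [div_le_iff₀ hε]; linarith [ht.2]
                linarith)
            _ = q := hzΘ q
      have h1 : W (y t) ≤ f (y t) ^ 2 := (Real.sqrt_le_left (hpos _).le).1 (hWf _ hyI)
      have h2 := hM t ⟨ht.1.le, ht.2.le.trans hτle⟩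
      have h3 := hω.pos t ⟨ht.1.le, ht.2.le.trans hετT⟩
      unfold energyDensity
      rw [hde.deriv, huy t ht.2.le]
      have e1 : ε ^ 2 * (f (y t) / ε) ^ 2 = f (y t) ^ 2 := by field_simp
      have e2 : 2 * ε * M * (f (y t) * (f (y t) / ε)) = 2 * f (y t) ^ 2 * M := by field_simp
      rw [e1, e2]
      have := hpos (y t)
      gcongr
      linarith
  have hchange : ∫ t in (0 : ℝ)..ε * τ, f (y t) * (f (y t) / ε) = ∫ x in p..q, f x := by
    have := intervalIntegral.integral_comp_mul_deriv (a := 0) (b := ε * τ) (f := y)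
      (f' := fun t => f (y t) / ε) (g := f) (fun t _ => hyd t)
      ((hf.comp hyc).div_const ε).continuousOn hf
    rw [show y 0 = p by rw [← huy 0 hετ0, hu0],
      show y (ε * τ) = q by rw [← huy _ le_rfl, huτ _ le_rfl]] at this
    simpa only [Function.comp_apply] using this
  have htail : ∫ t in ε * τ..T, energyDensity W ω ε u t ≤ ∫ _t in ε * τ..T, W q * Ω := by
    refine intervalIntegral.integral_mono_on_of_le_Ioo hετT
      (intervalIntegrable_mono hint hετ0 hετT le_rfl) intervalIntegrable_const fun t ht => ?_
    have hde : HasDerivAt u 0 t := (hasDerivAt_const t q).congr_of_eventuallyEq (by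
      filter_upwards [Ioi_mem_nhds ht.1] with s hs using huτ s (le_of_lt hs))
    unfold energyDensity
    rw [hde.deriv, huτ t ht.1.le]
    have := hΩ t ⟨hετ0.trans ht.1.le, ht.2.le⟩
    have := hW0 q
    simp only [ne_eq, OfNat.ofNat_ne_zero, not_false_eq_true, zero_pow, mul_zero, add_zero]
    gcongr
  rw [intervalIntegral.integral_const_mul, hchange] at hlayer
  rw [intervalIntegral.integral_const, smul_eq_mul] at htail
  have hWΩ : 0 ≤ W q * Ω := mul_nonneg (hW0 q)
    ((hω.pos 0 ⟨le_rfl, hT⟩).le.trans (hΩ 0 ⟨le_rfl, hT⟩))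
  nlinarith

/-- The affine competitor. -/
lemma exists_admissible_affine_le {p q m Ω : ℝ} (hW : Continuous W) (hW0 : ∀ s, 0 ≤ W s)
    (hT : 0 < T) (hω : IsWeight T ω) (hm : ∀ x ∈ uIcc p q, W x ≤ m)
    (hΩ : ∀ t ∈ Icc 0 T, ω t ≤ Ω) :
    ∃ u, IsAdmissible T p q u ∧ ∫ t in (0 : ℝ)..T, energyDensity W ω ε u t ≤
      T * ((m + ε ^ 2 * ((q - p) / T) ^ 2) * Ω) := by
  set u : ℝ → ℝ := fun t => p + (q - p) / T * t with hu
  have hud : ∀ t, HasDerivAt u ((q - p) / T) t := fun t => by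
    have := ((hasDerivAt_id t).const_mul ((q - p) / T)).const_add p
    exact this.congr_deriv (by simp)
  have hul : LipschitzWith (|(q - p) / T|).toNNReal u :=
    lipschitzWith_of_nnnorm_deriv_le (fun t => (hud t).differentiableAt) fun t => by
      rw [(hud t).deriv, ← NNReal.coe_le_coe, coe_nnnorm, Real.coe_toNNReal _ (abs_nonneg _),
        Real.norm_eq_abs]
  have hH1 := isH1_of_lipschitz hul T
  refine ⟨u, ⟨hH1, by simp [hu], by simp only [hu]; field_simp; ring⟩, ?_⟩
  have hle : ∫ t in (0 : ℝ)..T, energyDensity W ω ε u t ≤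
      ∫ _t in (0 : ℝ)..T, (m + ε ^ 2 * ((q - p) / T) ^ 2) * Ω := by
    refine intervalIntegral.integral_mono_on hT.le
      (hH1.intervalIntegrable_energyDensity hT.le hW hω.continuousOn ε)
      intervalIntegrable_const fun t ht => ?_
    unfold energyDensity
    rw [(hud t).deriv]
    have ht1 : 0 ≤ t / T := div_nonneg ht.1 hT.le
    have ht2 : t / T ≤ 1 := (div_le_one hT).2 ht.2
    have hut : u t ∈ uIcc p q := by
      have : u t = AffineMap.lineMap p q (t / T) := by
        simp only [hu, AffineMap.lineMap_apply, vsub_eq_sub, vadd_eq_add, smul_eq_mul]; ring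
      rw [this, ← segment_eq_uIcc]
      exact ⟨1 - t / T, t / T, by linarith, ht1, by ring, by
        simp only [AffineMap.lineMap_apply, vsub_eq_sub, vadd_eq_add, smul_eq_mul]; ring⟩
    have h1 := hm (u t) hut
    have h4 := hΩ t ht
    have h5 := hW0 (u t)
    have h6 := hω.pos t ht
    have h7 : 0 ≤ m := h5.trans h1
    gcongr
  rwa [intervalIntegral.integral_const, smul_eq_mul, sub_zero] at hle

/-- Sharp upper bound of the minimal energy, uniformly in the boundary data. -/
lemma exists_admissible_le_of_isDoubleWell {a b c : ℝ} (hW : IsDoubleWell W a b c) (hT : 0 < T)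
    (hω : IsWeight T ω) {B η : ℝ} (hB : 0 < B) (hη : 0 < η) :
    ∃ ε₁ : ℝ, 0 < ε₁ ∧ ∀ ε ∈ Ioo 0 ε₁, ∀ p ∈ Icc a b, ∀ q ∈ Icc a b, |q - b| ≤ B * ε →
      ∃ u, IsAdmissible T p q u ∧ ∫ t in (0 : ℝ)..T, energyDensity W ω ε u t ≤
        ε * (-2 * wellPrimitive W b p * ω 0 + η) := by
  have hWc := hW.contDiff.continuous
  have hab : a < b := hW.lt_left.trans hW.lt_right
  obtain ⟨Ω, hΩ'⟩ := (isCompact_Icc (a := (0 : ℝ)) (b := T)).exists_bound_of_continuousOn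
    hω.continuousOn
  have hΩ : ∀ t ∈ Icc 0 T, ω t ≤ Ω := fun t ht => (le_abs_self _).trans (hΩ' t ht)
  have h0T : (0 : ℝ) ∈ Icc 0 T := ⟨le_rfl, hT.le⟩
  have hω0 : 0 < ω 0 := hω.pos 0 h0T
  have hΩ0 : 0 < Ω := hω0.trans_le (hΩ 0 h0T)
  obtain ⟨K, hK'⟩ := (isCompact_Icc (a := a) (b := b)).exists_bound_of_continuousOn
    (Real.continuous_sqrt.comp hWc).continuousOn
  have hK : ∀ x ∈ Icc a b, √(W x) ≤ K := fun x hx => (le_abs_self _).trans (hK' x hx)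
  have hK0 : 0 ≤ K := (Real.sqrt_nonneg _).trans (hK a ⟨le_rfl, hab.le⟩)
  obtain ⟨C, hC, hWC⟩ := exists_le_sq hW.contDiff ((hW.zero_iff b).2 (by simp))
    ((hW.deriv_zero_iff b).2 (by simp)) (max |a| |b|)
  have habR : Icc a b ⊆ Icc (-(max |a| |b|)) (max |a| |b|) := Icc_subset_Icc
    (by linarith [le_max_left |a| |b|, neg_abs_le a]) ((le_abs_self b).trans (le_max_right _ _))
  set A := -wellPrimitive W b a with hA
  have hΦm := monotone_wellPrimitive (b := b) hWc
  have hΦle : ∀ x ∈ Icc a b, wellPrimitive W b x ≤ 0 := fun x hx => by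
    rw [← wellPrimitive_self (W := W) (b := b)]; exact hΦm hx.2
  have hA0 : 0 ≤ A := by have := hΦle a ⟨le_rfl, hab.le⟩; linarith
  -- `θ` controls the oscillation of `ω` on the layer, `σ` the regularization of `W^{1/2}`.
  set θ := min 1 (η / (6 * (A + 1))) with hθ
  have hθ0 : 0 < θ := by positivity
  have hθA : 2 * θ * A ≤ η / 3 := by
    have h1 : θ ≤ η / (6 * (A + 1)) := min_le_right _ _
    have h2 : θ * (6 * (A + 1)) ≤ η := by rwa [le_div_iff₀ (by positivity)] at h1
    nlinarith
  set σ := η / (6 * (ω 0 + 1) * (b - a)) with hσ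
  have hba : 0 < b - a := sub_pos.2 hab
  have hσ0 : 0 < σ := by positivity
  have hσe : 2 * (ω 0 + 1) * (σ * (b - a)) = η / 3 := by rw [hσ]; field_simp; ring
  have hcw : ContinuousWithinAt ω (Icc 0 T) 0 := hω.continuousOn 0 h0T
  obtain ⟨r, hr, hrω⟩ := Metric.continuousWithinAt_iff.1 hcw θ hθ0
  set D := (C * B ^ 2 + B ^ 2 / T ^ 2) * Ω * T with hD
  have hD0 : 0 < D := by positivity
  refine ⟨min 1 (min (η / (3 * D)) (min (r / 2) T * σ / (b - a))), by positivity, ?_⟩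
  intro ε hε p hp q hq hqb
  have hε0 : 0 < ε := hε.1
  have hε1 : ε < 1 := hε.2.trans_le (min_le_left _ _)
  have hεD : ε * D ≤ η / 3 := by
    have : ε ≤ η / (3 * D) := (hε.2.trans_le ((min_le_right _ _).trans (min_le_left _ _))).le
    rw [le_div_iff₀ (by positivity)] at this
    linarith
  have hεt : ε * ((b - a) / σ) ≤ min (r / 2) T := by
    have : ε ≤ min (r / 2) T * σ / (b - a) :=
      (hε.2.trans_le ((min_le_right _ _).trans (min_le_right _ _))).le
    rw [le_div_iff₀ hba] at this
    rw [← mul_div_assoc, div_le_iff₀ hσ0]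
    exact this
  have hWq : ∀ x ∈ Icc a b, |x - b| ≤ B * ε → W x ≤ C * B ^ 2 * ε ^ 2 := by
    intro x hx hxb
    refine (hWC x (habR hx)).trans ?_
    have : (x - b) ^ 2 ≤ (B * ε) ^ 2 := sq_le_sq' (by linarith [(abs_le.1 hxb).1]) (abs_le.1 hxb).2
    nlinarith
  rcases le_or_gt p q with hpq | hpq
  · -- The truncation by `K` only serves to make the regularized speed bounded on all of `ℝ`.
    set f : ℝ → ℝ := fun x => min (√(W x)) K + σ with hf
    have hfc : Continuous f := ((Real.continuous_sqrt.comp hWc).min continuous_const).add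
      continuous_const
    have htime : ε * ((q - p) / σ) ≤ min (r / 2) T := by
      refine le_trans ?_ hεt
      have : q - p ≤ b - a := by linarith [hq.2, hp.1]
      gcongr
    obtain ⟨u, hu, hle⟩ := exists_admissible_le (W := W) (ω := ω) (T := T) (ε := ε) (f := f)
      (σ := σ) (K := K + σ) (p := p) (q := q) (M := ω 0 + θ) (Ω := Ω) hWc hW.nonneg hω hfc hσ0
      (fun x => by have := le_min (Real.sqrt_nonneg (W x)) hK0; simp only [hf]; linarith)
      (fun x => by have := min_le_right (√(W x)) K; simp only [hf]; linarith) hpq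
      (fun x hx => by
        simp only [hf]
        rw [min_eq_left (hK x ⟨hp.1.trans hx.1, hx.2.trans hq.2⟩)]; linarith) hε0
      (htime.trans (min_le_right _ _))
      (fun t ht => by
        have h1 : t ≤ r / 2 := ht.2.trans (htime.trans (min_le_left _ _))
        have h2 : t ≤ T := ht.2.trans (htime.trans (min_le_right _ _))
        have := hrω ⟨ht.1, h2⟩ (by
          rw [Real.dist_eq, sub_zero, abs_of_nonneg ht.1]; linarith)
        rw [Real.dist_eq] at this
        linarith [(abs_lt.1 this).2]) hΩ
    refine ⟨u, hu, hle.trans ?_⟩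
    have hfint : ∫ x in p..q, f x ≤ -wellPrimitive W b p + σ * (b - a) := by
      calc ∫ x in p..q, f x ≤ ∫ x in p..q, (√(W x) + σ) := by
            refine intervalIntegral.integral_mono_on hpq (hfc.intervalIntegrable _ _)
              (((Real.continuous_sqrt.comp hWc).add continuous_const).intervalIntegrable _ _)
              fun x _ => ?_
            simp only [hf]
            gcongr
            exact min_le_left _ _
        _ = wellPrimitive W b q - wellPrimitive W b p + (q - p) * σ := by
            rw [intervalIntegral.integral_add (f := fun x => √(W x))
              ((Real.continuous_sqrt.comp hWc).intervalIntegrable _ _) intervalIntegrable_const,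
              integral_sqrt_eq hWc b, intervalIntegral.integral_const, smul_eq_mul]
        _ ≤ _ := by
            have := hΦle q hq
            have : (q - p) * σ ≤ (b - a) * σ := by
              gcongr
              exacts [hq.2, hp.1]
            linarith
    have hpA : -wellPrimitive W b p ≤ A := neg_le_neg (hΦm hp.1)
    have hp0 : 0 ≤ -wellPrimitive W b p := by linarith [hΦle p hp]
    have hθ1 : θ ≤ 1 := min_le_left _ _
    have h1 : W q * Ω * T ≤ ε * (η / 3) := by
      calc W q * Ω * T ≤ C * B ^ 2 * ε ^ 2 * Ω * T := by
            have := hWq q hq hqb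
            gcongr
        _ ≤ ε * (ε * D) := by
            have : 0 ≤ B ^ 2 / T ^ 2 * Ω * T * ε ^ 2 := by positivity
            rw [hD]; nlinarith
        _ ≤ _ := by gcongr
    have h2 : 2 * (ω 0 + θ) * (∫ x in p..q, f x) ≤
        -2 * wellPrimitive W b p * ω 0 + η / 3 + η / 3 := by
      calc 2 * (ω 0 + θ) * (∫ x in p..q, f x)
          ≤ 2 * (ω 0 + θ) * (-wellPrimitive W b p + σ * (b - a)) := by gcongr
        _ = -2 * wellPrimitive W b p * ω 0 + 2 * θ * (-wellPrimitive W b p) +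
            2 * (ω 0 + θ) * (σ * (b - a)) := by ring
        _ ≤ -2 * wellPrimitive W b p * ω 0 + 2 * θ * A + 2 * (ω 0 + 1) * (σ * (b - a)) := by
            gcongr
        _ ≤ _ := by rw [hσe]; linarith
    have h3 : 2 * ε * (ω 0 + θ) * (∫ x in p..q, f x) ≤
        ε * (-2 * wellPrimitive W b p * ω 0 + η / 3 + η / 3) := by
      calc _ = ε * (2 * (ω 0 + θ) * (∫ x in p..q, f x)) := by ring
        _ ≤ _ := by gcongr
    calc _ ≤ ε * (-2 * wellPrimitive W b p * ω 0 + η / 3 + η / 3) + ε * (η / 3) := by linarith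
      _ = _ := by ring
  · -- Here both data are within `B ε` of the well, and the affine competitor has energy `O(ε²)`.
    have hpb : |p - b| ≤ B * ε := by
      rw [abs_le] at hqb ⊢
      constructor
      · linarith [hqb.1]
      · have := mul_pos hB hε0
        linarith [hp.2]
    obtain ⟨u, hu, hle⟩ := exists_admissible_affine_le (W := W) (ω := ω) (ε := ε) (p := p)
      (q := q) (m := C * B ^ 2 * ε ^ 2) hWc hW.nonneg hT hω (fun x hx => by
        rw [uIcc_of_ge hpq.le] at hx
        rw [abs_le] at hqb hpb
        exact hWq x ⟨hq.1.trans hx.1, hx.2.trans hp.2⟩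
          (abs_le.2 ⟨by linarith [hqb.1, hx.1], by linarith [hpb.2, hx.2]⟩)) hΩ
    have hp0 : 0 ≤ -2 * wellPrimitive W b p * ω 0 := by
      have := hΦle p hp
      have : 0 ≤ -wellPrimitive W b p * ω 0 := mul_nonneg (by linarith) hω0.le
      linarith
    have h2 : (q - p) ^ 2 ≤ B ^ 2 := by
      have h3 : p - q ≤ B := by
        have : B * ε ≤ B := mul_le_of_le_one_right hB.le hε1.le
        linarith [(abs_le.1 hqb).1, hp.2]
      exact sq_le_sq' (by linarith) (by linarith)
    refine ⟨u, hu, hle.trans ?_⟩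
    calc T * ((C * B ^ 2 * ε ^ 2 + ε ^ 2 * ((q - p) / T) ^ 2) * Ω)
        = T * ((C * B ^ 2 * ε ^ 2 + ε ^ 2 * ((q - p) ^ 2 / T ^ 2)) * Ω) := by rw [div_pow]
      _ ≤ T * ((C * B ^ 2 * ε ^ 2 + ε ^ 2 * (B ^ 2 / T ^ 2)) * Ω) := by gcongr
      _ = ε * (ε * D) := by rw [hD]; ring
      _ ≤ _ := by gcongr; linarith

end Recovery

/-! ### Confinement of minimizers and exponential decay of the tail energy -/

lemma dW_eq {W : ℝ → ℝ} (hW : Continuous W) (b : ℝ) {r s : ℝ} (hrs : r ≤ s) :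
    dW W r s = 2 * (wellPrimitive W b s - wellPrimitive W b r) := by
  rw [dW, integral_sqrt_eq hW b, abs_of_nonneg (sub_nonneg.2 (monotone_wellPrimitive hW hrs))]

/-- The energy of `v` on `[t, T]`. -/
noncomputable def tailEnergy (W ω : ℝ → ℝ) (T ε : ℝ) (v : ℝ → ℝ) (t : ℝ) : ℝ :=
  ∫ r in t..T, energyDensity W ω ε v r

section Confinement

variable {W ω : ℝ → ℝ} {T : ℝ}

/-- For small `ε`, minimizers stay in a fixed compact interval that contains the well `b` but not the
well `a`: an excursion to either end costs more than the sharp upper bound allows. This is where the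
restriction on `ω₀` enters. -/
lemma exists_confinement {a b c : ℝ} (hW : IsDoubleWell W a b c) (hT : 0 < T) (hω : IsWeight T ω)
    {αm ω₀ B : ℝ} (hαm : a < αm) (hαmb : αm < b) (hω₀ : 0 ≤ ω₀)
    (hω₀' : ω₀ < 1 / 2 * (dW W a αm / CW W a b) * ω 0)
    (hclose : ∀ t ∈ Ioc 0 T, ω 0 - ω₀ < ω t) (hB : 0 < B) :
    ∃ a' b' ε₁ M : ℝ, a < a' ∧ a' ≤ αm ∧ b ≤ b' ∧ 0 < ε₁ ∧ 0 < M ∧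
      ∀ ε ∈ Ioo 0 ε₁, ∀ p ∈ Icc αm b, ∀ q ∈ Icc αm b, |q - b| ≤ B * ε →
        ∀ v, IsMinimizer W ω T ε p q v →
          (∀ t ∈ Icc 0 T, v t ∈ Icc a' b') ∧ tailEnergy W ω T ε v 0 ≤ M * ε := by
  have hWc := hW.contDiff.continuous
  have hω0 : 0 < ω 0 := hω.pos 0 ⟨le_rfl, hT.le⟩
  have hΦm := monotone_wellPrimitive (b := b) hWc
  have hΦc := continuous_wellPrimitive (b := b) hWc
  set A := -wellPrimitive W b a with hA
  set x := wellPrimitive W b αm - wellPrimitive W b a with hx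
  have hx0 : 0 < x := sub_pos.2 (wellPrimitive_lt hWc hαm fun t ht =>
    lt_of_le_of_ne (hW.nonneg t) fun h => by
      rcases (hW.zero_iff t).1 h.symm with h | h
      · exact ht.1.ne' h
      · exact absurd ht.2 (by rw [h]; exact not_lt.2 hαmb.le))
  have hΦle : ∀ y, y ≤ b → wellPrimitive W b y ≤ 0 := fun y hy => by
    rw [← wellPrimitive_self (W := W) (b := b)]; exact hΦm hy
  have hxA : x ≤ A := by have := hΦle αm hαmb.le; rw [hx, hA]; linarith
  have hA0 : 0 < A := hx0.trans_le hxA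
  -- The hypothesis on `ω₀` in terms of `x = d_W(a, αm) / 2` and `A = C_W / 2`.
  have hω₀A : 2 * ω₀ * A < x * ω 0 := by
    have h1 : CW W a b = 2 * A := by
      rw [CW, integral_sqrt_eq hWc b, wellPrimitive_self, zero_sub]
    rw [dW_eq hWc b hαm.le, h1, mul_div_mul_left _ _ two_ne_zero, ← hx] at hω₀'
    have h2 : 1 / 2 * (x / A) * ω 0 = x * ω 0 / (2 * A) := by field_simp
    rw [h2, lt_div_iff₀ (by positivity)] at hω₀'
    linarith
  set m := ω 0 - ω₀ with hm
  have hm2 : ω 0 / 2 ≤ m := by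
    have : 2 * ω₀ * A < A * ω 0 := hω₀A.trans_le (by gcongr)
    have : 2 * ω₀ < ω 0 := by
      by_contra h
      push Not at h
      nlinarith
    rw [hm]; linarith
  have hm0 : 0 < m := by linarith
  have hmω : m ≤ ω 0 := by rw [hm]; linarith
  -- The point `a'` is so close to `a` that passing through it costs nearly as much as passing through
  -- `a`, and `b'` is so far from `b` that reaching it costs more than the energy bound allows.
  obtain ⟨a', ha', hΦa'⟩ : ∃ a' ∈ Ioo a αm, wellPrimitive W b a' < wellPrimitive W b a + x / 8 := by
    have h1 : ∀ᶠ y in 𝓝[>] a, wellPrimitive W b y < wellPrimitive W b a + x / 8 :=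
      (hΦc.tendsto a).mono_left nhdsWithin_le_nhds |>.eventually_lt_const (by linarith)
    obtain ⟨y, h1, h2⟩ := (h1.and (Ioo_mem_nhdsGT hαm)).exists
    exact ⟨y, h2, h1⟩
  set η := ω 0 * x / 2 with hη
  have hη0 : 0 < η := by positivity
  obtain ⟨b', hbb', hΦb'⟩ : ∃ b', b ≤ b' ∧ 2 * A + η / ω 0 < wellPrimitive W b b' := by
    obtain ⟨b', h1, h2⟩ := ((eventually_ge_atTop b).and
      ((hW.tendsto_wellPrimitive (b := b)).eventually_gt_atTop (2 * A + η / ω 0))).exists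
    exact ⟨b', h1, h2⟩
  obtain ⟨L, hL, hLip⟩ := exists_lipschitz_wellPrimitive hWc b (max |αm| |b|)
  obtain ⟨ε₁, hε₁, hrec⟩ := exists_admissible_le_of_isDoubleWell hW hT hω hB hη0
  refine ⟨a', b', min ε₁ (x / (4 * L * B)), 2 * A * ω 0 + η, ha'.1, ha'.2.le, hbb', by positivity,
    by positivity, ?_⟩
  intro ε hε p hp q hq hqb v hv
  have hε0 := hε.1
  have hεx : 4 * L * B * ε < x := by
    have := hε.2.trans_le (min_le_right _ _)
    rw [lt_div_iff₀ (by positivity)] at this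
    linarith
  obtain ⟨u, hu, hule⟩ := hrec ε ⟨hε0, hε.2.trans_le (min_le_left _ _)⟩ p
    ⟨hαm.le.trans hp.1, hp.2⟩ q ⟨hαm.le.trans hq.1, hq.2⟩ hqb
  have hvle : tailEnergy W ω T ε v 0 ≤ ε * (-2 * wellPrimitive W b p * ω 0 + η) :=
    (hv.2 u hu).trans hule
  have hpA : -wellPrimitive W b p ≤ A := neg_le_neg (hΦm (hαm.le.trans hp.1))
  have hpx : x ≤ wellPrimitive W b p + A := by have := hΦm hp.1; rw [hx, hA]; linarith
  have hp0 := hΦle p hp.2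
  have hq0 : -(x / 4) ≤ wellPrimitive W b q := by
    have hmem : ∀ y ∈ Icc αm b, y ∈ Icc (-(max |αm| |b|)) (max |αm| |b|) := fun y hy =>
      ⟨by linarith [le_max_left |αm| |b|, neg_abs_le αm, hy.1],
        hy.2.trans ((le_abs_self b).trans (le_max_right _ _))⟩
    have h1 := hLip q (hmem q hq) b (hmem b ⟨hαmb.le, le_rfl⟩)
    rw [wellPrimitive_self, sub_zero] at h1
    have h2 : L * |q - b| ≤ L * (B * ε) := by gcongr
    linarith [(abs_le.1 h1).1]
  -- The energy dominates the cost of passing through any intermediate value.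
  have hlow : ∀ t ∈ Icc 0 T, 2 * m * (|wellPrimitive W b (v t) - wellPrimitive W b p| +
      |wellPrimitive W b q - wellPrimitive W b (v t)|) ≤ -2 * wellPrimitive W b p * ω 0 + η := by
    intro t ht
    have hH1 := hv.1.1
    have hmr : ∀ r ∈ Ioc 0 T, m ≤ ω r := fun r hr => (hclose r hr).le
    have h1 := hH1.two_mul_abs_sub_le_integral hWc hW.nonneg hω.continuousOn b hε0 hm0.le hmr
      le_rfl ht.1 ht.2
    have h2 := hH1.two_mul_abs_sub_le_integral hWc hW.nonneg hω.continuousOn b hε0 hm0.le hmr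
      ht.1 ht.2 le_rfl
    have hint := hH1.intervalIntegrable_energyDensity hT.le hWc hω.continuousOn ε
    have h3 := intervalIntegral.integral_add_adjacent_intervals
      (intervalIntegrable_mono hint le_rfl ht.1 ht.2)
      (intervalIntegrable_mono hint ht.1 ht.2 le_rfl)
    rw [hv.1.2.1] at h1
    rw [hv.1.2.2] at h2
    refine le_of_mul_le_mul_left ?_ hε0
    rw [tailEnergy, ← h3] at hvle
    linarith
  refine ⟨fun t ht => ⟨?_, ?_⟩, hvle.trans ?_⟩
  · by_contra! hlt
    have h1 := hlow t ht
    have h2 := hΦm hlt.le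
    have h3 : wellPrimitive W b p - wellPrimitive W b a' ≤
        |wellPrimitive W b (v t) - wellPrimitive W b p| := by
      rw [abs_sub_comm]; exact le_trans (by linarith) (le_abs_self _)
    have h4 : wellPrimitive W b q - wellPrimitive W b a' ≤
        |wellPrimitive W b q - wellPrimitive W b (v t)| :=
      le_trans (by linarith) (le_abs_self _)
    have h5 : 2 * m * ((wellPrimitive W b p + A) + A - 2 * (x / 8) - x / 4) ≤
        -2 * wellPrimitive W b p * ω 0 + η := by
      refine le_trans ?_ h1
      gcongr
      linarith
    have h6 : ω₀ * (wellPrimitive W b p + A + A) ≤ ω₀ * (2 * A) := by gcongr; linarith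
    have h7 : x * ω 0 ≤ (wellPrimitive W b p + A) * ω 0 := by gcongr
    have h8 : m * x ≤ ω 0 * x := by gcongr
    -- Reaching `a'` costs about `2 m (Φ(p) + 2 A)`, against the bound `-2 Φ(p) ω(0)`. Since
    -- `m = ω(0) - ω₀` and `-A + x ≤ Φ(p) ≤ 0`, the difference is at least `4 x ω(0) - 4 ω₀ A` up to
    -- small terms, and this exceeds `2 x ω(0)` by `hω₀A`.
    have h9 : m * (wellPrimitive W b p + A + A) =
      ω 0 * (wellPrimitive W b p + A) + ω 0 * A - ω₀ * (wellPrimitive W b p + A + A) := by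
      rw [hm]; ring
    have h10 : 0 < ω 0 * x := by positivity
    linarith
  · by_contra! hlt
    have h1 := hlow t ht
    have h2 := hΦm hlt.le
    have hΦb0 : 0 < wellPrimitive W b b' := lt_trans (by positivity) hΦb'
    have h3 : wellPrimitive W b b' ≤ |wellPrimitive W b (v t) - wellPrimitive W b p| :=
      le_trans (by linarith) (le_abs_self _)
    have h4 : ω 0 * wellPrimitive W b b' ≤ -2 * wellPrimitive W b p * ω 0 + η := by
      refine le_trans ?_ h1
      calc ω 0 * wellPrimitive W b b' = 2 * (ω 0 / 2) * (wellPrimitive W b b' + 0) := by ring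
        _ ≤ _ := by
          gcongr
          exact abs_nonneg _
    have h5 : ω 0 * (2 * A + η / ω 0) < ω 0 * wellPrimitive W b b' := by gcongr
    have h6 : ω 0 * (2 * A + η / ω 0) = 2 * A * ω 0 + η := by field_simp
    nlinarith
  · have h1 : -wellPrimitive W b p * ω 0 ≤ A * ω 0 := by gcongr
    rw [mul_comm]
    exact mul_le_mul_of_nonneg_right (by linarith) hε0.le

end Confinement

section HoleFilling

variable {W ω : ℝ → ℝ} {T ε : ℝ}

/-- The piecewise affine cutoff that vanishes before `t` and equals one after `t + ε`. -/
noncomputable def cutoff (t ε s : ℝ) : ℝ := max 0 (min 1 ((s - t) / ε))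

lemma lipschitzWith_cutoff (t : ℝ) (hε : 0 < ε) : LipschitzWith (ε⁻¹).toNNReal (cutoff t ε) := by
  refine LipschitzWith.const_max (LipschitzWith.const_min ?_ 1) 0
  refine LipschitzWith.of_dist_le_mul fun x y => ?_
  rw [Real.coe_toNNReal _ (inv_pos.2 hε).le, Real.dist_eq, Real.dist_eq, ← sub_div, abs_div,
    abs_of_pos hε, div_eq_inv_mul, sub_sub_sub_cancel_right]

lemma cutoff_nonneg (t ε s : ℝ) : 0 ≤ cutoff t ε s := le_max_left _ _

lemma cutoff_le_one (t ε s : ℝ) : cutoff t ε s ≤ 1 := max_le zero_le_one (min_le_left _ _)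

lemma cutoff_of_le {t s : ℝ} (hε : 0 < ε) (h : s ≤ t) : cutoff t ε s = 0 := by
  have : (s - t) / ε ≤ 0 := div_nonpos_of_nonpos_of_nonneg (by linarith) hε.le
  exact max_eq_left ((min_le_right _ _).trans this)

lemma cutoff_of_ge {t s : ℝ} (hε : 0 < ε) (h : t + ε ≤ s) : cutoff t ε s = 1 := by
  have : 1 ≤ (s - t) / ε := by rw [le_div_iff₀ hε]; linarith
  rw [cutoff, min_eq_left this, max_eq_right zero_le_one]

/-- The comparison function of the hole-filling argument: `v` interpolated to the constant `q`. -/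
noncomputable def interpolate (t ε q : ℝ) (v : ℝ → ℝ) (s : ℝ) : ℝ :=
  v s + cutoff t ε s * (q - v s)

lemma ae_deriv_interpolate {v : ℝ → ℝ} (hv : IsH1 T v) (hT : 0 ≤ T) (t : ℝ) (hε : 0 < ε) (q : ℝ) :
    ∀ᵐ s, s ∈ Icc 0 T → deriv (interpolate t ε q v) s =
      (1 - cutoff t ε s) * deriv v s + deriv (cutoff t ε) s * (q - v s) := by
  filter_upwards [hv.1.ae_differentiableAt, (lipschitzWith_cutoff t hε).ae_differentiableAt_real]
    with s h1 h2 hs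
  have hd := (h1 (by rwa [uIcc_of_le hT])).hasDerivAt
  have := hd.add (h2.hasDerivAt.mul (hd.const_sub q))
  exact (this.congr_deriv (by ring)).deriv

lemma abs_deriv_cutoff_le (t : ℝ) (hε : 0 < ε) (s : ℝ) : |deriv (cutoff t ε) s| ≤ ε⁻¹ := by
  have := norm_deriv_le_of_lipschitz (lipschitzWith_cutoff t hε) (x₀ := s)
  rwa [Real.coe_toNNReal _ (inv_pos.2 hε).le] at this

lemma isH1_interpolate {v : ℝ → ℝ} (hv : IsH1 T v) (hT : 0 ≤ T) (t : ℝ) (hε : 0 < ε) (q : ℝ) :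
    IsH1 T (interpolate t ε q v) := by
  have hχ : AbsolutelyContinuousOnInterval (cutoff t ε) 0 T :=
    (lipschitzWith_cutoff t hε).lipschitzOnWith.absolutelyContinuousOnInterval
  have hc : AbsolutelyContinuousOnInterval (fun _ : ℝ => q) 0 T :=
    (LipschitzWith.const q).lipschitzOnWith.absolutelyContinuousOnInterval
  refine ⟨hv.1.fun_add (hχ.fun_mul (hc.fun_sub hv.1)), ?_⟩
  obtain ⟨R, hR⟩ := hv.1.exists_bound
  rw [uIcc_of_le hT] at hR
  have hdom : MemLp (fun s => ‖deriv v s‖ + ε⁻¹ * (|q| + R)) 2 (volume.restrict (Ioo 0 T)) :=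
    hv.2.norm.add (memLp_const _)
  refine hdom.mono' (measurable_deriv _).aestronglyMeasurable ?_
  filter_upwards [ae_restrict_of_ae (ae_deriv_interpolate hv hT t hε q),
    ae_restrict_mem measurableSet_Ioo] with s h1 hs
  have hs' := Ioo_subset_Icc_self hs
  rw [h1 hs']
  refine (norm_add_le _ _).trans ?_
  rw [norm_mul, norm_mul]
  have h2 : ‖1 - cutoff t ε s‖ ≤ 1 := by
    rw [Real.norm_eq_abs, abs_le]
    constructor <;> linarith [cutoff_nonneg t ε s, cutoff_le_one t ε s]
  have h3 : ‖q - v s‖ ≤ |q| + R := (norm_sub_le _ _).trans (by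
    have := hR s hs'; rw [Real.norm_eq_abs q]; linarith)
  have h4 := abs_deriv_cutoff_le t hε s
  have h5 : (0 : ℝ) ≤ ε⁻¹ := by positivity
  gcongr
  · exact mul_le_of_le_one_left (norm_nonneg _) h2
  · exact h4

/-- The pointwise energy bound of the interpolation, with values `x`, slopes `y` of the minimizer and
`χ`, `χ'` of the cutoff. -/
lemma hole_filling_pointwise {k C b q r χ χ' x y y' Wx Wu : ℝ} (hε : 0 < ε) (hk : 0 < k)
    (hC : 0 < C) (hχ0 : 0 ≤ χ) (hχ1 : χ ≤ 1) (hχ' : |χ'| ≤ ε⁻¹) (hqr : (q - b) ^ 2 ≤ r ^ 2)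
    (hWx : 0 ≤ Wx) (hk' : k * (x - b) ^ 2 ≤ Wx) (hC' : Wu ≤ C * ((1 - χ) * x + χ * q - b) ^ 2)
    (hy' : y' = (1 - χ) * y + χ' * (q - x)) :
    Wu + ε ^ 2 * y' ^ 2 ≤
      ((2 * C + 4) / k + 2) * (Wx + ε ^ 2 * y ^ 2) + (2 * C + 4) * r ^ 2 := by
  have hχ2 : (1 - χ) ^ 2 ≤ 1 := pow_le_one₀ (by linarith) (by linarith)
  have h1 : ((1 - χ) * x + χ * q - b) ^ 2 ≤ 2 * (x - b) ^ 2 + 2 * r ^ 2 := by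
    have e : (1 - χ) * x + χ * q - b = (1 - χ) * (x - b) + χ * (q - b) := by ring
    have e1 : ((1 - χ) * (x - b)) ^ 2 ≤ (x - b) ^ 2 := by
      rw [mul_pow]
      exact mul_le_of_le_one_left (sq_nonneg _) hχ2
    have e2 : (χ * (q - b)) ^ 2 ≤ r ^ 2 := by
      rw [mul_pow]
      exact (mul_le_of_le_one_left (sq_nonneg _) (pow_le_one₀ hχ0 hχ1)).trans hqr
    rw [e]
    linarith [add_sq_le (a := (1 - χ) * (x - b)) (b := χ * (q - b))]
  have h2 : ε ^ 2 * y' ^ 2 ≤ 2 * (ε ^ 2 * y ^ 2) + 4 * (x - b) ^ 2 + 4 * r ^ 2 := by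
    have e0 : (ε * χ') ^ 2 ≤ 1 := by
      rw [← sq_abs, abs_mul, abs_of_pos hε]
      have h5 : ε * |χ'| ≤ 1 := by
        calc ε * |χ'| ≤ ε * ε⁻¹ := by gcongr
          _ = 1 := mul_inv_cancel₀ hε.ne'
      exact pow_le_one₀ (by positivity) h5
    have e1 : ((1 - χ) * (ε * y)) ^ 2 ≤ ε ^ 2 * y ^ 2 := by
      rw [mul_pow, ← mul_pow ε]
      exact mul_le_of_le_one_left (sq_nonneg _) hχ2
    have e2 : (ε * χ' * (q - x)) ^ 2 ≤ 2 * (x - b) ^ 2 + 2 * r ^ 2 := by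
      rw [mul_pow]
      refine (mul_le_of_le_one_left (sq_nonneg _) e0).trans ?_
      have := add_sq_le (a := q - b) (b := b - x)
      have e4 : q - b + (b - x) = q - x := by ring
      have e5 : (b - x) ^ 2 = (x - b) ^ 2 := by ring
      rw [e4, e5] at this
      linarith
    have e3 : ε * y' = (1 - χ) * (ε * y) + ε * χ' * (q - x) := by rw [hy']; ring
    rw [← mul_pow, e3]
    linarith [add_sq_le (a := (1 - χ) * (ε * y)) (b := ε * χ' * (q - x))]
  have h3 : (x - b) ^ 2 ≤ Wx / k := by
    rw [le_div_iff₀ hk, mul_comm]; exact hk'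
  have e2 : C * ((1 - χ) * x + χ * q - b) ^ 2 ≤ C * (2 * (x - b) ^ 2 + 2 * r ^ 2) := by gcongr
  have e3 : (2 * C + 4) * (x - b) ^ 2 ≤ (2 * C + 4) * (Wx / k) := by gcongr
  have e5 : 0 ≤ (2 * C + 4) / k * (ε ^ 2 * y ^ 2) := by positivity
  calc Wu + ε ^ 2 * y' ^ 2 ≤ (2 * C + 4) * (Wx / k) + 2 * (ε ^ 2 * y ^ 2) +
        (2 * C + 4) * r ^ 2 := by linarith
    _ ≤ (2 * C + 4) * (Wx / k) + 2 * (ε ^ 2 * y ^ 2) + (2 * C + 4) * r ^ 2 +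
        (2 * Wx + (2 * C + 4) / k * (ε ^ 2 * y ^ 2)) := by linarith
    _ = _ := by ring

/-- Hole filling: comparing the minimizer `v` with its interpolation to the boundary value `q` on
`[t, t + ε]` bounds the energy after `t` by the energy in this layer, up to the distance `r` of `q`
from the well. -/
lemma IsMinimizer.tailEnergy_le {p q r a' b' b k C Ω : ℝ} {v : ℝ → ℝ}
    (hv : IsMinimizer W ω T ε p q v) (hW : Continuous W) (hW0 : ∀ s, 0 ≤ W s) (hT : 0 ≤ T)
    (hω : IsWeight T ω) (hε : 0 < ε) (hk : 0 < k) (hC : 0 < C)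
    (hkW : ∀ x ∈ Icc a' b', k * (x - b) ^ 2 ≤ W x) (hCW : ∀ x ∈ Icc a' b', W x ≤ C * (x - b) ^ 2)
    (hΩ : ∀ t ∈ Icc 0 T, ω t ≤ Ω) (hmem : ∀ t ∈ Icc 0 T, v t ∈ Icc a' b') (hq : q ∈ Icc a' b')
    (hqr : |q - b| ≤ r) {t : ℝ} (ht : 0 ≤ t) (htT : t + ε ≤ T) :
    tailEnergy W ω T ε v t ≤ ((2 * C + 4) / k + 2) *
      (tailEnergy W ω T ε v t - tailEnergy W ω T ε v (t + ε)) + (3 * C + 4) * Ω * T * r ^ 2 := by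
  have hH1 := hv.1.1
  have hu1 := isH1_interpolate hH1 hT t hε q
  set u := interpolate t ε q v with hu
  have hule : ∀ s, s ≤ t → u s = v s := fun s hs => by
    simp only [hu, interpolate, cutoff_of_le hε hs]; ring
  have huge : ∀ s, t + ε ≤ s → u s = q := fun s hs => by
    simp only [hu, interpolate, cutoff_of_ge hε hs]; ring
  have hadm : IsAdmissible T p q u := ⟨hu1, by rw [hule 0 ht, hv.1.2.1], huge T htT⟩
  have htT' : t ≤ T := by linarith
  have hvi := hH1.intervalIntegrable_energyDensity hT hW hω.continuousOn ε
  have hui := hu1.intervalIntegrable_energyDensity hT hW hω.continuousOn ε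
  have hmin : ∫ s in (0 : ℝ)..T, energyDensity W ω ε v s ≤
      ∫ s in (0 : ℝ)..T, energyDensity W ω ε u s := hv.2 u hadm
  have hv1 := intervalIntegrable_mono hvi le_rfl ht htT'
  have hv2 := intervalIntegrable_mono hvi ht (by linarith : t ≤ t + ε) htT
  have hv3 := intervalIntegrable_mono hvi (by linarith : 0 ≤ t + ε) htT le_rfl
  have hu1' := intervalIntegrable_mono hui le_rfl ht htT'
  have hu2 := intervalIntegrable_mono hui ht (by linarith : t ≤ t + ε) htT
  have hu3 := intervalIntegrable_mono hui (by linarith : 0 ≤ t + ε) htT le_rfl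
  rw [← intervalIntegral.integral_add_adjacent_intervals hv1 (hv2.trans hv3),
    ← intervalIntegral.integral_add_adjacent_intervals hu1' (hu2.trans hu3),
    ← intervalIntegral.integral_add_adjacent_intervals hu2 hu3] at hmin
  have hr0 : 0 ≤ r := (abs_nonneg _).trans hqr
  have hqr2 : (q - b) ^ 2 ≤ r ^ 2 := sq_le_sq' (abs_le.1 hqr).1 (abs_le.1 hqr).2
  have hΩ0 : 0 ≤ Ω := (hω.pos 0 ⟨le_rfl, hT⟩).le.trans (hΩ 0 ⟨le_rfl, hT⟩)
  have hhead : ∫ s in (0 : ℝ)..t, energyDensity W ω ε u s =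
      ∫ s in (0 : ℝ)..t, energyDensity W ω ε v s := by
    rw [intervalIntegral.integral_of_le ht, intervalIntegral.integral_of_le ht,
      integral_Ioc_eq_integral_Ioo, integral_Ioc_eq_integral_Ioo]
    refine setIntegral_congr_fun measurableSet_Ioo fun s hs => ?_
    have : u =ᶠ[𝓝 s] v := by filter_upwards [Iio_mem_nhds hs.2] with y hy using hule y (le_of_lt hy)
    simp only [energyDensity, this.deriv_eq, this.eq_of_nhds]
  have htail : ∫ s in t + ε..T, energyDensity W ω ε u s ≤ ∫ _s in t + ε..T, C * r ^ 2 * Ω := by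
    refine intervalIntegral.integral_mono_on_of_le_Ioo htT hu3 intervalIntegrable_const
      fun s hs => ?_
    have : u =ᶠ[𝓝 s] fun _ => q := by
      filter_upwards [Ioi_mem_nhds hs.1] with y hy using huge y (le_of_lt hy)
    have hs' : s ∈ Icc 0 T := ⟨by linarith [hs.1], hs.2.le⟩
    simp only [energyDensity, this.deriv_eq, this.eq_of_nhds, deriv_const]
    have h1 := hCW q hq
    have h2 := hΩ s hs'
    have h3 := (hω.pos s hs').le
    have h4 := hW0 q
    have h5 : W q ≤ C * r ^ 2 := h1.trans (by gcongr)
    simp only [ne_eq, OfNat.ofNat_ne_zero, not_false_eq_true, zero_pow, mul_zero, add_zero]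
    gcongr
  have hmid : ∫ s in t..t + ε, energyDensity W ω ε u s ≤
      ∫ s in t..t + ε, (((2 * C + 4) / k + 2) * energyDensity W ω ε v s +
        (2 * C + 4) * r ^ 2 * Ω) := by
    refine intervalIntegral.integral_mono_ae_restrict (by linarith) hu2
      ((hv2.const_mul _).add intervalIntegrable_const) ?_
    filter_upwards [ae_restrict_of_ae (ae_deriv_interpolate hH1 hT t hε q),
      ae_restrict_mem measurableSet_Icc] with s hds hs
    have hs' : s ∈ Icc 0 T := ⟨ht.trans hs.1, hs.2.trans htT⟩
    have hχ0 := cutoff_nonneg t ε s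
    have hχ1 := cutoff_le_one t ε s
    have hvs := hmem s hs'
    set χ := cutoff t ε s with hχ
    have hus : u s = (1 - χ) * v s + χ * q := by simp only [hu, interpolate, ← hχ]; ring
    have humem : u s ∈ Icc a' b' := by
      rw [hus]
      exact ⟨by nlinarith [hvs.1, hq.1], by nlinarith [hvs.2, hq.2]⟩
    have h4 : W (u s) + ε ^ 2 * deriv u s ^ 2 ≤
        ((2 * C + 4) / k + 2) * (W (v s) + ε ^ 2 * deriv v s ^ 2) + (2 * C + 4) * r ^ 2 := by
      refine hole_filling_pointwise hε hk hC hχ0 hχ1 (abs_deriv_cutoff_le t hε s) hqr2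
        (hW0 _) (hkW _ hvs) ?_ (hds hs')
      rw [← hus]
      exact hCW _ humem
    have hωs := hω.pos s hs'
    have hΩs := hΩ s hs'
    calc energyDensity W ω ε u s ≤ (((2 * C + 4) / k + 2) * (W (v s) + ε ^ 2 * deriv v s ^ 2) +
          (2 * C + 4) * r ^ 2) * ω s := by unfold energyDensity; gcongr
      _ = ((2 * C + 4) / k + 2) * energyDensity W ω ε v s + (2 * C + 4) * r ^ 2 * ω s := by
          unfold energyDensity; ring
      _ ≤ _ := by gcongr
  rw [intervalIntegral.integral_add (hv2.const_mul _) intervalIntegrable_const,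
    intervalIntegral.integral_const_mul, intervalIntegral.integral_const, smul_eq_mul] at hmid
  rw [intervalIntegral.integral_const, smul_eq_mul] at htail
  -- The competitor agrees with `v` before `t`, so minimality compares the energies after `t`.
  have hE : tailEnergy W ω T ε v t = (∫ s in t..t + ε, energyDensity W ω ε v s) +
      tailEnergy W ω T ε v (t + ε) :=
    (intervalIntegral.integral_add_adjacent_intervals hv2 hv3).symm
  have hE' : tailEnergy W ω T ε v t = ∫ s in t..T, energyDensity W ω ε v s := rfl
  have h1 : (t + ε - t) * ((2 * C + 4) * r ^ 2 * Ω) ≤ T * ((2 * C + 4) * r ^ 2 * Ω) := by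
    gcongr; linarith
  have h2 : (T - (t + ε)) * (C * r ^ 2 * Ω) ≤ T * (C * r ^ 2 * Ω) := by
    gcongr; linarith
  have h3 : tailEnergy W ω T ε v t - tailEnergy W ω T ε v (t + ε) =
    ∫ s in t..t + ε, energyDensity W ω ε v s := by rw [hE]; ring
  rw [h3]
  rw [← hE', hhead] at hmin
  have h4 : (t + ε - t) * ((2 * C + 4) * r ^ 2 * Ω) + (T - (t + ε)) * (C * r ^ 2 * Ω) ≤
      (3 * C + 4) * Ω * T * r ^ 2 :=
    (add_le_add h1 h2).trans_eq (by ring)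
  linarith

lemma tailEnergy_anti {v : ℝ → ℝ} (hv : IsH1 T v) (hW : Continuous W) (hW0 : ∀ s, 0 ≤ W s)
    (hT : 0 ≤ T) (hω : IsWeight T ω) {s t : ℝ} (hs : 0 ≤ s) (hst : s ≤ t) (ht : t ≤ T) :
    tailEnergy W ω T ε v t ≤ tailEnergy W ω T ε v s := by
  have hvi := hv.intervalIntegrable_energyDensity hT hW hω.continuousOn ε
  have := intervalIntegral.integral_add_adjacent_intervals
    (intervalIntegrable_mono hvi hs hst ht) (intervalIntegrable_mono hvi (hs.trans hst) ht le_rfl)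
  have h0 : 0 ≤ ∫ r in s..t, energyDensity W ω ε v r :=
    intervalIntegral.integral_nonneg hst fun r hr =>
      energyDensity_nonneg hW0 hω ⟨hs.trans hr.1, hr.2.trans ht⟩
  unfold tailEnergy
  linarith

/-- Uniform estimates for minimizers: confinement near the well `b`, and exponential decay of the tail
energy on the scale `ε`, up to the squared distance `r` of the right boundary value from the well. -/
lemma exists_minimizer_estimates {a b c : ℝ} (hW : IsDoubleWell W a b c) (hT : 0 < T)
    (hω : IsWeight T ω) {αm ω₀ B : ℝ} (hαm : a < αm) (hαmb : αm < b) (hω₀ : 0 ≤ ω₀)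
    (hω₀' : ω₀ < 1 / 2 * (dW W a αm / CW W a b) * ω 0)
    (hclose : ∀ t ∈ Ioc 0 T, ω 0 - ω₀ < ω t) (hB : 0 < B) :
    ∃ a' b' ε₁ C μ : ℝ, a < a' ∧ a' ≤ αm ∧ b ≤ b' ∧ 0 < ε₁ ∧ 0 < C ∧ 0 < μ ∧
      ∀ ε ∈ Ioo 0 ε₁, ∀ p ∈ Icc αm b, ∀ q ∈ Icc αm b, ∀ r, |q - b| ≤ r → r ≤ B * ε →
        ∀ v, IsMinimizer W ω T ε p q v →
          (∀ t ∈ Icc 0 T, v t ∈ Icc a' b') ∧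
          ∀ t ∈ Icc 0 T, tailEnergy W ω T ε v t ≤ C * (ε * Real.exp (-(μ * (t / ε))) + r ^ 2) := by
  have hWc := hW.contDiff.continuous
  obtain ⟨a', b', ε₁, M, ha', ha'm, hb', hε₁, hM, hconf⟩ :=
    exists_confinement hW hT hω hαm hαmb hω₀ hω₀' hclose hB
  obtain ⟨k, hk, hkW⟩ := exists_sq_le hW (q := b') ha'
  obtain ⟨C, hC, hCW⟩ := exists_le_sq hW.contDiff ((hW.zero_iff b).2 (by simp))
    ((hW.deriv_zero_iff b).2 (by simp)) (max |a'| |b'|)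
  have hCW' : ∀ x ∈ Icc a' b', W x ≤ C * (x - b) ^ 2 := fun x hx => hCW x
    ⟨by linarith [le_max_left |a'| |b'|, neg_abs_le a', hx.1],
      hx.2.trans ((le_abs_self b').trans (le_max_right _ _))⟩
  obtain ⟨Ω, hΩ'⟩ := (isCompact_Icc (a := (0 : ℝ)) (b := T)).exists_bound_of_continuousOn
    hω.continuousOn
  have hΩ : ∀ t ∈ Icc 0 T, ω t ≤ Ω := fun t ht => (le_abs_self _).trans (hΩ' t ht)
  have hΩ0 : 0 < Ω := (hω.pos 0 ⟨le_rfl, hT.le⟩).trans_le (hΩ 0 ⟨le_rfl, hT.le⟩)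
  set C₁ := (2 * C + 4) / k + 2 with hC₁
  have hC₁2 : 2 ≤ C₁ := by have : 0 ≤ (2 * C + 4) / k := by positivity
                           linarith
  set D := (3 * C + 4) * Ω * T with hD
  have hD0 : 0 < D := by positivity
  -- Filling the hole: `E(t) ≤ C₁ (E(t) - E(t + ε)) + D r²` means `E(t + ε) ≤ θ E(t) + D r² / C₁`, and
  -- `D r²` is the fixed point of this recursion.
  set θ := (C₁ - 1) / C₁ with hθ
  have hθ0 : 0 < θ := div_pos (by linarith) (by linarith)
  have hθ1 : θ < 1 := by rw [hθ, div_lt_one (by linarith)]; linarith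
  have hθD : θ + 1 / C₁ = 1 := by rw [hθ]; field_simp; ring
  set μ := -Real.log θ with hμ
  have hμ0 : 0 < μ := neg_pos.2 (Real.log_neg hθ0 hθ1)
  refine ⟨a', b', ε₁, max (M * Real.exp μ) D, μ, ha', ha'm, hb', hε₁, by positivity, hμ0, ?_⟩
  intro ε hε p hp q hq r hqr hrB v hv
  have hε0 := hε.1
  obtain ⟨hmem, hE0⟩ := hconf ε hε p hp q hq (hqr.trans hrB) v hv
  refine ⟨hmem, fun t ht => ?_⟩
  have hstep : ∀ n : ℕ, n * ε ≤ T →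
      tailEnergy W ω T ε v (n * ε) ≤ θ ^ n * (M * ε) + D * r ^ 2 := by
    intro n
    induction n with
    | zero => intro _; simp only [Nat.cast_zero, zero_mul, pow_zero, one_mul]; nlinarith [sq_nonneg r]
    | succ n ih =>
      intro hn
      push_cast at hn ⊢
      have hn' : n * ε + ε ≤ T := by linarith
      have h1 := ih (by linarith)
      have h2 := hv.tailEnergy_le hWc hW.nonneg hT.le hω hε0 hk hC hkW hCW' hΩ hmem
        ⟨ha'm.trans hq.1, hq.2.trans hb'⟩ hqr (t := n * ε) (by positivity) hn'
      rw [← hC₁, ← hD] at h2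
      rw [show ((n : ℝ) + 1) * ε = n * ε + ε by ring]
      have h3 : tailEnergy W ω T ε v (n * ε + ε) ≤
          θ * tailEnergy W ω T ε v (n * ε) + 1 / C₁ * (D * r ^ 2) := by
        have hC₁0 : 0 < C₁ := by linarith
        have e : θ * tailEnergy W ω T ε v (n * ε) + 1 / C₁ * (D * r ^ 2) =
          ((C₁ - 1) * tailEnergy W ω T ε v (n * ε) + D * r ^ 2) / C₁ := by
          rw [hθ]; field_simp
        rw [e, le_div_iff₀ hC₁0]
        linarith
      calc _ ≤ θ * (θ ^ n * (M * ε) + D * r ^ 2) + 1 / C₁ * (D * r ^ 2) := by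
            refine h3.trans ?_; gcongr
        _ = θ ^ (n + 1) * (M * ε) + (θ + 1 / C₁) * (D * r ^ 2) := by ring
        _ = _ := by rw [hθD, one_mul]
  set n := ⌊t / ε⌋₊ with hn
  have hnt : n * ε ≤ t := by
    have := Nat.floor_le (div_nonneg ht.1 hε0.le)
    rwa [le_div_iff₀ hε0] at this
  have hθn : θ ^ n ≤ Real.exp μ * Real.exp (-(μ * (t / ε))) := by
    have h1 : θ = Real.exp (-μ) := by rw [hμ, neg_neg, Real.exp_log hθ0]
    rw [h1, ← Real.exp_nat_mul, ← Real.exp_add, Real.exp_le_exp]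
    have h2 := (Nat.lt_floor_add_one (t / ε)).le
    rw [← hn] at h2
    nlinarith
  calc tailEnergy W ω T ε v t ≤ tailEnergy W ω T ε v (n * ε) :=
        tailEnergy_anti hv.1.1 hWc hW.nonneg hT.le hω (by positivity) hnt ht.2
    _ ≤ θ ^ n * (M * ε) + D * r ^ 2 := hstep n (hnt.trans ht.2)
    _ ≤ Real.exp μ * Real.exp (-(μ * (t / ε))) * (M * ε) + D * r ^ 2 := by gcongr
    _ = (M * Real.exp μ) * (ε * Real.exp (-(μ * (t / ε)))) + D * r ^ 2 := by ring
    _ ≤ max (M * Real.exp μ) D * (ε * Real.exp (-(μ * (t / ε)))) +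
        max (M * Real.exp μ) D * r ^ 2 := by
        gcongr
        · exact le_max_left _ _
        · exact le_max_right _ _
    _ = _ := by ring

end HoleFilling

/-! ### Second-order expansion of the energy -/

section Expansion

variable {W ω v : ℝ → ℝ} {T ε b : ℝ}

lemma IsH1.continuousOn_wellPrimitive (hv : IsH1 T v) (hT : 0 ≤ T) (hW : Continuous W) (b : ℝ) :
    ContinuousOn (fun t => wellPrimitive W b (v t)) (Icc 0 T) :=
  (continuous_wellPrimitive hW).comp_continuousOn (hv.continuousOn hT)

lemma IsH1.intervalIntegrable_wellPrimitive (hv : IsH1 T v) (hT : 0 ≤ T) (hW : Continuous W)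
    (b : ℝ) : IntervalIntegrable (fun t => wellPrimitive W b (v t)) volume 0 T := by
  apply ContinuousOn.intervalIntegrable
  rw [uIcc_of_le hT]
  exact hv.continuousOn_wellPrimitive hT hW b

lemma IsWeight.continuousOn_weightDeriv (hω : IsWeight T ω) (hT : 0 < T) :
    ContinuousOn (weightDeriv T ω) (Icc 0 T) :=
  hω.contDiffOn.continuousOn_derivWithin (uniqueDiffOn_Icc hT) le_rfl

/-- The moment of the rescaled profile in the original variable, after integration by parts. -/
lemma IsH1.integral_momentIntegrand_rescale (hv : IsH1 T v) (hT : 0 ≤ T) (hW : Continuous W)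
    (hε : 0 < ε) (b : ℝ) {l : ℝ} (hl : 0 ≤ l) :
    ∫ s in (0 : ℝ)..l, momentIntegrand W (rescale T ε v) s =
      (wellPrimitive W b (v (min (ε * l) T)) * min (ε * l) T -
        ∫ t in (0 : ℝ)..min (ε * l) T, wellPrimitive W b (v t)) / ε := by
  set g : ℝ → ℝ := fun t => √(W (v t)) * deriv v t * t with hg
  have hgi : IntervalIntegrable g volume 0 T :=
    (hv.intervalIntegrable_sqrt_mul_deriv hW).mul_continuousOn continuousOn_id
  have hin : ∀ s, ε * s < T → momentIntegrand W (rescale T ε v) s = g (ε * s) := by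
    intro s hs
    have h1 : rescale T ε v =ᶠ[𝓝 s] fun s => v (ε * s) := by
      have : ∀ᶠ y in 𝓝 s, ε * y < T :=
        (continuous_const.mul continuous_id).continuousAt.eventually_lt continuousAt_const hs
      filter_upwards [this] with y hy
      simp only [rescale, min_eq_left hy.le]
    simp only [momentIntegrand, hg, h1.deriv_eq, h1.eq_of_nhds, deriv_comp_mul_left, smul_eq_mul]
    ring
  have hout : ∀ s, T < ε * s → momentIntegrand W (rescale T ε v) s = 0 := by
    intro s hs
    have h1 : rescale T ε v =ᶠ[𝓝 s] fun _ => v T := by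
      have : ∀ᶠ y in 𝓝 s, T < ε * y :=
        continuousAt_const.eventually_lt (continuous_const.mul continuous_id).continuousAt hs
      filter_upwards [this] with y hy
      simp only [rescale, min_eq_right hy.le]
    simp only [momentIntegrand, h1.deriv_eq, deriv_const, mul_zero, zero_mul]
  have hscale : ∀ r, 0 ≤ r → ε * r ≤ T →
      IntervalIntegrable (momentIntegrand W (rescale T ε v)) volume 0 r ∧
      ∫ s in (0 : ℝ)..r, momentIntegrand W (rescale T ε v) s =
      (wellPrimitive W b (v (ε * r)) * (ε * r) -
        ∫ t in (0 : ℝ)..(ε * r), wellPrimitive W b (v t)) / ε := by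
    intro r hr hrT
    have hεr : 0 ≤ ε * r := by positivity
    have hcongr : ∀ s ∈ Ioo 0 r, g (ε * s) = momentIntegrand W (rescale T ε v) s := fun s hs =>
      (hin s (lt_of_lt_of_le (by have := hs.2; gcongr) hrT)).symm
    constructor
    · have h1 := (intervalIntegrable_mono hgi le_rfl hεr hrT).comp_mul_left (c := ε)
      rw [zero_div, mul_div_cancel_left₀ _ hε.ne', intervalIntegrable_iff_integrableOn_Ioo_of_le hr]
        at h1
      rw [intervalIntegrable_iff_integrableOn_Ioo_of_le hr]
      exact h1.congr_fun hcongr measurableSet_Ioo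
    · have h1 : ∫ s in (0 : ℝ)..r, momentIntegrand W (rescale T ε v) s =
          ∫ s in (0 : ℝ)..r, g (ε * s) := by
        rw [intervalIntegral.integral_of_le hr, intervalIntegral.integral_of_le hr,
          integral_Ioc_eq_integral_Ioo, integral_Ioc_eq_integral_Ioo]
        exact (setIntegral_congr_fun measurableSet_Ioo hcongr).symm
      rw [h1, intervalIntegral.integral_comp_mul_left _ hε.ne', mul_zero, smul_eq_mul,
        hv.integral_sqrt_mul_deriv_mul_id hW b hεr hrT, inv_mul_eq_div]
  rcases le_total (ε * l) T with h | h
  · rw [min_eq_left h]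
    exact (hscale l hl h).2
  · rw [min_eq_right h]
    have hTε : ε * (T / ε) = T := mul_div_cancel₀ _ hε.ne'
    have hTl : T / ε ≤ l := by rwa [div_le_iff₀ hε, mul_comm]
    obtain ⟨h1, h2⟩ := hscale (T / ε) (div_nonneg hT hε.le) hTε.le
    have hzero : ∀ s ∈ Ioo (T / ε) l, (0 : ℝ) = momentIntegrand W (rescale T ε v) s := fun s hs =>
      (hout s (by have := hs.1; rwa [div_lt_iff₀ hε, mul_comm] at this)).symm
    have h3 : IntervalIntegrable (momentIntegrand W (rescale T ε v)) volume (T / ε) l := by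
      rw [intervalIntegrable_iff_integrableOn_Ioo_of_le hTl]
      exact integrableOn_zero.congr_fun hzero measurableSet_Ioo
    have h4 : ∫ s in T / ε..l, momentIntegrand W (rescale T ε v) s = 0 := by
      rw [intervalIntegral.integral_of_le hTl, integral_Ioc_eq_integral_Ioo,
        ← setIntegral_congr_fun measurableSet_Ioo hzero, integral_zero]
    rw [← intervalIntegral.integral_add_adjacent_intervals h1 h3, h4, add_zero, h2, hTε]

/-- Replacing `ω'(t)` by `ω'(0)` against a density that concentrates in `[0, h]`. -/
lemma abs_integral_mul_weightDeriv_sub_le {f : ℝ → ℝ} (hf : ContinuousOn f (Icc 0 T)) (hT : 0 < T)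
    (hω : IsWeight T ω) {d K : ℝ≥0}
    (hH : HolderOnWith K d (weightDeriv T ω) (Icc 0 T)) {h : ℝ} (hh : 0 ≤ h) (hhT : h ≤ T) :
    |(∫ t in (0 : ℝ)..T, f t * weightDeriv T ω t) - weightDeriv T ω 0 * ∫ t in (0 : ℝ)..T, f t| ≤
      K * h ^ (d : ℝ) * (∫ t in (0 : ℝ)..T, |f t|) + K * T ^ (d : ℝ) * ∫ t in h..T, |f t| := by
  have hωc := hω.continuousOn_weightDeriv hT
  have hc : ∀ {g : ℝ → ℝ}, ContinuousOn g (Icc 0 T) → IntervalIntegrable g volume 0 T := by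
    intro g hg
    apply ContinuousOn.intervalIntegrable
    rwa [uIcc_of_le hT.le]
  have hd : ContinuousOn (fun t => f t * (weightDeriv T ω t - weightDeriv T ω 0)) (Icc 0 T) :=
    hf.mul (hωc.sub continuousOn_const)
  have e : (∫ t in (0 : ℝ)..T, f t * weightDeriv T ω t) - weightDeriv T ω 0 * ∫ t in (0 : ℝ)..T, f t
      = ∫ t in (0 : ℝ)..T, f t * (weightDeriv T ω t - weightDeriv T ω 0) := by
    rw [← intervalIntegral.integral_const_mul, ← intervalIntegral.integral_sub
      (f := fun t => f t * weightDeriv T ω t) (hc (hf.mul hωc)) ((hc hf).const_mul _)]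
    refine intervalIntegral.integral_congr fun t _ => ?_
    ring
  have hpt : ∀ t ∈ Icc 0 T, ∀ h', t ≤ h' →
      |f t * (weightDeriv T ω t - weightDeriv T ω 0)| ≤ K * h' ^ (d : ℝ) * |f t| := by
    intro t ht h' hth
    have h1 := hH.dist_le ht ⟨le_rfl, hT.le⟩
    rw [Real.dist_eq, Real.dist_eq, sub_zero, abs_of_nonneg ht.1] at h1
    have h2 : t ^ (d : ℝ) ≤ h' ^ (d : ℝ) := Real.rpow_le_rpow ht.1 hth d.2
    rw [abs_mul, mul_comm]
    gcongr
    exact h1.trans (by gcongr)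
  have hf1 := hc hf.abs
  have hd1 := hc hd.abs
  rw [e]
  refine (intervalIntegral.abs_integral_le_integral_abs hT.le).trans ?_
  rw [← intervalIntegral.integral_add_adjacent_intervals
    (intervalIntegrable_mono hd1 le_rfl hh hhT) (intervalIntegrable_mono hd1 hh hhT le_rfl)]
  have hle1 : ∫ t in (0 : ℝ)..h, |f t| ≤ ∫ t in (0 : ℝ)..T, |f t| := by
    rw [← intervalIntegral.integral_add_adjacent_intervals
      (intervalIntegrable_mono hf1 le_rfl hh hhT) (intervalIntegrable_mono hf1 hh hhT le_rfl)]
    linarith [intervalIntegral.integral_nonneg (μ := volume) (f := fun t => |f t|) hhT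
      fun t _ => abs_nonneg (f t)]
  refine add_le_add ?_ ?_
  · calc _ ≤ ∫ t in (0 : ℝ)..h, K * h ^ (d : ℝ) * |f t| :=
          intervalIntegral.integral_mono_on hh (intervalIntegrable_mono hd1 le_rfl hh hhT)
            ((intervalIntegrable_mono hf1 le_rfl hh hhT).const_mul _)
            fun t ht => hpt t ⟨ht.1, ht.2.trans hhT⟩ h ht.2
      _ = K * h ^ (d : ℝ) * ∫ t in (0 : ℝ)..h, |f t| := intervalIntegral.integral_const_mul _ _
      _ ≤ _ := by gcongr
  · calc _ ≤ ∫ t in h..T, K * T ^ (d : ℝ) * |f t| :=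
          intervalIntegral.integral_mono_on hhT (intervalIntegrable_mono hd1 hh hhT le_rfl)
            ((intervalIntegrable_mono hf1 hh hhT le_rfl).const_mul _)
            fun t ht => hpt t ⟨hh.trans ht.1, ht.2⟩ T ht.2
      _ = _ := intervalIntegral.integral_const_mul _ _

/-- The second-order energy dominates the first moment of the rescaled profile up to errors that only
involve `Φ` at the boundary values and the tail of `Φ ∘ v`. -/
lemma IsH1.moment_sub_le_G2 (hv : IsH1 T v) (hT : 0 < T) (hW : Continuous W)
    (hW0 : ∀ s, 0 ≤ W s) (hω : IsWeight T ω) (hε : 0 < ε) {α : ℝ} (hα : α ≤ b) {Ω R l : ℝ}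
    (hΩ : ω T ≤ Ω)
    (hR : |(∫ t in (0 : ℝ)..T, wellPrimitive W b (v t) * weightDeriv T ω t) -
      weightDeriv T ω 0 * ∫ t in (0 : ℝ)..T, wellPrimitive W b (v t)| ≤ R) (hl : 0 ≤ l) :
    2 * weightDeriv T ω 0 * (∫ s in (0 : ℝ)..l, momentIntegrand W (rescale T ε v) s) -
      2 / ε * (|wellPrimitive W b (v T)| * Ω + |wellPrimitive W b (v 0) - wellPrimitive W b α| * ω 0
        + R + |weightDeriv T ω 0| * ((∫ t in min (ε * l) T..T, |wellPrimitive W b (v t)|) +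
          min (ε * l) T * |wellPrimitive W b (v (min (ε * l) T))|)) ≤ G2 W ω T b α ε v := by
  have hL0 : 0 ≤ min (ε * l) T := le_min (by positivity) hT.le
  have hLT : min (ε * l) T ≤ T := min_le_right _ _
  rw [hv.integral_momentIntegrand_rescale hT.le hW hε b hl]
  set L := min (ε * l) T with hL
  have hΦi := hv.intervalIntegrable_wellPrimitive hT.le hW b
  have hω0 := hω.pos 0 ⟨le_rfl, hT.le⟩
  have hωT := hω.pos T ⟨hT.le, le_rfl⟩
  set ω' := weightDeriv T ω 0 with hω'
  have hG : G2 W ω T b α ε v =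
      ((∫ t in (0 : ℝ)..T, energyDensity W ω ε v t) / ε + 2 * wellPrimitive W b α * ω 0) / ε := by
    rw [G2, G1, dW_eq hW b hα, wellPrimitive_self]
    have : G W ω T ε v = ∫ t in (0 : ℝ)..T, energyDensity W ω ε v t := rfl
    rw [this]
    ring
  have hdef : 0 ≤ ∫ t in (0 : ℝ)..T, equipartitionDefect W ε v t * ω t :=
    intervalIntegral.integral_nonneg hT.le fun t ht => mul_nonneg (sq_nonneg _) (hω.pos t ht).le
  have hid := hv.integral_energyDensity_eq hW hW0 hT.le hω b ε
  set J := ∫ t in (0 : ℝ)..T, wellPrimitive W b (v t) * weightDeriv T ω t with hJ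
  have hE : 2 * (wellPrimitive W b (v T) * ω T - wellPrimitive W b (v 0) * ω 0 - J) ≤
      (∫ t in (0 : ℝ)..T, energyDensity W ω ε v t) / ε := by
    rw [le_div_iff₀ hε, hid]
    linarith
  have hsplit := intervalIntegral.integral_add_adjacent_intervals
    (intervalIntegrable_mono hΦi le_rfl hL0 hLT) (intervalIntegrable_mono hΦi hL0 hLT le_rfl)
  rw [← hsplit] at hR
  have habs := intervalIntegral.abs_integral_le_integral_abs (μ := volume)
    (f := fun t => wellPrimitive W b (v t)) hLT
  set I₁ := ∫ t in (0 : ℝ)..L, wellPrimitive W b (v t)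
  set I₂ := ∫ t in L..T, wellPrimitive W b (v t)
  set N₂ := ∫ t in L..T, |wellPrimitive W b (v t)|
  have h1 : -(|wellPrimitive W b (v T)| * Ω) ≤ wellPrimitive W b (v T) * ω T := by
    calc -(|wellPrimitive W b (v T)| * Ω) ≤ -(|wellPrimitive W b (v T)| * ω T) := by gcongr
      _ ≤ _ := by nlinarith [neg_abs_le (wellPrimitive W b (v T))]
  have h2 : -(|wellPrimitive W b (v 0) - wellPrimitive W b α| * ω 0) ≤
      -((wellPrimitive W b (v 0) - wellPrimitive W b α) * ω 0) := by
    gcongr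
    exact le_abs_self _
  have h3 : ω' * I₂ ≤ |ω'| * N₂ := by
    calc ω' * I₂ ≤ |ω'| * |I₂| := by rw [← abs_mul]; exact le_abs_self _
      _ ≤ _ := by gcongr
  have h4 : ω' * (wellPrimitive W b (v L) * L) ≤ |ω'| * (L * |wellPrimitive W b (v L)|) := by
    calc ω' * (wellPrimitive W b (v L) * L) ≤ |ω' * (wellPrimitive W b (v L) * L)| := le_abs_self _
      _ = _ := by rw [abs_mul, abs_mul, abs_of_nonneg hL0, mul_comm L]
  have h5 := (abs_le.1 hR).2
  rw [hG]
  have hfin : 2 * ω' * (wellPrimitive W b (v L) * L - I₁) -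
      2 * (|wellPrimitive W b (v T)| * Ω + |wellPrimitive W b (v 0) - wellPrimitive W b α| * ω 0
        + R + |ω'| * (N₂ + L * |wellPrimitive W b (v L)|)) ≤
      (∫ t in (0 : ℝ)..T, energyDensity W ω ε v t) / ε + 2 * wellPrimitive W b α * ω 0 := by
    nlinarith
  calc _ = (2 * ω' * (wellPrimitive W b (v L) * L - I₁) -
      2 * (|wellPrimitive W b (v T)| * Ω + |wellPrimitive W b (v 0) - wellPrimitive W b α| * ω 0
        + R + |ω'| * (N₂ + L * |wellPrimitive W b (v L)|))) / ε := by ring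
    _ ≤ _ := by gcongr

end Expansion

section Uniform

variable {W ω : ℝ → ℝ} {T : ℝ}

/-- The decay of the tail energy, expressed through `Φ ∘ v`. -/
lemma exists_wellPrimitive_estimates {a b c : ℝ} (hW : IsDoubleWell W a b c) (hT : 0 < T)
    (hω : IsWeight T ω) {αm ω₀ B : ℝ} (hαm : a < αm) (hαmb : αm < b) (hω₀ : 0 ≤ ω₀)
    (hω₀' : ω₀ < 1 / 2 * (dW W a αm / CW W a b) * ω 0)
    (hclose : ∀ t ∈ Ioc 0 T, ω 0 - ω₀ < ω t) (hB : 0 < B) :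
    ∃ R ε₁ C μ : ℝ, 0 < ε₁ ∧ ε₁ < 1 ∧ 0 < C ∧ 0 < μ ∧
      ∀ ε ∈ Ioo 0 ε₁, ∀ p ∈ Icc αm b, ∀ q ∈ Icc αm b, ∀ r, |q - b| ≤ r → r ≤ B * ε →
        ∀ v, IsMinimizer W ω T ε p q v →
          (∀ t ∈ Icc 0 T, v t ∈ Icc (-R) R) ∧ |wellPrimitive W b q| ≤ C * r ^ 2 ∧
          (∀ t ∈ Icc 0 T, ∫ s in t..T, |wellPrimitive W b (v s)| ≤
            C * (ε * Real.exp (-(μ * (t / ε))) + r ^ 2)) ∧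
          ∀ t ∈ Icc 0 T, |wellPrimitive W b (v t)| ≤
            C * (Real.exp (-(μ * (t / ε))) + r ^ 2 / ε) := by
  have hWc := hW.contDiff.continuous
  obtain ⟨a', b', ε₁, C, μ, ha', ha'm, hb', hε₁, hC, hμ, hest⟩ :=
    exists_minimizer_estimates hW hT hω hαm hαmb hω₀ hω₀' hclose hB
  obtain ⟨k, hk, hkW⟩ := exists_sq_le hW (q := b') ha'
  set R := max |a'| |b'| with hR
  have hmemR : Icc a' b' ⊆ Icc (-R) R := Icc_subset_Icc
    (by linarith [le_max_left |a'| |b'|, neg_abs_le a']) ((le_abs_self b').trans (le_max_right _ _))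
  obtain ⟨D, hD, hΦD⟩ := exists_abs_wellPrimitive_le (b := b) hW.contDiff
    ((hW.zero_iff b).2 (by simp)) ((hW.deriv_zero_iff b).2 (by simp)) R
  obtain ⟨t₀, ht₀, hmin⟩ := isCompact_Icc.exists_isMinOn
    (nonempty_Icc.2 hT.le) hω.continuousOn
  set m := ω t₀ with hm
  have hm0 : 0 < m := hω.pos t₀ ht₀
  have hmω : ∀ t ∈ Icc 0 T, m ≤ ω t := fun t ht => hmin ht
  refine ⟨R, min ε₁ (1 / 2), D + D / k / m * C + C / (2 * m), μ, by positivity,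
    (min_le_right _ _).trans_lt (by norm_num), by positivity, hμ, ?_⟩
  intro ε hε p hp q hq r hqr hrB v hv
  have hε0 := hε.1
  have hε1 : ε ≤ 1 := (hε.2.trans_le (min_le_right _ _)).le.trans (by norm_num)
  obtain ⟨hmem, hE⟩ := hest ε ⟨hε0, hε.2.trans_le (min_le_left _ _)⟩ p hp q hq r hqr hrB v hv
  have hH1 := hv.1.1
  have hr0 : 0 ≤ r := (abs_nonneg _).trans hqr
  have hqmem : q ∈ Icc a' b' := ⟨ha'm.trans hq.1, hq.2.trans hb'⟩
  have hΦq : |wellPrimitive W b q| ≤ D * r ^ 2 := by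
    refine (hΦD q (hmemR hqmem)).trans ?_
    gcongr D * ?_
    exact sq_le_sq' (abs_le.1 hqr).1 (abs_le.1 hqr).2
  have hDk : 0 ≤ D / k / m * C := by positivity
  have hCm : 0 ≤ C / (2 * m) := by positivity
  have hEi := hH1.intervalIntegrable_energyDensity hT.le hWc hω.continuousOn ε
  refine ⟨fun t ht => hmemR (hmem t ht), ?_, fun t ht => ?_, fun t ht => ?_⟩
  · refine hΦq.trans ?_
    gcongr
    linarith
  · have h1 : ∫ s in t..T, |wellPrimitive W b (v s)| ≤ D / k / m * tailEnergy W ω T ε v t := by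
      rw [tailEnergy, ← intervalIntegral.integral_const_mul]
      refine intervalIntegral.integral_mono_on ht.2
        (intervalIntegrable_mono (hH1.intervalIntegrable_wellPrimitive hT.le hWc b).abs ht.1 ht.2
          le_rfl) ((intervalIntegrable_mono hEi ht.1 ht.2 le_rfl).const_mul _) fun s hs => ?_
      have hs' : s ∈ Icc 0 T := ⟨ht.1.trans hs.1, hs.2⟩
      have e1 := hΦD _ (hmemR (hmem s hs'))
      have e2 := hkW _ (hmem s hs')
      have e3 := hmω s hs'
      have e4 := hW.nonneg (v s)
      have e5 : (v s - b) ^ 2 ≤ W (v s) / k := by rw [le_div_iff₀ hk]; linarith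
      have e6 : W (v s) * m ≤ energyDensity W ω ε v s := by
        unfold energyDensity
        gcongr
        have : 0 ≤ ε ^ 2 * deriv v s ^ 2 := by positivity
        linarith
      calc |wellPrimitive W b (v s)| ≤ D * (W (v s) / k) := e1.trans (by gcongr)
        _ = D / k / m * (W (v s) * m) := by field_simp
        _ ≤ _ := by gcongr
    have h2 := hE t ht
    have h3 : 0 ≤ ε * Real.exp (-(μ * (t / ε))) + r ^ 2 := by positivity
    calc _ ≤ D / k / m * (C * (ε * Real.exp (-(μ * (t / ε))) + r ^ 2)) := h1.trans (by gcongr)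
      _ = D / k / m * C * (ε * Real.exp (-(μ * (t / ε))) + r ^ 2) := by ring
      _ ≤ _ := by gcongr; linarith
  · -- For the pointwise bound, the energy after `t` pays for the way from `v t` to `q`.
    have h1 := hH1.two_mul_abs_sub_le_integral hWc hW.nonneg hω.continuousOn b hε0 hm0.le
      (fun r hr => hmω r ⟨hr.1.le, hr.2⟩) ht.1 ht.2 le_rfl
    rw [hv.1.2.2] at h1
    have h2 : 2 * ε * m * |wellPrimitive W b q - wellPrimitive W b (v t)| ≤
        C * (ε * Real.exp (-(μ * (t / ε))) + r ^ 2) := h1.trans (hE t ht)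
    have h3 : |wellPrimitive W b q - wellPrimitive W b (v t)| ≤
        C / (2 * m) * (Real.exp (-(μ * (t / ε))) + r ^ 2 / ε) := by
      have e : C / (2 * m) * (Real.exp (-(μ * (t / ε))) + r ^ 2 / ε) =
        C * (ε * Real.exp (-(μ * (t / ε))) + r ^ 2) / (2 * ε * m) := by field_simp
      rw [e, le_div_iff₀ (by positivity)]
      linarith
    have h4 : |wellPrimitive W b (v t)| ≤ |wellPrimitive W b q| +
        |wellPrimitive W b q - wellPrimitive W b (v t)| := by
      have := abs_sub_abs_le_abs_sub (wellPrimitive W b (v t)) (wellPrimitive W b q)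
      rw [abs_sub_comm] at this
      linarith
    have h5 : r ^ 2 ≤ r ^ 2 / ε := le_div_self (by positivity) hε0 hε1
    have h6 : D * r ^ 2 ≤ D * (Real.exp (-(μ * (t / ε))) + r ^ 2 / ε) := by
      gcongr
      linarith [Real.exp_pos (-(μ * (t / ε)))]
    calc _ ≤ (D + C / (2 * m)) * (Real.exp (-(μ * (t / ε))) + r ^ 2 / ε) := by linarith
      _ ≤ _ := by
        gcongr
        linarith

end Uniform

/-! ### The uniform lower bound -/

lemma exp_neg_le_inv {y : ℝ} (hy : 0 < y) : Real.exp (-y) ≤ y⁻¹ := by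
  rw [Real.exp_neg]
  exact inv_anti₀ hy (by linarith [Real.add_one_le_exp y])

/-- The lower bound for the second-order energy of minimizers, with constants that do not depend on
`γ` and with an error exponent `min (d / 2) (γ - 1) (1 / 2)`. -/
lemma exists_moment_sub_le_G2 {W ω : ℝ → ℝ} {T a b c : ℝ} (hW : IsDoubleWell W a b c) (hT : 0 < T)
    (hω : IsWeight T ω) {αm ω₀ A₀ B₀ : ℝ} (hαm : a < αm) (hαmb : αm < b) (hω₀ : 0 ≤ ω₀)
    (hω₀' : ω₀ < 1 / 2 * (dW W a αm / CW W a b) * ω 0)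
    (hclose : ∀ t ∈ Ioc 0 T, ω 0 - ω₀ < ω t) (hA₀ : 0 < A₀) (hB₀ : 0 < B₀) :
    ∃ ε₀ N μ : ℝ, 0 < ε₀ ∧ ε₀ < 1 ∧ 0 < N ∧ 0 < μ ∧ ∀ γ : ℝ, 1 < γ → ∃ γ₁ : ℝ, 0 < γ₁ ∧
      ∀ ε ∈ Ioo 0 ε₀, ∀ p ∈ Icc αm b, ∀ q ∈ Icc αm b, ∀ α ∈ Icc αm b,
        |p - α| ≤ A₀ * ε ^ γ → |q - b| ≤ B₀ * ε ^ γ → ∀ v, IsMinimizer W ω T ε p q v →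
          ∀ l : ℝ, 0 < l →
            2 * weightDeriv T ω 0 *
                (∫ s in (0 : ℝ)..l, momentIntegrand W (rescale T ε v) s) -
              N * (Real.exp (-(l * μ)) * (l * μ + 1) + ε ^ γ₁) ≤ G2 W ω T b α ε v := by
  have hWc := hW.contDiff.continuous
  obtain ⟨R₀, ε₁, C, μ, hε₁, hε₁1, hC, hμ, hest⟩ :=
    exists_wellPrimitive_estimates hW hT hω hαm hαmb hω₀ hω₀' hclose hB₀
  obtain ⟨Lφ, hLφ, hLip⟩ := exists_lipschitz_wellPrimitive hWc b (max |αm| |b|)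
  have hmemR : Icc αm b ⊆ Icc (-(max |αm| |b|)) (max |αm| |b|) := Icc_subset_Icc
    (by linarith [le_max_left |αm| |b|, neg_abs_le αm]) ((le_abs_self b).trans (le_max_right _ _))
  obtain ⟨d, K, hd, -, hH⟩ := hω.holder
  have hd' : (0 : ℝ) < d := hd
  have hωT : 0 < ω T := hω.pos T ⟨hT.le, le_rfl⟩
  have hω0 : 0 < ω 0 := hω.pos 0 ⟨le_rfl, hT.le⟩
  set ω' := weightDeriv T ω 0 with hω'
  set N₁ := C * ω T * B₀ ^ 2 with hN₁
  set N₂ := Lφ * A₀ * ω 0 with hN₂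
  set N₃ := K * C * (1 + B₀ ^ 2) + K * T ^ (d : ℝ) * C * (μ⁻¹ + B₀ ^ 2) with hN₃
  set N₄ := C * (1 + B₀ ^ 2) with hN₄
  set N₅ := C * (μ⁻¹ + T * B₀ ^ 2) with hN₅
  refine ⟨min ε₁ (T ^ 2), 2 * (N₁ + N₂ + N₃ + |ω'| * (N₄ + N₅)), μ,
    by positivity, (min_le_left _ _).trans_lt hε₁1, by positivity, hμ, fun γ hγ => ?_⟩
  have hγ1 : 0 < γ - 1 := sub_pos.2 hγ
  set γ₁ := min ((d : ℝ) / 2) (min (γ - 1) (1 / 2)) with hγ₁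
  refine ⟨γ₁, by positivity, ?_⟩
  intro ε hε p hp q hq α hα hpα hqb v hv l hl
  have hε0 : 0 < ε := hε.1
  have hε1 : ε < 1 := hε.2.trans ((min_le_left _ _).trans_lt hε₁1)
  set X := ε ^ γ₁ with hX
  have hX0 : 0 < X := Real.rpow_pos_of_pos hε0 _
  have hpow : ∀ {e : ℝ}, γ₁ ≤ e → ε ^ e ≤ X := fun he =>
    Real.rpow_le_rpow_of_exponent_ge hε0 hε1.le he
  have hX1 : X ≤ 1 := Real.rpow_le_one hε0.le hε1.le (by positivity)
  have hεγ : ε ^ γ = ε ^ (γ - 1) * ε := by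
    rw [Real.rpow_sub_one hε0.ne']; field_simp
  have hγX : ε ^ (γ - 1) ≤ X := hpow ((min_le_right _ _).trans (min_le_left _ _))
  have hγ0 : 0 < ε ^ (γ - 1) := Real.rpow_pos_of_pos hε0 _
  set r := B₀ * ε ^ γ with hr
  have hr0 : 0 ≤ r := by positivity
  have hrB : r ≤ B₀ * ε := by
    rw [hr, hεγ]
    gcongr
    exact mul_le_of_le_one_left hε0.le (hγX.trans hX1)
  -- The mismatch at `T` enters as `r² / ε²`, which is small because `γ > 1`.
  have hρ : r ^ 2 / ε / ε ≤ B₀ ^ 2 * X := by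
    have e : r ^ 2 / ε / ε = B₀ ^ 2 * (ε ^ (γ - 1) * ε ^ (γ - 1)) := by
      rw [hr, hεγ]; field_simp
    rw [e]
    gcongr
    exact (mul_le_of_le_one_left hγ0.le (hγX.trans hX1)).trans hγX
  have hρ1 : r ^ 2 / ε ≤ B₀ ^ 2 * X := (le_div_self (by positivity) hε0 hε1.le).trans hρ
  obtain ⟨-, hΦq, hint, hpt⟩ := hest ε ⟨hε0, hε.2.trans_le (min_le_left _ _)⟩ p hp q hq r hqb hrB
    v hv
  have hH1 := hv.1.1
  have hsε : √ε ≤ T := Real.sqrt_le_left hT.le |>.2 (hε.2.trans_le (min_le_right _ _)).le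
  have hsX : √ε ≤ X := by
    rw [Real.sqrt_eq_rpow]; exact hpow ((min_le_right _ _).trans (min_le_right _ _))
  have hRle := abs_integral_mul_weightDeriv_sub_le (hH1.continuousOn_wellPrimitive hT.le hWc b) hT
    hω hH (Real.sqrt_nonneg ε) hsε
  have hmain := hH1.moment_sub_le_G2 hT hWc hW.nonneg hω hε0 hα.2 le_rfl hRle hl.le
  rw [hv.1.2.1, hv.1.2.2] at hmain
  set F := Real.exp (-(l * μ)) * (l * μ + 1) with hF
  have hlμ : 0 < l * μ := by positivity
  have hF0 : 0 < F := by positivity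
  have hFexp : Real.exp (-(μ * l)) ≤ F := by
    rw [hF, mul_comm μ l]
    exact le_mul_of_one_le_right (Real.exp_pos _).le (by linarith)
  have hFl : l * Real.exp (-(μ * l)) ≤ μ⁻¹ * F := by
    rw [hF, mul_comm μ l]
    have : l = μ⁻¹ * (l * μ) := by field_simp
    calc l * Real.exp (-(l * μ)) = μ⁻¹ * (Real.exp (-(l * μ)) * (l * μ)) := by
          field_simp
      _ ≤ _ := by gcongr; linarith
  have hT1 : |wellPrimitive W b q| * ω T / ε ≤ N₁ * (F + X) := by
    calc |wellPrimitive W b q| * ω T / ε ≤ C * r ^ 2 * ω T / ε := by gcongr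
      _ = C * ω T * (r ^ 2 / ε) := by ring
      _ ≤ C * ω T * (B₀ ^ 2 * X) := by gcongr
      _ = N₁ * X := by rw [hN₁]; ring
      _ ≤ _ := by gcongr; linarith
  -- Here the mismatch `ε ^ γ` of the data at `0` is divided by `ε`, so `γ > 1` is needed again.
  have hT2 : |wellPrimitive W b p - wellPrimitive W b α| * ω 0 / ε ≤ N₂ * (F + X) := by
    have h1 := hLip p (hmemR hp) α (hmemR hα)
    calc |wellPrimitive W b p - wellPrimitive W b α| * ω 0 / ε
        ≤ Lφ * (A₀ * ε ^ γ) * ω 0 / ε := by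
          gcongr
          exact h1.trans (by gcongr)
      _ = N₂ * ε ^ (γ - 1) := by rw [hN₂, hεγ]; field_simp
      _ ≤ N₂ * (F + X) := by gcongr; linarith
  -- The Hölder modulus of `ω'` is split at `t = √ε`: small before it, while `Φ ∘ v` has decayed after
  -- it. This gives the exponent `d / 2`.
  have hT3 : (K * √ε ^ (d : ℝ) * (∫ t in (0 : ℝ)..T, |wellPrimitive W b (v t)|) +
      K * T ^ (d : ℝ) * ∫ t in √ε..T, |wellPrimitive W b (v t)|) / ε ≤ N₃ * (F + X) := by
    have e1 : √ε ^ (d : ℝ) ≤ X := by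
      rw [Real.sqrt_eq_rpow, ← Real.rpow_mul hε0.le]
      exact hpow (by rw [one_div, inv_mul_eq_div]; exact min_le_left _ _)
    have e2 : (∫ t in (0 : ℝ)..T, |wellPrimitive W b (v t)|) / ε ≤ C * (1 + B₀ ^ 2) := by
      have := hint 0 ⟨le_rfl, hT.le⟩
      rw [zero_div, mul_zero, neg_zero, Real.exp_zero, mul_one] at this
      calc _ ≤ C * (ε + r ^ 2) / ε := by gcongr
        _ = C * (1 + r ^ 2 / ε) := by field_simp
        _ ≤ C * (1 + B₀ ^ 2) := by
          gcongr
          exact hρ1.trans (mul_le_of_le_one_right (by positivity) hX1)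
    have e3 : (∫ t in √ε..T, |wellPrimitive W b (v t)|) / ε ≤ C * ((μ⁻¹ + B₀ ^ 2) * X) := by
      have := hint (√ε) ⟨Real.sqrt_nonneg _, hsε⟩
      have hs0 : 0 < √ε := Real.sqrt_pos.2 hε0
      have h1 : Real.exp (-(μ * (√ε / ε))) ≤ μ⁻¹ * X := by
        refine (exp_neg_le_inv (by positivity)).trans ?_
        have : (μ * (√ε / ε))⁻¹ = μ⁻¹ * √ε := by
          rw [Real.sqrt_div_self', mul_inv, one_div, inv_inv]
        rw [this]
        gcongr
      calc _ ≤ C * (ε * Real.exp (-(μ * (√ε / ε))) + r ^ 2) / ε := by gcongr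
        _ = C * (Real.exp (-(μ * (√ε / ε))) + r ^ 2 / ε) := by field_simp
        _ ≤ C * (μ⁻¹ * X + B₀ ^ 2 * X) := by gcongr
        _ = _ := by ring
    have e4 : 0 ≤ (∫ t in (0 : ℝ)..T, |wellPrimitive W b (v t)|) / ε :=
      div_nonneg (intervalIntegral.integral_nonneg hT.le fun t _ => abs_nonneg _) hε0.le
    calc _ = K * √ε ^ (d : ℝ) * ((∫ t in (0 : ℝ)..T, |wellPrimitive W b (v t)|) / ε) +
          K * T ^ (d : ℝ) * ((∫ t in √ε..T, |wellPrimitive W b (v t)|) / ε) := by ring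
      _ ≤ K * X * (C * (1 + B₀ ^ 2)) + K * T ^ (d : ℝ) * (C * ((μ⁻¹ + B₀ ^ 2) * X)) := by
          gcongr
      _ = N₃ * X := by rw [hN₃]; ring
      _ ≤ _ := by gcongr; linarith
  -- If `ε * l ≥ T`, the truncation at `T` leaves only the boundary value, which is controlled by `r`.
  have hT45 : (∫ t in min (ε * l) T..T, |wellPrimitive W b (v t)|) / ε ≤ N₄ * (F + X) ∧
      min (ε * l) T * |wellPrimitive W b (v (min (ε * l) T))| / ε ≤ N₅ * (F + X) := by
    rcases le_total (ε * l) T with h | h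
    · rw [min_eq_left h]
      have hεl : ε * l ∈ Icc 0 T := ⟨by positivity, h⟩
      have e : ε * l / ε = l := mul_div_cancel_left₀ _ hε0.ne'
      have h1 := hint _ hεl
      have h2 := hpt _ hεl
      rw [e] at h1 h2
      constructor
      · calc _ ≤ C * (ε * Real.exp (-(μ * l)) + r ^ 2) / ε := by gcongr
          _ = C * (Real.exp (-(μ * l)) + r ^ 2 / ε) := by field_simp
          _ ≤ C * (F + B₀ ^ 2 * X) := by gcongr
          _ ≤ C * ((1 + B₀ ^ 2) * (F + X)) := by
            gcongr
            have : 0 ≤ B₀ ^ 2 * F := by positivity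
            linarith
          _ = _ := by rw [hN₄]; ring
      · have hlT : l ≤ T / ε := by rw [le_div_iff₀ hε0]; linarith
        calc _ ≤ ε * l * (C * (Real.exp (-(μ * l)) + r ^ 2 / ε)) / ε := by gcongr
          _ = C * (l * Real.exp (-(μ * l)) + l * (r ^ 2 / ε)) := by field_simp
          _ ≤ C * (μ⁻¹ * F + T / ε * (r ^ 2 / ε)) := by gcongr
          _ = C * (μ⁻¹ * F + T * (r ^ 2 / ε / ε)) := by ring
          _ ≤ C * (μ⁻¹ * F + T * (B₀ ^ 2 * X)) := by gcongr
          _ ≤ C * ((μ⁻¹ + T * B₀ ^ 2) * (F + X)) := by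
            gcongr
            have : 0 ≤ μ⁻¹ * X := by positivity
            have : 0 ≤ T * B₀ ^ 2 * F := by positivity
            linarith
          _ = _ := by rw [hN₅]; ring
    · rw [min_eq_right h, intervalIntegral.integral_same, zero_div, hv.1.2.2]
      refine ⟨by positivity, ?_⟩
      calc T * |wellPrimitive W b q| / ε ≤ T * (C * r ^ 2) / ε := by gcongr
        _ = C * (T * (r ^ 2 / ε)) := by ring
        _ ≤ C * (T * (B₀ ^ 2 * X)) := by gcongr
        _ ≤ C * ((μ⁻¹ + T * B₀ ^ 2) * (F + X)) := by
            refine mul_le_mul_of_nonneg_left ?_ hC.le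
            have : 0 ≤ μ⁻¹ * (F + X) := by positivity
            have : 0 ≤ T * B₀ ^ 2 * F := by positivity
            linarith
        _ = _ := by rw [hN₅]; ring
  refine le_trans ?_ hmain
  have hsum := add_le_add (add_le_add (add_le_add hT1 hT2) hT3)
    (mul_le_mul_of_nonneg_left (add_le_add hT45.1 hT45.2) (abs_nonneg ω'))
  set Y₁ := |wellPrimitive W b q| * ω T
  set Y₂ := |wellPrimitive W b p - wellPrimitive W b α| * ω 0
  set Y₃ := K * √ε ^ (d : ℝ) * (∫ t in (0 : ℝ)..T, |wellPrimitive W b (v t)|) +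
      K * T ^ (d : ℝ) * ∫ t in √ε..T, |wellPrimitive W b (v t)|
  set Y₄ := ∫ t in min (ε * l) T..T, |wellPrimitive W b (v t)|
  set Y₅ := min (ε * l) T * |wellPrimitive W b (v (min (ε * l) T))|
  have e : 2 / ε * (Y₁ + Y₂ + Y₃ + |ω'| * (Y₄ + Y₅)) =
    2 * (Y₁ / ε + Y₂ / ε + Y₃ / ε + |ω'| * (Y₄ / ε + Y₅ / ε)) := by ring
  rw [e]
  linarith

/-! ### Convergence of the rescaled profiles -/

/-- Grönwall's inequality in integral form. -/
lemma le_mul_exp_of_le_add_integral {D : ℝ → ℝ} {δ L l : ℝ} (hl : 0 ≤ l)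
    (hD : ContinuousOn D (Icc 0 l)) (hD0 : ∀ s ∈ Icc 0 l, 0 ≤ D s) (hδ : 0 ≤ δ) (hL : 0 ≤ L)
    (h : ∀ s ∈ Icc 0 l, D s ≤ δ + L * ∫ r in (0 : ℝ)..s, D r) :
    ∀ s ∈ Icc 0 l, D s ≤ δ * Real.exp (L * s) := by
  set D' : ℝ → ℝ := fun s => D (max 0 (min l s)) with hD'
  have hmem : ∀ s, max 0 (min l s) ∈ Icc 0 l := fun s =>
    ⟨le_max_left _ _, max_le hl (min_le_left _ _)⟩
  have hD'c : Continuous D' := hD.comp_continuous (by fun_prop) hmem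
  have hD'0 : ∀ s, 0 ≤ D' s := fun s => hD0 _ (hmem s)
  have heq : ∀ s ∈ Icc 0 l, D' s = D s := fun s hs => by
    simp only [hD', min_eq_right hs.2, max_eq_right hs.1]
  have hint : ∀ s ∈ Icc 0 l, ∫ r in (0 : ℝ)..s, D r = ∫ r in (0 : ℝ)..s, D' r := fun s hs =>
    intervalIntegral.integral_congr fun r hr => by
      rw [uIcc_of_le hs.1] at hr
      exact (heq r ⟨hr.1, hr.2.trans hs.2⟩).symm
  set H : ℝ → ℝ := fun s => δ + L * ∫ r in (0 : ℝ)..s, D' r with hH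
  have hle : ∀ s ∈ Icc 0 l, D s ≤ H s := fun s hs => by
    simp only [hH, ← hint s hs]; exact h s hs
  have hd : ∀ s, HasDerivAt H (L * D' s) s := fun s =>
    ((hD'c.integral_hasStrictDerivAt 0 s).hasDerivAt.const_mul L).const_add δ
  have hgr := norm_le_gronwallBound_of_norm_deriv_right_le (f := H) (f' := fun s => L * D' s)
    (δ := δ) (K := L) (ε := 0) (a := 0) (b := l)
    (fun s _ => (hd s).continuousAt.continuousWithinAt) (fun s _ => (hd s).hasDerivWithinAt)
    (by simp [hH, abs_of_nonneg hδ])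
    (fun s hs => by
      have hs' : s ∈ Icc 0 l := ⟨hs.1, hs.2.le⟩
      rw [norm_mul, Real.norm_eq_abs, Real.norm_eq_abs, abs_of_nonneg hL,
        abs_of_nonneg (hD'0 s), heq s hs', add_zero]
      gcongr
      exact (hle s hs').trans (le_abs_self _))
  intro s hs
  have := hgr s hs
  rw [gronwallBound_ε0, sub_zero] at this
  exact (hle s hs).trans ((le_abs_self _).trans this)

section Convergence

variable {W ω v z : ℝ → ℝ} {T ε b α : ℝ}

lemma IsCauchySolution.continuous (hz : IsCauchySolution W α z) : Continuous z :=
  continuous_iff_continuousAt.2 fun t => (hz.1 t).continuousAt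

lemma IsCauchySolution.isH1 (hz : IsCauchySolution W α z) (hW : Continuous W) (l : ℝ) :
    IsH1 l z := by
  have hd : deriv z = fun t => √(W (z t)) := funext fun t => (hz.1 t).deriv
  have hc : Continuous (deriv z) := by
    rw [hd]; exact Real.continuous_sqrt.comp (hW.comp hz.continuous)
  refine ⟨ContDiffOn.absolutelyContinuousOnInterval (ContDiff.contDiffOn ?_), ?_⟩
  · exact contDiff_one_iff_deriv.2 ⟨fun t => (hz.1 t).differentiableAt, hc⟩
  · obtain ⟨M, hM⟩ := (isCompact_Icc (a := (0 : ℝ)) (b := l)).exists_bound_of_continuousOn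
      hc.continuousOn
    refine MemLp.of_bound hc.aestronglyMeasurable M ?_
    filter_upwards [ae_restrict_mem measurableSet_Ioo] with t ht using hM t (Ioo_subset_Icc_self ht)

/-- A small equipartition defect forces `v(ε ·)` to stay close to the solution of the Cauchy
problem. -/
lemma abs_sub_le_of_integral_equipartitionDefect_le (hv : IsH1 T v) (hT : 0 ≤ T) (hW : Continuous W)
    (hW0 : ∀ s, 0 ≤ W s) (hε : 0 < ε) (hz : IsCauchySolution W α z) {L R κ l : ℝ} (hL : 0 ≤ L)
    (hκ : 0 < κ) (hLip : ∀ x ∈ Icc (-R) R, ∀ y ∈ Icc (-R) R, |√(W x) - √(W y)| ≤ L * |x - y|)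
    (hvR : ∀ t ∈ Icc 0 T, v t ∈ Icc (-R) R) (hl : 0 ≤ l) (hzR : ∀ s ∈ Icc 0 l, z s ∈ Icc (-R) R)
    (hεl : ε * l ≤ T)
    (hdef : ∫ t in (0 : ℝ)..T, equipartitionDefect W ε v t ≤ ε * κ ^ 2) :
    ∀ s ∈ Icc 0 l, |v (ε * s) - z s| ≤ (|v 0 - α| + κ * (l + 1) / 2) * Real.exp (L * l) := by
  have hscale : ∀ s ∈ Icc 0 l, ε * s ∈ Icc 0 T := fun s hs =>
    ⟨mul_nonneg hε.le hs.1, (mul_le_mul_of_nonneg_left hs.2 hε.le).trans hεl⟩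
  have hvc := hv.continuousOn hT
  have hvs : ContinuousOn (fun s => v (ε * s)) (Icc 0 l) :=
    hvc.comp (continuous_const.mul continuous_id).continuousOn hscale
  have hsq : Continuous fun x => √(W x) := Real.continuous_sqrt.comp hW
  have hδ : 0 ≤ |v 0 - α| + κ * (l + 1) / 2 := by positivity
  have hdi := hv.intervalIntegrable_equipartitionDefect hW hW0 hT ε
  have hri : IntervalIntegrable (fun t => ε * deriv v t - √(W (v t))) volume 0 T := by
    refine (hv.1.intervalIntegrable_deriv.const_mul ε).sub (ContinuousOn.intervalIntegrable ?_)
    rw [uIcc_of_le hT]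
    exact hsq.comp_continuousOn hvc
  have hgr := le_mul_exp_of_le_add_integral (D := fun s => |v (ε * s) - z s|) hl
    (hvs.sub hz.continuous.continuousOn).abs (fun s _ => abs_nonneg _) hδ hL fun s hs => ?_
  · intro s hs
    refine (hgr s hs).trans ?_
    gcongr
    exact hs.2
  · have hεs := hscale s hs
    have hvi : IntervalIntegrable (fun σ => √(W (v (ε * σ)))) volume 0 s := by
      apply ContinuousOn.intervalIntegrable
      rw [uIcc_of_le hs.1]
      exact hsq.comp_continuousOn (hvs.mono (Icc_subset_Icc le_rfl hs.2))
    have hzi : IntervalIntegrable (fun σ => √(W (z σ))) volume 0 s :=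
      (hsq.comp hz.continuous).intervalIntegrable _ _
    have hDi : IntervalIntegrable (fun σ => |v (ε * σ) - z σ|) volume 0 s := by
      apply ContinuousOn.intervalIntegrable
      rw [uIcc_of_le hs.1]
      exact ((hvs.sub hz.continuous.continuousOn).abs).mono (Icc_subset_Icc le_rfl hs.2)
    have hz1 : z s = α + ∫ σ in (0 : ℝ)..s, √(W (z σ)) := by
      rw [intervalIntegral.integral_eq_sub_of_hasDerivAt (fun t _ => hz.1 t) hzi, hz.2]; ring
    have hri' := intervalIntegrable_mono hri le_rfl hεs.1 hεs.2
    have hv1 : v (ε * s) = v 0 + (∫ t in (0 : ℝ)..ε * s, (ε * deriv v t - √(W (v t)))) / ε +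
        ∫ σ in (0 : ℝ)..s, √(W (v (ε * σ))) := by
      have hac : AbsolutelyContinuousOnInterval v 0 (ε * s) := hv.1.mono (by
        rw [uIcc_of_le hεs.1, uIcc_of_le hT]; exact Icc_subset_Icc le_rfl hεs.2)
      have h1 := hac.integral_deriv_eq_sub
      have h2 := intervalIntegral.integral_comp_mul_left (a := 0) (b := s)
        (fun t => √(W (v t))) hε.ne'
      rw [mul_zero, smul_eq_mul] at h2
      have hwi : IntervalIntegrable (fun t => √(W (v t))) volume 0 (ε * s) := by
        apply ContinuousOn.intervalIntegrable
        rw [uIcc_of_le hεs.1]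
        exact hsq.comp_continuousOn (hvc.mono (Icc_subset_Icc le_rfl hεs.2))
      rw [h2, intervalIntegral.integral_sub (hac.intervalIntegrable_deriv.const_mul ε) hwi,
        intervalIntegral.integral_const_mul, h1]
      field_simp
      ring
    have hr1 : |∫ t in (0 : ℝ)..ε * s, (ε * deriv v t - √(W (v t)))| / ε ≤ κ * (l + 1) / 2 := by
      rw [div_le_iff₀ hε]
      have hdi' := intervalIntegrable_mono hdi le_rfl hεs.1 hεs.2
      -- The weighted inequality `|x| ≤ (κ + x² / κ) / 2` replaces Cauchy–Schwarz.
      have h1 : ∫ t in (0 : ℝ)..ε * s, |ε * deriv v t - √(W (v t))| ≤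
          ∫ t in (0 : ℝ)..ε * s, (κ / 2 + (2 * κ)⁻¹ * equipartitionDefect W ε v t) := by
        refine intervalIntegral.integral_mono_on hεs.1 hri'.abs
          (intervalIntegrable_const.add (hdi'.const_mul _)) fun t _ => ?_
        have e : (2 * κ)⁻¹ * equipartitionDefect W ε v t =
            (ε * deriv v t - √(W (v t))) ^ 2 / (2 * κ) := by
          rw [equipartitionDefect]; field_simp; ring
        rw [e, ← sq_abs (ε * deriv v t - √(W (v t)))]
        set y := |ε * deriv v t - √(W (v t))|
        have : κ / 2 + y ^ 2 / (2 * κ) - y = (κ - y) ^ 2 / (2 * κ) := by field_simp; ring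
        have : 0 ≤ (κ - y) ^ 2 / (2 * κ) := by positivity
        linarith
      have h2 : ∫ t in (0 : ℝ)..ε * s, equipartitionDefect W ε v t ≤ ε * κ ^ 2 := by
        refine le_trans ?_ hdef
        rw [← intervalIntegral.integral_add_adjacent_intervals hdi'
          (intervalIntegrable_mono hdi hεs.1 hεs.2 le_rfl)]
        linarith [intervalIntegral.integral_nonneg (μ := volume)
          (f := equipartitionDefect W ε v) hεs.2 fun t _ => sq_nonneg _]
      rw [intervalIntegral.integral_add intervalIntegrable_const (hdi'.const_mul _),
        intervalIntegral.integral_const, intervalIntegral.integral_const_mul, smul_eq_mul,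
        sub_zero] at h1
      have h3 : (2 * κ)⁻¹ * ∫ t in (0 : ℝ)..ε * s, equipartitionDefect W ε v t ≤
          (2 * κ)⁻¹ * (ε * κ ^ 2) := by gcongr
      have h4 : (2 * κ)⁻¹ * (ε * κ ^ 2) = ε * κ / 2 := by field_simp
      have h5 : ε * s * (κ / 2) ≤ ε * l * (κ / 2) := by
        have := hs.2
        gcongr
      have h6 := intervalIntegral.abs_integral_le_integral_abs (μ := volume)
        (f := fun t => ε * deriv v t - √(W (v t))) hεs.1
      calc _ ≤ _ := h6
        _ ≤ ε * s * (κ / 2) + ε * κ / 2 := by linarith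
        _ ≤ ε * l * (κ / 2) + ε * κ / 2 := by linarith
        _ = _ := by ring
    have hlip : |∫ σ in (0 : ℝ)..s, (√(W (v (ε * σ))) - √(W (z σ)))| ≤
        L * ∫ σ in (0 : ℝ)..s, |v (ε * σ) - z σ| := by
      refine (intervalIntegral.abs_integral_le_integral_abs hs.1).trans ?_
      rw [← intervalIntegral.integral_const_mul]
      refine intervalIntegral.integral_mono_on hs.1 (hvi.sub hzi).abs (hDi.const_mul _)
        fun σ hσ => ?_
      have hσ' : σ ∈ Icc 0 l := ⟨hσ.1, hσ.2.trans hs.2⟩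
      exact hLip _ (hvR _ (hscale σ hσ')) _ (hzR σ hσ')
    have e : v (ε * s) - z s = (v 0 - α) +
        (∫ t in (0 : ℝ)..ε * s, (ε * deriv v t - √(W (v t)))) / ε +
        ∫ σ in (0 : ℝ)..s, (√(W (v (ε * σ))) - √(W (z σ))) := by
      rw [hv1, hz1, intervalIntegral.integral_sub hvi hzi]; ring
    have h7 := abs_add_three (v 0 - α)
      ((∫ t in (0 : ℝ)..ε * s, (ε * deriv v t - √(W (v t)))) / ε)
      (∫ σ in (0 : ℝ)..s, (√(W (v (ε * σ))) - √(W (z σ))))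
    rw [abs_div, abs_of_pos hε] at h7
    simp only [e]
    linarith

/-- The moment is stable under uniform convergence of the profile. -/
lemma abs_moment_sub_moment_le (hv : IsH1 T v) (hT : 0 ≤ T) (hW : Continuous W) (hε : 0 < ε)
    (hz : IsCauchySolution W α z) (b : ℝ) {L R D l : ℝ} (hL : 0 ≤ L)
    (hLip : ∀ x ∈ Icc (-R) R, ∀ y ∈ Icc (-R) R,
      |wellPrimitive W b x - wellPrimitive W b y| ≤ L * |x - y|)
    (hvR : ∀ t ∈ Icc 0 T, v t ∈ Icc (-R) R) (hl : 0 ≤ l) (hzR : ∀ s ∈ Icc 0 l, z s ∈ Icc (-R) R)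
    (hεl : ε * l ≤ T) (hD : ∀ s ∈ Icc 0 l, |v (ε * s) - z s| ≤ D) :
    |(∫ s in (0 : ℝ)..l, momentIntegrand W (rescale T ε v) s) -
      ∫ s in (0 : ℝ)..l, momentIntegrand W z s| ≤ 2 * l * L * D := by
  have hscale : ∀ s ∈ Icc 0 l, ε * s ∈ Icc 0 T := fun s hs =>
    ⟨mul_nonneg hε.le hs.1, (mul_le_mul_of_nonneg_left hs.2 hε.le).trans hεl⟩
  have hpt : ∀ s ∈ Icc 0 l, |wellPrimitive W b (v (ε * s)) - wellPrimitive W b (z s)| ≤ L * D :=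
    fun s hs => (hLip _ (hvR _ (hscale s hs)) _ (hzR s hs)).trans
      (mul_le_mul_of_nonneg_left (hD s hs) hL)
  have h1 := hv.integral_momentIntegrand_rescale hT hW hε b hl
  rw [min_eq_left hεl] at h1
  have h2 : ∫ s in (0 : ℝ)..l, momentIntegrand W z s =
      wellPrimitive W b (z l) * l - ∫ t in (0 : ℝ)..l, wellPrimitive W b (z t) :=
    (hz.isH1 hW l).integral_sqrt_mul_deriv_mul_id hW b hl le_rfl
  have h3 := intervalIntegral.integral_comp_mul_left (a := 0) (b := l)
    (fun t => wellPrimitive W b (v t)) hε.ne'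
  rw [mul_zero, smul_eq_mul, inv_mul_eq_div] at h3
  have hvi : IntervalIntegrable (fun s => wellPrimitive W b (v (ε * s))) volume 0 l := by
    apply ContinuousOn.intervalIntegrable
    rw [uIcc_of_le hl]
    exact (hv.continuousOn_wellPrimitive hT hW b).comp
      (continuous_const.mul continuous_id).continuousOn hscale
  have hzi : IntervalIntegrable (fun s => wellPrimitive W b (z s)) volume 0 l :=
    ((continuous_wellPrimitive hW).comp hz.continuous).intervalIntegrable _ _
  have e : (∫ s in (0 : ℝ)..l, momentIntegrand W (rescale T ε v) s) -
      ∫ s in (0 : ℝ)..l, momentIntegrand W z s =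
      (wellPrimitive W b (v (ε * l)) - wellPrimitive W b (z l)) * l -
      ∫ s in (0 : ℝ)..l, (wellPrimitive W b (v (ε * s)) - wellPrimitive W b (z s)) := by
    rw [intervalIntegral.integral_sub hvi hzi, h3, h1, h2]
    field_simp
    ring
  have h4 : ‖∫ s in (0 : ℝ)..l, (wellPrimitive W b (v (ε * s)) - wellPrimitive W b (z s))‖ ≤
      L * D * |l - 0| := by
    refine intervalIntegral.norm_integral_le_of_norm_le_const fun s hs => ?_
    rw [uIoc_of_le hl] at hs
    exact hpt s ⟨hs.1.le, hs.2⟩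
  rw [sub_zero, abs_of_nonneg hl, Real.norm_eq_abs] at h4
  have h5 : |(wellPrimitive W b (v (ε * l)) - wellPrimitive W b (z l)) * l| ≤ L * D * l := by
    rw [abs_mul, abs_of_nonneg hl]
    exact mul_le_mul_of_nonneg_right (hpt l ⟨hl, le_rfl⟩) hl
  rw [e]
  calc _ ≤ _ := abs_sub _ _
    _ ≤ L * D * l + L * D * l := add_le_add h5 h4
    _ = _ := by ring

end Convergence

/-- The equipartition defect of minimizers is `o(ε)`, uniformly in the boundary data. -/
lemma exists_integral_equipartitionDefect_le {W ω : ℝ → ℝ} {T a b c : ℝ}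
    (hW : IsDoubleWell W a b c) (hT : 0 < T)
    (hω : IsWeight T ω) {αm ω₀ B : ℝ} (hαm : a < αm) (hαmb : αm < b) (hω₀ : 0 ≤ ω₀)
    (hω₀' : ω₀ < 1 / 2 * (dW W a αm / CW W a b) * ω 0)
    (hclose : ∀ t ∈ Ioc 0 T, ω 0 - ω₀ < ω t) (hB : 0 < B) {η : ℝ} (hη : 0 < η) :
    ∃ ε₁ : ℝ, 0 < ε₁ ∧ ∀ ε ∈ Ioo 0 ε₁, ∀ p ∈ Icc αm b, ∀ q ∈ Icc αm b, |q - b| ≤ B * ε →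
      ∀ v, IsMinimizer W ω T ε p q v →
        ∫ t in (0 : ℝ)..T, equipartitionDefect W ε v t ≤ ε * η := by
  have hWc := hW.contDiff.continuous
  obtain ⟨R, ε₁, C, μ, hε₁, hε₁1, hC, hμ, hest⟩ :=
    exists_wellPrimitive_estimates hW hT hω hαm hαmb hω₀ hω₀' hclose hB
  obtain ⟨t₀, ht₀, hmin⟩ := isCompact_Icc.exists_isMinOn
    (nonempty_Icc.2 hT.le) hω.continuousOn
  set m := ω t₀ with hm
  have hm0 : 0 < m := hω.pos t₀ ht₀
  have hmω : ∀ t ∈ Icc 0 T, m ≤ ω t := fun t ht => hmin ht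
  obtain ⟨ε₂, hε₂, hrec⟩ := exists_admissible_le_of_isDoubleWell hW hT hω hB
    (by positivity : 0 < m * η / 2)
  obtain ⟨D', hD'⟩ := (isCompact_Icc (a := (0 : ℝ)) (b := T)).exists_bound_of_continuousOn
    (hω.continuousOn_weightDeriv hT)
  have hD0 : 0 ≤ D' := (norm_nonneg _).trans (hD' 0 ⟨le_rfl, hT.le⟩)
  have hωT : 0 < ω T := hω.pos T ⟨hT.le, le_rfl⟩
  set M := 2 * (C * B ^ 2 * ω T + D' * (C * (1 + B ^ 2))) with hM
  have hM0 : 0 < M := by positivity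
  refine ⟨min ε₁ (min ε₂ (m * η / 2 / M)), by positivity, ?_⟩
  intro ε hε p hp q hq hqb v hv
  have hε0 := hε.1
  have hεε₁ : ε < ε₁ := hε.2.trans_le (min_le_left _ _)
  have hεε₂ : ε < ε₂ := hε.2.trans_le ((min_le_right _ _).trans (min_le_left _ _))
  have hεM : ε * M ≤ m * η / 2 := by
    have := (hε.2.trans_le ((min_le_right _ _).trans (min_le_right _ _))).le
    rwa [le_div_iff₀ hM0] at this
  have hε1 : ε ≤ 1 := (hεε₁.trans hε₁1).le
  obtain ⟨-, hΦq, hint, -⟩ := hest ε ⟨hε0, hεε₁⟩ p hp q hq (B * ε) hqb le_rfl v hv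
  have hH1 := hv.1.1
  obtain ⟨u, hu, hule⟩ := hrec ε ⟨hε0, hεε₂⟩ p ⟨hαm.le.trans hp.1, hp.2⟩ q
    ⟨hαm.le.trans hq.1, hq.2⟩ hqb
  have hvle : ∫ t in (0 : ℝ)..T, energyDensity W ω ε v t ≤
      ε * (-2 * wellPrimitive W b p * ω 0 + m * η / 2) := (hv.2 u hu).trans hule
  rw [hH1.integral_energyDensity_eq hWc hW.nonneg hT.le hω b ε, hv.1.2.1, hv.1.2.2] at hvle
  have hdi := hH1.intervalIntegrable_equipartitionDefect hWc hW.nonneg hT.le ε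
  have hωc : ContinuousOn ω (uIcc 0 T) := by rw [uIcc_of_le hT.le]; exact hω.continuousOn
  have h1 : m * ∫ t in (0 : ℝ)..T, equipartitionDefect W ε v t ≤
      ∫ t in (0 : ℝ)..T, equipartitionDefect W ε v t * ω t := by
    rw [← intervalIntegral.integral_const_mul]
    refine intervalIntegral.integral_mono_on hT.le (hdi.const_mul _)
      (hdi.mul_continuousOn hωc) fun t ht => ?_
    rw [mul_comm]
    exact mul_le_mul_of_nonneg_left (hmω t ht) (sq_nonneg _)
  have hΦi := hH1.intervalIntegrable_wellPrimitive hT.le hWc b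
  have hω'c : ContinuousOn (weightDeriv T ω) (uIcc 0 T) := by
    rw [uIcc_of_le hT.le]; exact hω.continuousOn_weightDeriv hT
  have h2 : ∫ t in (0 : ℝ)..T, wellPrimitive W b (v t) * weightDeriv T ω t ≤
      D' * (C * (1 + B ^ 2)) * ε := by
    calc _ ≤ ∫ t in (0 : ℝ)..T, D' * |wellPrimitive W b (v t)| := by
          refine intervalIntegral.integral_mono_on hT.le (hΦi.mul_continuousOn hω'c)
            (hΦi.abs.const_mul _) fun t ht => ?_
          refine (le_abs_self _).trans ?_
          rw [abs_mul, mul_comm]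
          gcongr
          exact hD' t ht
      _ = D' * ∫ t in (0 : ℝ)..T, |wellPrimitive W b (v t)| :=
          intervalIntegral.integral_const_mul _ _
      _ ≤ D' * (C * (ε + (B * ε) ^ 2)) := by
          gcongr
          have := hint 0 ⟨le_rfl, hT.le⟩
          rwa [zero_div, mul_zero, neg_zero, Real.exp_zero, mul_one] at this
      _ ≤ D' * (C * ((1 + B ^ 2) * ε)) := by
          gcongr
          have : B ^ 2 * ε ^ 2 ≤ B ^ 2 * ε := by
            gcongr
            exact pow_le_of_le_one hε0.le hε1 two_ne_zero
          linarith [mul_pow B ε 2]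
      _ = _ := by ring
  have h3 : -(C * B ^ 2 * ω T * ε) ≤ wellPrimitive W b q * ω T := by
    calc -(C * B ^ 2 * ω T * ε) ≤ -(C * (B * ε) ^ 2 * ω T) := by
          have : ε ^ 2 ≤ ε := pow_le_of_le_one hε0.le hε1 two_ne_zero
          have : C * B ^ 2 * ω T * ε ^ 2 ≤ C * B ^ 2 * ω T * ε := by gcongr
          linarith [show C * (B * ε) ^ 2 * ω T = C * B ^ 2 * ω T * ε ^ 2 by ring]
      _ ≤ -(|wellPrimitive W b q| * ω T) := by gcongr
      _ ≤ _ := by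
          rw [← neg_mul]
          gcongr
          exact neg_abs_le _
  set J := ∫ t in (0 : ℝ)..T, wellPrimitive W b (v t) * weightDeriv T ω t
  set I := ∫ t in (0 : ℝ)..T, equipartitionDefect W ε v t
  have h4 : m * I ≤ ε * (m * η) := by
    have e1 : ε * (2 * (J - wellPrimitive W b q * ω T)) ≤ ε * (ε * M) := by
      refine mul_le_mul_of_nonneg_left ?_ hε0.le
      rw [hM]
      linarith
    have e2 : ε * (ε * M) ≤ ε * (m * η / 2) := by gcongr
    linarith
  have h5 : m * I ≤ m * (ε * η) := by linarith
  exact le_of_mul_le_mul_left h5 hm0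

/-! ### The limit of the moments -/

section Family

variable {W ω : ℝ → ℝ} {T a b c : ℝ}

lemma tendsto_of_abs_sub_le_rpow {f : ℝ → ℝ} {A γ x : ℝ} (hγ : 0 < γ)
    (h : ∀ ε ∈ Ioo (0 : ℝ) 1, |f ε - x| ≤ A * ε ^ γ) : Tendsto f (𝓝[>] 0) (𝓝 x) := by
  have h1 : Tendsto (fun ε : ℝ => A * ε ^ γ) (𝓝[>] 0) (𝓝 0) := by
    have := ((Real.continuousAt_rpow_const 0 γ (Or.inr hγ.le)).tendsto.const_mul A).mono_left
      (nhdsWithin_le_nhds (s := Ioi 0))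
    rwa [Real.zero_rpow hγ.ne', mul_zero] at this
  rw [tendsto_iff_norm_sub_tendsto_zero]
  refine squeeze_zero' (Eventually.of_forall fun _ => norm_nonneg _) ?_ h1
  filter_upwards [Ioo_mem_nhdsGT (zero_lt_one (α := ℝ))] with ε hε using h ε hε

lemma abs_sub_le_mul_of_rpow {ε γ B x y : ℝ} (hε : ε ∈ Ioo (0 : ℝ) 1) (hγ : 1 < γ) (hB : 0 < B)
    (h : |x - y| ≤ B * ε ^ γ) : |x - y| ≤ B * ε := by
  refine h.trans (mul_le_mul_of_nonneg_left ?_ hB.le)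
  calc ε ^ γ ≤ ε ^ (1 : ℝ) := Real.rpow_le_rpow_of_exponent_ge hε.1 hε.2.le hγ.le
    _ = ε := Real.rpow_one ε

/-- Convergence of the moments on bounded intervals. -/
lemma tendsto_moment (hW : IsDoubleWell W a b c) (hT : 0 < T) (hω : IsWeight T ω)
    {αm ω₀ A B γ α : ℝ} (hαm : a < αm) (hαmb : αm < b) (hω₀ : 0 ≤ ω₀)
    (hω₀' : ω₀ < 1 / 2 * (dW W a αm / CW W a b) * ω 0)
    (hclose : ∀ t ∈ Ioc 0 T, ω 0 - ω₀ < ω t) (hB : 0 < B) (hγ : 1 < γ)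
    {αε βε : ℝ → ℝ} {v : ℝ → ℝ → ℝ}
    (hmem : ∀ ε ∈ Ioo (0 : ℝ) 1, αε ε ∈ Icc αm b ∧ βε ε ∈ Icc αm b)
    (hα : ∀ ε ∈ Ioo (0 : ℝ) 1, |αε ε - α| ≤ A * ε ^ γ)
    (hβ : ∀ ε ∈ Ioo (0 : ℝ) 1, |βε ε - b| ≤ B * ε ^ γ)
    (hv : ∀ ε ∈ Ioo (0 : ℝ) 1, IsMinimizer W ω T ε (αε ε) (βε ε) (v ε))
    {z : ℝ → ℝ} (hz : IsCauchySolution W α z) {l : ℝ} (hl : 0 < l) :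
    Tendsto (fun ε => ∫ s in (0 : ℝ)..l, momentIntegrand W (rescale T ε (v ε)) s) (𝓝[>] 0)
      (𝓝 (∫ s in (0 : ℝ)..l, momentIntegrand W z s)) := by
  have hWc := hW.contDiff.continuous
  obtain ⟨R₀, ε₁, C, μ, hε₁, -, hC, hμ, hest⟩ :=
    exists_wellPrimitive_estimates hW hT hω hαm hαmb hω₀ hω₀' hclose hB
  obtain ⟨R₁, hR₁⟩ := (isCompact_Icc (a := (0 : ℝ)) (b := l)).exists_bound_of_continuousOn
    hz.continuous.continuousOn
  set R := max R₀ R₁ with hR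
  obtain ⟨L, hL, hLip⟩ := exists_lipschitz_sqrt hW.contDiff hW.nonneg R
  obtain ⟨L', hL', hLip'⟩ := exists_lipschitz_wellPrimitive hWc b R
  have hzR : ∀ s ∈ Icc 0 l, z s ∈ Icc (-R) R := fun s hs =>
    abs_le.1 ((hR₁ s hs).trans (le_max_right _ _))
  rw [Metric.tendsto_nhds]
  intro η hη
  set Q := 2 * l * L' * ((1 + (l + 1) / 2) * Real.exp (L * l)) with hQ
  have hQ0 : 0 < Q := by positivity
  set κ := η / (2 * Q) with hκ
  have hκ0 : 0 < κ := by positivity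
  obtain ⟨ε₂, hε₂, hdef⟩ := exists_integral_equipartitionDefect_le hW hT hω hαm hαmb hω₀ hω₀'
    hclose hB (by positivity : 0 < κ ^ 2)
  have hαlim := (Metric.tendsto_nhds.1 (tendsto_of_abs_sub_le_rpow (by linarith) hα)) κ hκ0
  filter_upwards [hαlim, Ioo_mem_nhdsGT (zero_lt_one (α := ℝ)), Ioo_mem_nhdsGT hε₁,
    Ioo_mem_nhdsGT hε₂, Ioo_mem_nhdsGT (div_pos hT hl)] with ε h1 h2 h3 h4 h5
  have hβε := abs_sub_le_mul_of_rpow h2 hγ hB (hβ ε h2)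
  have hεl : ε * l ≤ T := by have := h5.2.le; rwa [le_div_iff₀ hl] at this
  have hvε := hv ε h2
  obtain ⟨hvR, -⟩ := hest ε h3 _ (hmem ε h2).1 _ (hmem ε h2).2 (B * ε) hβε le_rfl _ hvε
  have hvR' : ∀ t ∈ Icc 0 T, v ε t ∈ Icc (-R) R := fun t ht =>
    Icc_subset_Icc (neg_le_neg (le_max_left _ _)) (le_max_left _ _) (hvR t ht)
  have hD := abs_sub_le_of_integral_equipartitionDefect_le hvε.1.1 hT.le hWc hW.nonneg h2.1 hz hL.le
    hκ0 hLip hvR' hl.le hzR hεl (hdef ε h4 _ (hmem ε h2).1 _ (hmem ε h2).2 hβε _ hvε)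
  have hfin := abs_moment_sub_moment_le hvε.1.1 hT.le hWc h2.1 hz b hL'.le hLip' hvR' hl.le hzR hεl hD
  rw [Real.dist_eq] at h1 ⊢
  refine hfin.trans_lt ?_
  rw [hvε.1.2.1]
  calc 2 * l * L' * ((|αε ε - α| + κ * (l + 1) / 2) * Real.exp (L * l))
      ≤ 2 * l * L' * ((κ + κ * (l + 1) / 2) * Real.exp (L * l)) := by gcongr
    _ = Q * κ := by rw [hQ]; ring
    _ = η / 2 := by rw [hκ]; field_simp
    _ < η := by linarith

/-- The moments of minimizers are bounded uniformly in `l` as `ε → 0⁺`. -/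
lemma exists_abs_moment_le (hW : IsDoubleWell W a b c) (hT : 0 < T) (hω : IsWeight T ω)
    {αm ω₀ B γ : ℝ} (hαm : a < αm) (hαmb : αm < b) (hω₀ : 0 ≤ ω₀)
    (hω₀' : ω₀ < 1 / 2 * (dW W a αm / CW W a b) * ω 0)
    (hclose : ∀ t ∈ Ioc 0 T, ω 0 - ω₀ < ω t) (hB : 0 < B) (hγ : 1 < γ)
    {αε βε : ℝ → ℝ} {v : ℝ → ℝ → ℝ}
    (hmem : ∀ ε ∈ Ioo (0 : ℝ) 1, αε ε ∈ Icc αm b ∧ βε ε ∈ Icc αm b)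
    (hβ : ∀ ε ∈ Ioo (0 : ℝ) 1, |βε ε - b| ≤ B * ε ^ γ)
    (hv : ∀ ε ∈ Ioo (0 : ℝ) 1, IsMinimizer W ω T ε (αε ε) (βε ε) (v ε)) :
    ∃ M : ℝ, ∀ l : ℝ, 0 < l → ∀ᶠ ε in 𝓝[>] 0,
      |∫ s in (0 : ℝ)..l, momentIntegrand W (rescale T ε (v ε)) s| ≤ M := by
  have hWc := hW.contDiff.continuous
  obtain ⟨R₀, ε₁, C, μ, hε₁, -, hC, hμ, hest⟩ :=
    exists_wellPrimitive_estimates hW hT hω hαm hαmb hω₀ hω₀' hclose hB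
  refine ⟨C * (μ⁻¹ + B ^ 2) + C * (1 + B ^ 2), fun l hl => ?_⟩
  filter_upwards [Ioo_mem_nhdsGT (zero_lt_one (α := ℝ)), Ioo_mem_nhdsGT hε₁,
    Ioo_mem_nhdsGT (div_pos hT hl), Ioo_mem_nhdsGT (one_div_pos.2 hl)] with ε h2 h3 h5 h6
  have hε0 := h2.1
  have hβε := abs_sub_le_mul_of_rpow h2 hγ hB (hβ ε h2)
  have hεl : ε * l ≤ T := by have := h5.2.le; rwa [le_div_iff₀ hl] at this
  have hlε : l * ε ≤ 1 := by have := h6.2.le; rw [le_div_iff₀ hl] at this; linarith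
  have hvε := hv ε h2
  obtain ⟨-, -, hint, hpt⟩ := hest ε h3 _ (hmem ε h2).1 _ (hmem ε h2).2 (B * ε) hβε le_rfl _ hvε
  have hεl0 : 0 ≤ ε * l := by positivity
  rw [hvε.1.1.integral_momentIntegrand_rescale hT.le hWc hε0 b hl.le, min_eq_left hεl]
  have h7 := hpt (ε * l) ⟨hεl0, hεl⟩
  rw [mul_div_cancel_left₀ _ hε0.ne'] at h7
  have h8 := hint 0 ⟨le_rfl, hT.le⟩
  rw [zero_div, mul_zero, neg_zero, Real.exp_zero, mul_one] at h8
  have hΦi := (hvε.1.1.intervalIntegrable_wellPrimitive hT.le hWc b).abs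
  have h9 : |∫ t in (0 : ℝ)..ε * l, wellPrimitive W b (v ε t)| ≤ C * (ε + (B * ε) ^ 2) := by
    refine (intervalIntegral.abs_integral_le_integral_abs hεl0).trans (le_trans ?_ h8)
    rw [← intervalIntegral.integral_add_adjacent_intervals
      (intervalIntegrable_mono hΦi le_rfl hεl0 hεl) (intervalIntegrable_mono hΦi hεl0 hεl le_rfl)]
    linarith [intervalIntegral.integral_nonneg (μ := volume)
      (f := fun t => |wellPrimitive W b (v ε t)|) hεl fun t _ => abs_nonneg _]
  have h10 : l * Real.exp (-(μ * l)) ≤ μ⁻¹ := by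
    calc l * Real.exp (-(μ * l)) ≤ l * (μ * l)⁻¹ := by
          gcongr
          exact exp_neg_le_inv (by positivity)
      _ = μ⁻¹ := by field_simp
  have h11 : |wellPrimitive W b (v ε (ε * l)) * (ε * l)| / ε ≤ C * (μ⁻¹ + B ^ 2) := by
    rw [abs_mul, abs_of_nonneg hεl0]
    calc _ ≤ C * (Real.exp (-(μ * l)) + (B * ε) ^ 2 / ε) * (ε * l) / ε := by gcongr
      _ = C * (l * Real.exp (-(μ * l)) + B ^ 2 * (l * ε)) := by field_simp
      _ ≤ C * (μ⁻¹ + B ^ 2 * 1) := by gcongr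
      _ = _ := by rw [mul_one]
  have h12 : |∫ t in (0 : ℝ)..ε * l, wellPrimitive W b (v ε t)| / ε ≤ C * (1 + B ^ 2) := by
    calc _ ≤ C * (ε + (B * ε) ^ 2) / ε := by gcongr
      _ = C * (1 + B ^ 2 * ε) := by field_simp
      _ ≤ C * (1 + B ^ 2 * 1) := by
        have := h2.2.le
        gcongr
      _ = _ := by rw [mul_one]
  rw [abs_div, abs_of_pos hε0]
  calc _ ≤ (|wellPrimitive W b (v ε (ε * l)) * (ε * l)| +
        |∫ t in (0 : ℝ)..ε * l, wellPrimitive W b (v ε t)|) / ε := by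
        gcongr
        exact abs_sub _ _
    _ = _ := add_div _ _ _
    _ ≤ _ := add_le_add h11 h12

/-- Along a Cauchy solution the moment integrand is nonnegative, so bounded moments make it
integrable. -/
lemma IsCauchySolution.integrableOn_momentIntegrand {z : ℝ → ℝ} {α M : ℝ}
    (hz : IsCauchySolution W α z) (hW : Continuous W)
    (hM : ∀ l : ℝ, 0 < l → |∫ s in (0 : ℝ)..l, momentIntegrand W z s| ≤ M) :
    IntegrableOn (momentIntegrand W z) (Ioi 0) := by
  have hd : deriv z = fun t => √(W (z t)) := funext fun t => (hz.1 t).deriv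
  have hc : Continuous (momentIntegrand W z) := by
    have h1 : Continuous fun t => √(W (z t)) := Real.continuous_sqrt.comp (hW.comp hz.continuous)
    have : momentIntegrand W z = fun s => √(W (z s)) * √(W (z s)) * s := by
      funext s; rw [momentIntegrand, hd]
    rw [this]
    exact (h1.mul h1).mul continuous_id
  refine integrableOn_Ioi_of_intervalIntegral_norm_bounded (l := atTop) (b := id) M 0
    (fun l => hc.integrableOn_Ioc) tendsto_id ?_
  filter_upwards [eventually_gt_atTop 0] with l hl
  refine le_trans (le_of_eq ?_) ((le_abs_self _).trans (hM l hl))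
  refine intervalIntegral.integral_congr fun s hs => ?_
  rw [id, uIcc_of_le hl.le] at hs
  have h0 : 0 ≤ momentIntegrand W z s := by
    rw [momentIntegrand, hd]
    have := hs.1
    positivity
  simp only [Real.norm_eq_abs, abs_of_nonneg h0]

end Family

end CahnHilliard1D

theorem theorem3p10
    (W : ℝ → ℝ) (a b c : ℝ) (hW : CahnHilliard1D.IsDoubleWell W a b c)
    (αm : ℝ) (hαm : a < αm) (hαm' : αm < min c ((a + b) / 2))
    (T : ℝ) (hT : 0 < T)
    (ω : ℝ → ℝ) (hω : CahnHilliard1D.IsWeight T ω)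
    (ω₀ : ℝ) (hω₀ : 0 ≤ ω₀)
    (hω₀' : ω₀ < 1 / 2 * (CahnHilliard1D.dW W a αm / CahnHilliard1D.CW W a b) * ω 0)
    (hω_close : ∀ t ∈ Ioc 0 T, ω 0 - ω₀ < ω t)
    (A₀ B₀ : ℝ) (hA₀ : 0 < A₀) (hB₀ : 0 < B₀) :
    ∃ ε₀ C l₀ μ γ₀ : ℝ, 0 < ε₀ ∧ ε₀ < 1 ∧ 0 < C ∧ 1 < l₀ ∧ 0 < μ ∧ 0 < γ₀ ∧
      ∀ γ : ℝ, 1 < γ → ∃ γ₁ : ℝ, 0 < γ₁ ∧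
        ∀ (α : ℝ) (αε βε : ℝ → ℝ) (v : ℝ → ℝ → ℝ),
          (∀ ε ∈ Ioo (0 : ℝ) 1, αε ε ∈ Icc αm b ∧ βε ε ∈ Icc αm b) →
          (∀ ε ∈ Ioo (0 : ℝ) 1, |αε ε - α| ≤ A₀ * ε ^ γ ∧ |βε ε - b| ≤ B₀ * ε ^ γ) →
          (∀ ε ∈ Ioo (0 : ℝ) 1, CahnHilliard1D.IsMinimizer W ω T ε (αε ε) (βε ε) (v ε)) →
          (∀ ε ∈ Ioo 0 ε₀, ∀ l : ℝ, l₀ < l →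
            2 * CahnHilliard1D.weightDeriv T ω 0 *
                (∫ s in (0 : ℝ)..l,
                  CahnHilliard1D.momentIntegrand W (CahnHilliard1D.rescale T ε (v ε)) s)
              - C * Real.exp (-(l * μ)) * (l * μ + 1)
              - C * ε ^ (1 / 2 : ℝ) * l ^ 2
              - C * ε ^ γ₁ * |Real.log ε| ^ (2 + γ₀)
            ≤ CahnHilliard1D.G2 W ω T b α ε (v ε)) ∧
          ∀ z : ℝ → ℝ, CahnHilliard1D.IsCauchySolution W α z →
            (∀ l : ℝ, 0 < l →
              Tendsto
                (fun ε => ∫ s in (0 : ℝ)..l,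
                  CahnHilliard1D.momentIntegrand W (CahnHilliard1D.rescale T ε (v ε)) s)
                (𝓝[>] 0)
                (𝓝 (∫ s in (0 : ℝ)..l, CahnHilliard1D.momentIntegrand W z s))) ∧
            IntegrableOn (CahnHilliard1D.momentIntegrand W z) (Ioi 0) ∧
            ((2 * CahnHilliard1D.weightDeriv T ω 0 *
                ∫ s in Ioi (0 : ℝ), CahnHilliard1D.momentIntegrand W z s : ℝ) : EReal)
              ≤ liminf (fun ε => (CahnHilliard1D.G2 W ω T b α ε (v ε) : EReal)) (𝓝[>] 0) := by
  have hαmb : αm < b := (hαm'.trans_le (min_le_left _ _)).trans hW.lt_right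
  obtain ⟨ε₀, N, μ, hε₀, hε₀1, hN, hμ, hmain⟩ := CahnHilliard1D.exists_moment_sub_le_G2 hW hT hω
    hαm hαmb hω₀ hω₀' hω_close hA₀ hB₀
  -- Below `exp (-1)` the factor `|log ε| ^ (2 + γ₀)` is at least one; the estimate holds for all
  -- `l > 0`, and any `l₀ > 1` and `γ₀ > 0` will do.
  refine ⟨min ε₀ (Real.exp (-1)), N, 2, μ, 1, lt_min hε₀ (Real.exp_pos _),
    (min_le_left _ _).trans_lt hε₀1, hN, one_lt_two, hμ, one_pos, fun γ hγ => ?_⟩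
  obtain ⟨γ₁, hγ₁, hG⟩ := hmain γ hγ
  refine ⟨γ₁, hγ₁, fun α αε βε v hmem hclose hv => ?_⟩
  -- `α` is the limit of `αε`, so it inherits the bounds.
  have hα : α ∈ Icc αm b := by
    refine isClosed_Icc.mem_of_tendsto
      (CahnHilliard1D.tendsto_of_abs_sub_le_rpow (γ := γ) (by linarith) fun ε hε => (hclose ε hε).1) ?_
    filter_upwards [Ioo_mem_nhdsGT (zero_lt_one (α := ℝ))] with ε hε using (hmem ε hε).1
  have key : ∀ ε ∈ Ioo 0 ε₀, ∀ l : ℝ, 0 < l → _ := fun ε hε l hl =>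
    have hε1 : ε ∈ Ioo (0 : ℝ) 1 := ⟨hε.1, hε.2.trans hε₀1⟩
    hG ε hε _ (hmem ε hε1).1 _ (hmem ε hε1).2 α hα (hclose ε hε1).1 (hclose ε hε1).2 _ (hv ε hε1) l hl
  refine ⟨fun ε hε l hl => ?_, fun z hz => ?_⟩
  · have hε0 : 0 < ε := hε.1
    refine le_trans ?_ (key ε ⟨hε0, hε.2.trans_le (min_le_left _ _)⟩ l (by linarith))
    have hlog : 1 ≤ |Real.log ε| := by
      have h1 : Real.log ε < -1 := by
        rw [Real.log_lt_iff_lt_exp hε0]; exact hε.2.trans_le (min_le_right _ _)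
      rw [abs_of_neg (by linarith)]
      linarith
    have h2 : 1 ≤ |Real.log ε| ^ (2 + 1 : ℝ) := Real.one_le_rpow hlog (by norm_num)
    have h3 : 0 < ε ^ γ₁ := Real.rpow_pos_of_pos hε0 _
    have h4 : N * ε ^ γ₁ ≤ N * ε ^ γ₁ * |Real.log ε| ^ (2 + 1 : ℝ) :=
      le_mul_of_one_le_right (by positivity) h2
    have h5 : 0 ≤ N * ε ^ (1 / 2 : ℝ) * l ^ 2 := by
      have := Real.rpow_nonneg hε0.le (1 / 2)
      positivity
    generalize N * ε ^ γ₁ * |Real.log ε| ^ (2 + 1 : ℝ) = Y₁ at h4 ⊢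
    generalize N * ε ^ (1 / 2 : ℝ) * l ^ 2 = Y₂ at h5 ⊢
    linarith
  · have hlim : ∀ l : ℝ, 0 < l → Tendsto (fun ε => ∫ s in (0 : ℝ)..l,
        CahnHilliard1D.momentIntegrand W (CahnHilliard1D.rescale T ε (v ε)) s) (𝓝[>] 0)
        (𝓝 (∫ s in (0 : ℝ)..l, CahnHilliard1D.momentIntegrand W z s)) := fun l hl =>
      CahnHilliard1D.tendsto_moment hW hT hω hαm hαmb hω₀ hω₀' hω_close hB₀ hγ hmem
        (fun ε hε => (hclose ε hε).1) (fun ε hε => (hclose ε hε).2) hv hz hl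
    obtain ⟨M, hM⟩ := CahnHilliard1D.exists_abs_moment_le hW hT hω hαm hαmb hω₀ hω₀' hω_close hB₀
      hγ hmem (fun ε hε => (hclose ε hε).2) hv
    have hint := hz.integrableOn_momentIntegrand hW.contDiff.continuous
      fun l hl => le_of_tendsto (hlim l hl).abs (hM l hl)
    refine ⟨hlim, hint, ?_⟩
    -- First `ε → 0⁺` at fixed `l`, where `ε ^ γ₁` disappears, then `l → ∞`.
    have hl : ∀ l : ℝ, 0 < l → ((2 * CahnHilliard1D.weightDeriv T ω 0 *
        (∫ s in (0 : ℝ)..l, CahnHilliard1D.momentIntegrand W z s) -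
        N * (Real.exp (-(l * μ)) * (l * μ + 1)) : ℝ) : EReal) ≤
        liminf (fun ε => (CahnHilliard1D.G2 W ω T b α ε (v ε) : EReal)) (𝓝[>] 0) := by
      intro l hl
      have h1 : Tendsto (fun ε : ℝ => ε ^ γ₁) (𝓝[>] 0) (𝓝 0) := by
        have := (Real.continuousAt_rpow_const 0 γ₁ (Or.inr hγ₁.le)).tendsto.mono_left
          (nhdsWithin_le_nhds (s := Ioi 0))
        rwa [Real.zero_rpow hγ₁.ne'] at this
      have h2 := ((hlim l hl).const_mul (2 * CahnHilliard1D.weightDeriv T ω 0)).sub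
        ((h1.const_add (Real.exp (-(l * μ)) * (l * μ + 1))).const_mul N)
      rw [add_zero] at h2
      rw [← ((continuous_coe_real_ereal.tendsto _).comp h2).liminf_eq]
      refine liminf_le_liminf ?_
      filter_upwards [Ioo_mem_nhdsGT hε₀] with ε hε
      exact EReal.coe_le_coe_iff.2 (key ε hε l hl)
    have h1 := (intervalIntegral_tendsto_integral_Ioi 0 hint tendsto_id).const_mul
      (2 * CahnHilliard1D.weightDeriv T ω 0)
    have h2 : Tendsto (fun l : ℝ => N * (Real.exp (-(l * μ)) * (l * μ + 1))) atTop (𝓝 0) := by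
      have h3 := (Real.tendsto_pow_mul_exp_neg_atTop_nhds_zero 1).add
        (Real.tendsto_pow_mul_exp_neg_atTop_nhds_zero 0)
      have h4 := (h3.comp (tendsto_id.atTop_mul_const hμ)).const_mul N
      rw [add_zero, mul_zero] at h4
      refine h4.congr fun l => ?_
      simp only [Function.comp_apply, id, pow_one, pow_zero]
      ring
    have h3 := h1.sub h2
    rw [sub_zero] at h3
    refine le_of_tendsto ((continuous_coe_real_ereal.tendsto _).comp h3) ?_
    filter_upwards [eventually_gt_atTop 0] with l hl' using hl l hl'
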